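/- All vector spaces are real: $L^2(\mathbb{R}^N)=L^2(\mathbb{R}^N;\mathbb{C})$ has the scalar product $\langle u,v\rangle_{L^2}=\Re\int_{\mathbb{R}^N}u\,\overline v\,dx$ (and $\langle u,v\rangle_{L^2}=\Re\int u\cdot\overline v\,dx$ for $\mathbb{C}^N$-valued functions), $X^\star$ is the space of continuous $\mathbb{R}$-linear maps $X\to\mathbb{R}$, and $\mathscr{D}'(\mathbb{R}^N)$ is the space of continuous $\mathbb{R}$-linear maps $\mathscr{D}(\mathbb{R}^N;\mathbb{C})\to\mathbb{R}$, where $f\in L^1_{\mathrm{loc}}$ is identified with $\varphi\mapsto\Re\int f\,\overline\varphi\,dx$. Let $H^1(\mathbb{R}^N)$ be the space of $u\in L^2(\mathbb{R}^N)$ with $\nabla u\in L^2(\mathbb{R}^N;\mathbb{C}^N)$, with scalar product $\langle u,v\rangle_{L^2}+\langle\nabla u,\nabla v\rangle_{L^2}$, and let $H^{-1}(\mathbb{R}^N)=H^1(\mathbb{R}^N)^\star$. Let $N\ge1$, let $\{Q_j\}_j$ be the open unit cubes $z+(0,1)^N$, $z\in\mathbb{Z}^N$, and let $A\in L^2_{\mathrm{loc}}(\mathbb{R}^N;\mathbb{R}^N)$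 satisfy $A\in L^p_{\mathrm{loc}}(\mathbb{R}^N;\mathbb{R}^N)$ and $\sup_j\|A\|_{L^p(Q_j)}<\infty$, where $p=N$ if $N\ge3$, $p=2+\varepsilon$ for some $\varepsilon>0$ if $N=2$, and $p=2$ if $N=1$. Write $\nabla_A u=(\nabla+\mathrm{i}A)u$ and $-\Delta_A u=(-\mathrm{i}\nabla+A)^2u$, in the sense of distributions. 1. If $u\in H^1(\mathbb{R}^N)$ then $\nabla_Au\in L^2(\mathbb{R}^N;\mathbb{C}^N)$ and $-\Delta_Au\in H^{-1}(\mathbb{R}^N)$, that is, there is exactly one element of $H^{-1}(\mathbb{R}^N)$ whose restriction to $\mathscr{D}(\mathbb{R}^N)$ is the distribution $-\Delta_Au$; and for any $v\in H^1(\mathbb{R}^N)$, $$\langle-\Delta_Au,v\rangle_{H^{-1},H^1}=\langle\nabla_Au,\nabla_Av\rangle_{L^2}.$$ 2. Let in addition $V\in L^1_{\mathrm{loc}}(\mathbb{R}^N;\mathbb{R})$ with $\operatorname{ess\,inf}V>0$, let $$H^1_{A,V}(\mathbb{R}^N)=\{u\in L^2(\mathbb{R}^N):\ Vu^2\in L^1(\mathbb{R}^N),\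 \nabla_Au\in L^2(\mathbb{R}^N;\mathbb{C}^N)\}$$ with scalar product $\Re\int Vu\overline v\,dx+\langle\nabla_Au,\nabla_Av\rangle_{L^2}$, and let $H^{-1}_{A,V}(\mathbb{R}^N)=H^1_{A,V}(\mathbb{R}^N)^\star$. Then for any $T\in H^{-1}(\mathbb{R}^N)$ one has $T\in H^{-1}_{A,V}(\mathbb{R}^N)$, that is, there is exactly one element of $H^{-1}_{A,V}(\mathbb{R}^N)$ with the same restriction to $\mathscr{D}(\mathbb{R}^N)$ as $T$; and every $u\in H^1_{A,V}(\mathbb{R}^N)$ belongs to $H^1(\mathbb{R}^N)$ and satisfies $$\langle T,u\rangle_{H^{-1}_{A,V},H^1_{A,V}}=\langle T,u\rangle_{H^{-1},H^1}.$$ -/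

import Mathlib

open MeasureTheory Distributions
open scoped ENNReal ComplexConjugate

noncomputable section

namespace MagneticSobolev

/-! ### Function spaces and distributions on `ℝ^N`, over the scalar field `ℝ` -/

/-- The Euclidean space `ℝ^N`. -/
abbrev E (N : ℕ) := EuclideanSpace ℝ (Fin N)

/-- `L²(ℝ^N; ℂ)`; its real scalar product is `⟪u, v⟫ = Re ∫ u conj(v)`. -/
abbrev L2 (N : ℕ) := Lp ℂ 2 (volume : Measure (E N))

/-- `L²(ℝ^N; ℂ^N)`; its real scalar product is `⟪u, v⟫ = Re ∫ ∑ⱼ uⱼ conj(vⱼ)`. -/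
abbrev L2v (N : ℕ) := Lp (EuclideanSpace ℂ (Fin N)) 2 (volume : Measure (E N))

/-- Smooth compactly supported functions `ℝ^N → ℂ`, with the canonical LF topology. -/
abbrev TestFun (N : ℕ) := 𝓓((⊤ : TopologicalSpace.Opens (E N)), ℂ)

/-- Distributions on `ℝ^N`: continuous `ℝ`-linear maps from `TestFun N` to `ℝ`. -/
abbrev Distr (N : ℕ) := StrongDual ℝ (TestFun N)

/-- The vector `eⱼ` of the canonical basis of `ℝ^N`. -/
abbrev basisVec {N : ℕ} (j : Fin N) : E N := EuclideanSpace.single j (1 : ℝ)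

/-- The distribution `φ ↦ Re ∫ f conj(φ)` attached to a locally integrable function `f`
(the zero distribution if `f` is not locally integrable); note that the real scalar product of
`ℂ` is `⟪z, w⟫ = Re (w conj(z))`. -/
def toDistr {N : ℕ} (f : E N → ℂ) : Distr N :=
  TestFunction.integralAgainstBilinCLM (innerSL ℝ) volume f

/-- The distributional partial derivative, `⟨∂ⱼ T, φ⟩ = - ⟨T, ∂ⱼ φ⟩`. -/
def distrDeriv {N : ℕ} (j : Fin N) (T : Distr N) : Distr N :=
  -(T ∘L TestFunction.lineDerivCLM ℝ (basisVec j))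

/-- The product of a distribution by a complex number, `⟨c T, φ⟩ = ⟨T, conj(c) φ⟩`. -/
def distrSMul {N : ℕ} (c : ℂ) (T : Distr N) : Distr N :=
  T ∘L TestFunction.postcompCLM (ContinuousLinearMap.mul ℝ ℂ (conj c))

/-- `f ∈ L^p_loc(ℝ^N)`. -/
def MemLpLoc {N : ℕ} {F : Type*} [NormedAddCommGroup F] (f : E N → F) (p : ℝ≥0∞) : Prop :=
  ∀ K : Set (E N), IsCompact K → MemLp f p (volume.restrict K)

/-- The open unit cube `z + (0,1)^N`, for `z ∈ ℤ^N`. -/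
def unitCube {N : ℕ} (z : Fin N → ℤ) : Set (E N) :=
  {x | ∀ i, (z i : ℝ) < x i ∧ x i < (z i : ℝ) + 1}

/-- `f ∈ L^p_loc(ℝ^N)` and the supremum over all unit cubes `Q` with vertices in `ℤ^N` of
`‖f‖_{L^p(Q)}` is finite. -/
def MemLpUnif {N : ℕ} {F : Type*} [NormedAddCommGroup F] (f : E N → F) (p : ℝ≥0∞) : Prop :=
  MemLpLoc f p ∧ (⨆ z : Fin N → ℤ, eLpNorm f p (volume.restrict (unitCube z))) < ∞

/-- The assumption on the magnetic potential: uniformly local integrability with exponent `N` if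
`N ≥ 3`, with some exponent `2 + ε > 2` if `N = 2`, with exponent `2` if `N = 1`. -/
def MagneticCondition {N : ℕ} (A : E N → E N) : Prop :=
  (3 ≤ N → MemLpUnif A N) ∧
  (N = 2 → ∃ ε : ℝ, 0 < ε ∧ MemLpUnif A (ENNReal.ofReal (2 + ε))) ∧
  (N = 1 → MemLpUnif A 2)

/-- The assumption on the electric potential: `V ∈ L¹_loc` and `ess inf V > 0`. -/
def ElectricCondition {N : ℕ} (V : E N → ℝ) : Prop :=
  LocallyIntegrable V volume ∧ ∃ ν : ℝ, 0 < ν ∧ ∀ᵐ x, ν ≤ V x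

/-! ### Gradients and magnetic differential operators -/

/-- The distribution `∂ⱼ f + i Aⱼ f`, the `j`-th component of `(∇ + iA) f`. -/
def covDeriv {N : ℕ} (A : E N → E N) (j : Fin N) (f : E N → ℂ) : Distr N :=
  distrDeriv j (toDistr f) + toDistr (fun x => Complex.I * (A x j : ℂ) * f x)

/-- The distribution `-i ∂ⱼ f + Aⱼ f`, the `j`-th component of `(-i∇ + A) f`. -/
def momentum {N : ℕ} (A : E N → E N) (j : Fin N) (f : E N → ℂ) : Distr N :=
  distrSMul (-Complex.I) (distrDeriv j (toDistr f)) + toDistr (fun x => (A x j : ℂ) * f x)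

/-- `w ∈ L²(ℝ^N; ℂ^N)` is the distributional gradient of `u`. -/
def IsGrad {N : ℕ} (u : L2 N) (w : L2v N) : Prop :=
  ∀ j, distrDeriv j (toDistr u) = toDistr (fun x => w x j)

/-- `w ∈ L²(ℝ^N; ℂ^N)` is the distribution `∇_A u = (∇ + iA) u`. -/
def IsMagGrad {N : ℕ} (A : E N → E N) (u : L2 N) (w : L2v N) : Prop :=
  ∀ j, covDeriv A j u = toDistr (fun x => w x j)

open Classical in
/-- The gradient `∇u`, for `u ∈ L²` with distributional gradient in `L²` (otherwise `0`). -/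
def grad {N : ℕ} (u : L2 N) : L2v N :=
  if h : ∃ w, IsGrad u w then h.choose else 0

open Classical in
/-- The magnetic gradient `∇_A u`, for `u ∈ L²` with `∇_A u ∈ L²` (otherwise `0`). -/
def magGrad {N : ℕ} (A : E N → E N) (u : L2 N) : L2v N :=
  if h : ∃ w, IsMagGrad A u w then h.choose else 0

/-- The distribution `-Δ_A u = (-i∇ + A)² u = (-i∇ + A)·((-i∇ + A) u)`, for `u ∈ L²` with
`∇_A u ∈ L²`. The inner factor is the function `(-i∇ + A) u = -i ∇_A u`
(see `momentum_eq_of_isMagGrad`). -/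
def negMagLaplacian {N : ℕ} (A : E N → E N) (u : L2 N) : Distr N :=
  ∑ j, momentum A j (fun x => -Complex.I * magGrad A u x j)

/-! ### Basic facts on these operators -/

lemma toDistr_apply {N : ℕ} {f : E N → ℂ} (hf : LocallyIntegrable f volume) (φ : TestFun N) :
    toDistr f φ = ∫ x, (f x * conj (φ x)).re := by
  have : LocallyIntegrableOn f ((⊤ : TopologicalSpace.Opens (E N)) : Set (E N)) volume := by
    simpa [locallyIntegrableOn_univ] using hf
  rw [toDistr, TestFunction.integralAgainstBilinCLM_eq_integral this]
  rfl

lemma distrDeriv_apply {N : ℕ} (j : Fin N) (T : Distr N) (φ : TestFun N) :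
    distrDeriv j T φ = -T (TestFunction.lineDerivCLM ℝ (basisVec j) φ) := rfl

lemma distrSMul_apply {N : ℕ} (c : ℂ) (T : Distr N) (φ : TestFun N) :
    distrSMul c T φ = T (TestFunction.postcompCLM (ContinuousLinearMap.mul ℝ ℂ (conj c)) φ) :=
  rfl

lemma integrable_toDistr {N : ℕ} {f : E N → ℂ} (hf : LocallyIntegrable f volume)
    (φ : TestFun N) : Integrable (fun x => (f x * conj (φ x)).re) volume :=
  φ.integrable_bilin (innerSL ℝ) (hf.locallyIntegrableOn _)

lemma toDistr_add {N : ℕ} {f g : E N → ℂ} (hf : LocallyIntegrable f volume)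
    (hg : LocallyIntegrable g volume) :
    toDistr (fun x => f x + g x) = toDistr f + toDistr g := by
  ext φ
  have hfg : LocallyIntegrable (fun x => f x + g x) volume := hf.add hg
  rw [toDistr_apply hfg, add_apply, toDistr_apply hf,
    toDistr_apply hg, ← integral_add (integrable_toDistr hf φ) (integrable_toDistr hg φ)]
  congr; ext x; simp [add_mul]

lemma distrSMul_toDistr {N : ℕ} {f : E N → ℂ} (hf : LocallyIntegrable f volume) (c : ℂ) :
    distrSMul c (toDistr f) = toDistr (fun x => c * f x) := by
  ext φ
  have h : LocallyIntegrable (fun x => c * f x) volume := hf.smul c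
  rw [distrSMul_apply, toDistr_apply hf, toDistr_apply h]
  congr; ext x
  have : (TestFunction.postcompCLM (ContinuousLinearMap.mul ℝ ℂ (conj c)) φ : TestFun N) x
      = conj c * φ x := rfl
  rw [this]; congr 1; simp; ring

lemma toDistr_congr {N : ℕ} {f g : E N → ℂ} (h : f =ᵐ[volume] g) : toDistr f = toDistr g := by
  have hiff : LocallyIntegrable f volume ↔ LocallyIntegrable g volume :=
    ⟨fun hf => hf.congr h, fun hg => hg.congr h.symm⟩
  by_cases hf : LocallyIntegrable f volume
  · ext φ
    rw [toDistr_apply hf, toDistr_apply (hiff.1 hf)]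
    apply integral_congr_ae
    filter_upwards [h] with x hx
    rw [hx]
  · have hg := fun hg => hf (hiff.2 hg)
    rw [toDistr, toDistr, TestFunction.integralAgainstBilinCLM_eq_zero,
      TestFunction.integralAgainstBilinCLM_eq_zero] <;>
    simpa [locallyIntegrableOn_univ]

/-- A function in `L¹_loc` is determined by the distribution it defines. -/
lemma ae_eq_of_toDistr_eq {N : ℕ} {f g : E N → ℂ} (hf : LocallyIntegrable f volume)
    (hg : LocallyIntegrable g volume) (h : toDistr f = toDistr g) : f =ᵐ[volume] g := by
  have key : ∀ c : ℂ, (fun x => (f x * conj c).re) =ᵐ[volume] fun x => (g x * conj c).re := by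
    intro c
    have hL : ∀ k : E N → ℂ, LocallyIntegrable k volume →
        LocallyIntegrable (fun x => (k x * conj c).re) volume := fun k hk x => by
      obtain ⟨s, hs, hks⟩ := hk x
      exact ⟨s, hs, (hks.mul_const (conj c)).re⟩
    refine ae_eq_of_integral_contDiff_smul_eq (hL f hf) (hL g hg) fun ψ hψ hψc => ?_
    let φ : TestFun N := ⟨fun x => (ψ x : ℂ) * c,
      (Complex.ofRealCLM.contDiff.comp hψ).mul contDiff_const,
      (hψc.comp_left (g := fun t : ℝ => (t : ℂ) * c) (by simp)), by simp⟩
    have hφ := congrArg (fun T : Distr N => T φ) h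
    simp only [toDistr_apply hf, toDistr_apply hg] at hφ
    have e : ∀ k : E N → ℂ, ∀ x, ψ x • (k x * conj c).re = (k x * conj (φ x)).re := by
      intro k x
      change _ = (k x * conj ((ψ x : ℂ) * c)).re
      simp; ring
    simpa only [e] using hφ
  filter_upwards [key 1, key Complex.I] with x h1 h2
  apply Complex.ext
  · simpa using h1
  · simpa using h2

lemma locInt_of_memLpLoc {N : ℕ} {f : E N → ℂ} (hf : MemLpLoc f 2) :
    LocallyIntegrable f volume := by
  rw [locallyIntegrable_iff]
  intro K hK
  have : IsFiniteMeasure (volume.restrict K) := ⟨by simpa using hK.measure_lt_top⟩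
  exact (hf K hK).integrable (by norm_num)

lemma memLpLoc_L2 {N : ℕ} (u : L2 N) : MemLpLoc u 2 :=
  fun _ _ => (Lp.memLp u).restrict _

lemma memLp_coord {N : ℕ} {μ : Measure (E N)} {F : E N → EuclideanSpace ℂ (Fin N)} {p : ℝ≥0∞}
    (h : MemLp F p μ) (j : Fin N) : MemLp (fun x => F x j) p μ :=
  h.of_le ((PiLp.continuous_apply 2 _ j).comp_aestronglyMeasurable h.1)
    (Filter.Eventually.of_forall fun x => PiLp.norm_apply_le (F x) j)

lemma memLpLoc_L2v {N : ℕ} (w : L2v N) (j : Fin N) : MemLpLoc (fun x => w x j) 2 :=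
  fun _ _ => (memLp_coord (Lp.memLp w) j).restrict _

lemma memLpLoc_coord {N : ℕ} {A : E N → E N} (hA : MemLpLoc A 2) (j : Fin N) :
    MemLpLoc (fun x => (A x j : ℂ)) 2 := fun K hK =>
  (hA K hK).of_le
    ((Complex.continuous_ofReal.comp (PiLp.continuous_apply 2 (fun _ : Fin N => ℝ) j)
      ).comp_aestronglyMeasurable (hA K hK).1)
    (Filter.Eventually.of_forall fun x => by simpa using PiLp.norm_apply_le (A x) j)

/-- If `A` and `f` are in `L²_loc` then the components of `A f` are in `L¹_loc`. -/
lemma locInt_mul {N : ℕ} {A : E N → E N} (hA : MemLpLoc A 2) {f : E N → ℂ} (hf : MemLpLoc f 2)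
    (j : Fin N) : LocallyIntegrable (fun x => (A x j : ℂ) * f x) volume := by
  rw [locallyIntegrable_iff]
  intro K hK
  exact (memLpLoc_coord hA j K hK).integrable_mul (hf K hK)

lemma locInt_I_mul {N : ℕ} {A : E N → E N} (hA : MemLpLoc A 2) {f : E N → ℂ}
    (hf : MemLpLoc f 2) (j : Fin N) :
    LocallyIntegrable (fun x => Complex.I * (A x j : ℂ) * f x) volume := by
  have h : LocallyIntegrable (fun x => Complex.I * ((A x j : ℂ) * f x)) volume :=
    (locInt_mul hA hf j).smul Complex.I
  simpa only [mul_assoc] using h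

lemma distrSMul_add {N : ℕ} (c : ℂ) (S T : Distr N) :
    distrSMul c (S + T) = distrSMul c S + distrSMul c T := rfl

/-- If `∇_A u = w` then `(-i∇ + A) u = -i w`. -/
lemma momentum_eq_of_isMagGrad {N : ℕ} {A : E N → E N} (hA : MemLpLoc A 2) {u : L2 N}
    {w : L2v N} (h : IsMagGrad A u w) (j : Fin N) :
    momentum A j u = toDistr (fun x => -Complex.I * w x j) := by
  rw [← distrSMul_toDistr (locInt_of_memLpLoc (memLpLoc_L2v w j)), ← h j, covDeriv,
    distrSMul_add, distrSMul_toDistr (locInt_I_mul hA (memLpLoc_L2 u) j), momentum]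
  congr 2
  ext x
  linear_combination (A x j : ℂ) * u x * Complex.I_mul_I

lemma IsMagGrad.unique {N : ℕ} {A : E N → E N} {u : L2 N} {w w' : L2v N}
    (h : IsMagGrad A u w) (h' : IsMagGrad A u w') : w = w' := by
  have hj : ∀ j, (fun x => w x j) =ᵐ[volume] fun x => w' x j := fun j =>
    ae_eq_of_toDistr_eq (locInt_of_memLpLoc (memLpLoc_L2v w j))
      (locInt_of_memLpLoc (memLpLoc_L2v w' j)) ((h j).symm.trans (h' j))
  apply Lp.ext
  filter_upwards [ae_all_iff.2 hj] with x hx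
  ext j
  exact hx j

lemma isMagGrad_magGrad {N : ℕ} {A : E N → E N} {u : L2 N} (h : ∃ w, IsMagGrad A u w) :
    IsMagGrad A u (magGrad A u) := by
  rw [magGrad, dif_pos h]
  exact h.choose_spec

lemma IsMagGrad.magGrad_eq {N : ℕ} {A : E N → E N} {u : L2 N} {w : L2v N}
    (h : IsMagGrad A u w) : magGrad A u = w :=
  (isMagGrad_magGrad ⟨w, h⟩).unique h

lemma distrDeriv_add {N : ℕ} (j : Fin N) (S T : Distr N) :
    distrDeriv j (S + T) = distrDeriv j S + distrDeriv j T := by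
  ext φ; simp [distrDeriv_apply]; ring

lemma distrDeriv_distrSMul {N : ℕ} (j : Fin N) (c : ℝ) (T : Distr N) :
    distrDeriv j (c • T) = c • distrDeriv j T := by
  ext φ; simp [distrDeriv_apply]

lemma toDistr_smul {N : ℕ} {f : E N → ℂ} (hf : LocallyIntegrable f volume) (c : ℝ) :
    toDistr (fun x => c • f x) = c • toDistr f := by
  ext φ
  have hcf : LocallyIntegrable (fun x => c • f x) volume := hf.smul c
  rw [toDistr_apply hcf, smul_apply, toDistr_apply hf, smul_eq_mul,
    ← integral_const_mul]
  congr; ext x; simp; ring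

lemma toDistr_zero {N : ℕ} : toDistr (fun _ : E N => (0 : ℂ)) = 0 := by
  ext φ
  rw [toDistr_apply (locallyIntegrable_const 0)]
  simp

lemma IsMagGrad.add {N : ℕ} {A : E N → E N} (hA : MemLpLoc A 2) {u u' : L2 N} {w w' : L2v N}
    (h : IsMagGrad A u w) (h' : IsMagGrad A u' w') : IsMagGrad A (u + u') (w + w') := by
  intro j
  have e1 : toDistr (u + u' : L2 N) = toDistr u + toDistr u' := by
    rw [← toDistr_add (locInt_of_memLpLoc (memLpLoc_L2 u)) (locInt_of_memLpLoc (memLpLoc_L2 u'))]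
    exact toDistr_congr (Lp.coeFn_add u u')
  have e2 : toDistr (fun x => Complex.I * (A x j : ℂ) * (u + u' : L2 N) x) =
      toDistr (fun x => Complex.I * (A x j : ℂ) * u x) +
        toDistr (fun x => Complex.I * (A x j : ℂ) * u' x) := by
    rw [← toDistr_add (locInt_I_mul hA (memLpLoc_L2 u) j) (locInt_I_mul hA (memLpLoc_L2 u') j)]
    apply toDistr_congr
    filter_upwards [Lp.coeFn_add u u'] with x hx
    rw [hx, Pi.add_apply, mul_add]
  have e3 : toDistr (fun x => (w + w' : L2v N) x j) =
      toDistr (fun x => w x j) + toDistr (fun x => w' x j) := by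
    rw [← toDistr_add (locInt_of_memLpLoc (memLpLoc_L2v w j))
      (locInt_of_memLpLoc (memLpLoc_L2v w' j))]
    apply toDistr_congr
    filter_upwards [Lp.coeFn_add w w'] with x hx
    rw [hx]; rfl
  rw [e3, ← h j, ← h' j, covDeriv, covDeriv, covDeriv, e1, e2, distrDeriv_add]
  abel

lemma IsMagGrad.smul {N : ℕ} {A : E N → E N} (hA : MemLpLoc A 2) {u : L2 N} {w : L2v N}
    (c : ℝ) (h : IsMagGrad A u w) : IsMagGrad A (c • u) (c • w) := by
  intro j
  have e1 : toDistr (c • u : L2 N) = c • toDistr u := by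
    rw [← toDistr_smul (locInt_of_memLpLoc (memLpLoc_L2 u))]
    exact toDistr_congr (Lp.coeFn_smul c u)
  have e2 : toDistr (fun x => Complex.I * (A x j : ℂ) * (c • u : L2 N) x) =
      c • toDistr (fun x => Complex.I * (A x j : ℂ) * u x) := by
    rw [← toDistr_smul (locInt_I_mul hA (memLpLoc_L2 u) j)]
    apply toDistr_congr
    filter_upwards [Lp.coeFn_smul c u] with x hx
    rw [hx, Pi.smul_apply, mul_smul_comm]
  have e3 : toDistr (fun x => (c • w : L2v N) x j) = c • toDistr (fun x => w x j) := by
    rw [← toDistr_smul (locInt_of_memLpLoc (memLpLoc_L2v w j))]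
    apply toDistr_congr
    filter_upwards [Lp.coeFn_smul c w] with x hx
    rw [hx]; rfl
  rw [e3, ← h j, covDeriv, covDeriv, e1, e2, distrDeriv_distrSMul, smul_add]

lemma isMagGrad_zero {N : ℕ} (A : E N → E N) :
    IsMagGrad A (0 : L2 N) (0 : L2v N) := by
  intro j
  have e1 : toDistr (0 : L2 N) = 0 := by
    rw [← toDistr_zero]; exact toDistr_congr (Lp.coeFn_zero _ _ _)
  have e2 : toDistr (fun x => Complex.I * (A x j : ℂ) * (0 : L2 N) x) = 0 := by
    rw [← toDistr_zero]
    apply toDistr_congr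
    filter_upwards [Lp.coeFn_zero ℂ 2 (volume : Measure (E N))] with x hx
    rw [hx]; simp
  have e3 : toDistr (fun x => (0 : L2v N) x j) = 0 := by
    rw [← toDistr_zero]
    apply toDistr_congr
    filter_upwards [Lp.coeFn_zero (EuclideanSpace ℂ (Fin N)) 2 (volume : Measure (E N))] with x hx
    rw [hx]; rfl
  rw [covDeriv, e1, e2, e3]
  ext φ; simp [distrDeriv_apply]

lemma memLpLoc_zero {N : ℕ} : MemLpLoc (0 : E N → E N) 2 := fun _ _ => MemLp.zero

lemma isGrad_iff {N : ℕ} {u : L2 N} {w : L2v N} : IsGrad u w ↔ IsMagGrad 0 u w := by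
  have : ∀ j, covDeriv 0 j u = distrDeriv j (toDistr u) := fun j => by
    simp [covDeriv, toDistr_zero]
  simp only [IsGrad, IsMagGrad, this]

lemma isGrad_grad {N : ℕ} {u : L2 N} (h : ∃ w, IsGrad u w) : IsGrad u (grad u) := by
  rw [grad, dif_pos h]
  exact h.choose_spec

lemma IsGrad.grad_eq {N : ℕ} {u : L2 N} {w : L2v N} (h : IsGrad u w) : grad u = w :=
  (isGrad_iff.1 (isGrad_grad ⟨w, h⟩)).unique (isGrad_iff.1 h)

lemma IsGrad.add {N : ℕ} {u u' : L2 N} {w w' : L2v N} (h : IsGrad u w) (h' : IsGrad u' w') :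
    IsGrad (u + u') (w + w') :=
  isGrad_iff.2 ((isGrad_iff.1 h).add memLpLoc_zero (isGrad_iff.1 h'))

lemma IsGrad.smul {N : ℕ} {u : L2 N} {w : L2v N} (c : ℝ) (h : IsGrad u w) :
    IsGrad (c • u) (c • w) :=
  isGrad_iff.2 ((isGrad_iff.1 h).smul memLpLoc_zero c)

/-! ### The spaces `H¹(ℝ^N)` and `H¹_{A,V}(ℝ^N)` -/

/-- The functions `u ∈ L²(ℝ^N)` with `∇u ∈ L²(ℝ^N; ℂ^N)`. -/
def H1Submodule (N : ℕ) : Submodule ℝ (L2 N) where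
  carrier := {u | ∃ w, IsGrad u w}
  zero_mem' := ⟨0, isGrad_iff.2 (isMagGrad_zero 0)⟩
  add_mem' := fun ⟨_, h⟩ ⟨_, h'⟩ => ⟨_, h.add h'⟩
  smul_mem' := fun c _ ⟨_, h⟩ => ⟨_, h.smul c⟩

/-- The Sobolev space `H¹(ℝ^N)`, over the field `ℝ`. -/
def H1 (N : ℕ) : Type := ↥(H1Submodule N)

namespace H1

/-- The function underlying an element of `H¹(ℝ^N)`. -/
def toL2 {N : ℕ} (u : H1 N) : L2 N := Subtype.val u

instance {N : ℕ} : AddCommGroup (H1 N) := inferInstanceAs (AddCommGroup ↥(H1Submodule N))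
instance {N : ℕ} : Module ℝ (H1 N) := inferInstanceAs (Module ℝ ↥(H1Submodule N))

lemma grad_add {N : ℕ} (u v : H1 N) : grad (u + v).toL2 = grad u.toL2 + grad v.toL2 :=
  ((isGrad_grad u.2).add (isGrad_grad v.2)).grad_eq

lemma grad_smul {N : ℕ} (c : ℝ) (u : H1 N) : grad (c • u).toL2 = c • grad u.toL2 :=
  ((isGrad_grad u.2).smul c).grad_eq

/-- The scalar product `⟪u, v⟫_{H¹} = ⟪u, v⟫_{L²} + ⟪∇u, ∇v⟫_{L²}`. -/
@[reducible] def core (N : ℕ) : InnerProductSpace.Core ℝ (H1 N) where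
  inner u v := inner ℝ u.toL2 v.toL2 + inner ℝ (grad u.toL2) (grad v.toL2)
  conj_inner_symm u v := by simp [real_inner_comm]
  re_inner_nonneg u := add_nonneg real_inner_self_nonneg real_inner_self_nonneg
  add_left u v w := by
    have h : (u + v).toL2 = u.toL2 + v.toL2 := rfl
    rw [grad_add, h, inner_add_left, inner_add_left]; ring
  smul_left u v c := by
    have h : (c • u).toL2 = c • u.toL2 := rfl
    rw [grad_smul, h, real_inner_smul_left, real_inner_smul_left]; simp; ring
  definite u h := by
    have h1 : (0 : ℝ) ≤ inner ℝ u.toL2 u.toL2 := real_inner_self_nonneg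
    have h2 : (0 : ℝ) ≤ inner ℝ (grad u.toL2) (grad u.toL2) := real_inner_self_nonneg
    have h3 : inner ℝ u.toL2 u.toL2 = 0 := by linarith
    exact Subtype.ext (inner_self_eq_zero.1 h3)

instance {N : ℕ} : NormedAddCommGroup (H1 N) := (core N).toNormedAddCommGroup
instance {N : ℕ} : InnerProductSpace ℝ (H1 N) := InnerProductSpace.ofCore (core N).toCore

end H1

lemma integrable_mul_conj {N : ℕ} {V : E N → ℝ} (hV : ElectricCondition V) {u v : E N → ℂ}
    (hu : AEStronglyMeasurable u volume) (hv : AEStronglyMeasurable v volume)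
    (hVu : Integrable (fun x => (V x : ℂ) * u x ^ 2) volume)
    (hVv : Integrable (fun x => (V x : ℂ) * v x ^ 2) volume) :
    Integrable (fun x => (V x : ℂ) * u x * conj (v x)) volume := by
  have hVm : AEStronglyMeasurable (fun x => (V x : ℂ)) volume :=
    Complex.continuous_ofReal.comp_aestronglyMeasurable hV.1.aestronglyMeasurable
  refine (hVu.norm.add hVv.norm).mono'
    ((hVm.mul hu).mul (Complex.continuous_conj.comp_aestronglyMeasurable hv))
    (Filter.Eventually.of_forall fun x => ?_)
  simp only [norm_mul, norm_pow, RCLike.norm_conj, Pi.add_apply]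
  nlinarith [mul_nonneg (norm_nonneg (V x : ℂ)) (sq_nonneg (‖u x‖ - ‖v x‖)),
    mul_nonneg (norm_nonneg (V x : ℂ)) (sq_nonneg (‖u x‖ + ‖v x‖))]

lemma re_integral_self {N : ℕ} (V : E N → ℝ) (u : E N → ℂ) :
    (∫ x, (V x : ℂ) * u x * conj (u x)).re = ∫ x, V x * ‖u x‖ ^ 2 := by
  have h : ∀ x, (V x : ℂ) * u x * conj (u x) = ((V x * ‖u x‖ ^ 2 : ℝ) : ℂ) := fun x => by
    rw [mul_assoc, Complex.mul_conj, Complex.normSq_eq_norm_sq, Complex.ofReal_mul]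
  simp_rw [h]
  rw [integral_complex_ofReal, Complex.ofReal_re]

/-- The functions `u ∈ L²(ℝ^N)` with `V u² ∈ L¹(ℝ^N)` and `∇_A u ∈ L²(ℝ^N; ℂ^N)`. -/
def H1AVSubmodule {N : ℕ} (A : E N → E N) (V : E N → ℝ) (hA : MemLpLoc A 2)
    (hV : ElectricCondition V) : Submodule ℝ (L2 N) where
  carrier := {u | Integrable (fun x => (V x : ℂ) * u x ^ 2) volume ∧ ∃ w, IsMagGrad A u w}
  zero_mem' := by
    refine ⟨(integrable_zero _ _ _).congr ?_, 0, isMagGrad_zero A⟩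
    filter_upwards [Lp.coeFn_zero ℂ 2 (volume : Measure (E N))] with x hx
    rw [hx]; simp
  add_mem' := by
    rintro u v ⟨hu, w, hw⟩ ⟨hv, w', hw'⟩
    refine ⟨?_, _, hw.add hA hw'⟩
    have hVm : AEStronglyMeasurable (fun x => (V x : ℂ)) volume :=
      Complex.continuous_ofReal.comp_aestronglyMeasurable hV.1.aestronglyMeasurable
    have hum := Lp.aestronglyMeasurable u
    have hvm := Lp.aestronglyMeasurable v
    have h : Integrable (fun x => (V x : ℂ) * (u x + v x) ^ 2) volume := by
      refine ((hu.norm.add hv.norm).const_mul 2).mono' (hVm.mul ((hum.add hvm).pow 2))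
        (Filter.Eventually.of_forall fun x => ?_)
      simp only [norm_mul, norm_pow, Pi.add_apply]
      have h1 : ‖u x + v x‖ ^ 2 ≤ 2 * (‖u x‖ ^ 2 + ‖v x‖ ^ 2) := by
        nlinarith [norm_add_le (u x) (v x), norm_nonneg (u x + v x), sq_nonneg (‖u x‖ - ‖v x‖),
          norm_nonneg (u x), norm_nonneg (v x)]
      nlinarith [mul_le_mul_of_nonneg_left h1 (norm_nonneg (V x : ℂ))]
    refine h.congr ?_
    filter_upwards [Lp.coeFn_add u v] with x hx
    rw [hx, Pi.add_apply]
  smul_mem' := by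
    rintro c u ⟨hu, w, hw⟩
    refine ⟨(hu.const_mul ((c : ℂ) ^ 2)).congr ?_, _, hw.smul hA c⟩
    filter_upwards [Lp.coeFn_smul c u] with x hx
    rw [hx, Pi.smul_apply, Complex.real_smul]; ring

/-- The space `H¹_{A,V}(ℝ^N)`, over the field `ℝ`. -/
def H1AV {N : ℕ} (A : E N → E N) (V : E N → ℝ) (hA : MemLpLoc A 2) (hV : ElectricCondition V) :
    Type := ↥(H1AVSubmodule A V hA hV)

namespace H1AV

variable {N : ℕ} {A : E N → E N} {V : E N → ℝ} {hA : MemLpLoc A 2} {hV : ElectricCondition V}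

/-- The function underlying an element of `H¹_{A,V}(ℝ^N)`. -/
def toL2 (u : H1AV A V hA hV) : L2 N := Subtype.val u

instance : AddCommGroup (H1AV A V hA hV) :=
  inferInstanceAs (AddCommGroup ↥(H1AVSubmodule A V hA hV))
instance : Module ℝ (H1AV A V hA hV) :=
  inferInstanceAs (Module ℝ ↥(H1AVSubmodule A V hA hV))

lemma magGrad_add (u v : H1AV A V hA hV) :
    magGrad A (u + v).toL2 = magGrad A u.toL2 + magGrad A v.toL2 :=
  ((isMagGrad_magGrad u.2.2).add hA (isMagGrad_magGrad v.2.2)).magGrad_eq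

lemma magGrad_smul (c : ℝ) (u : H1AV A V hA hV) :
    magGrad A (c • u).toL2 = c • magGrad A u.toL2 :=
  ((isMagGrad_magGrad u.2.2).smul hA c).magGrad_eq

lemma integrable_pairing (u v : H1AV A V hA hV) :
    Integrable (fun x => (V x : ℂ) * u.toL2 x * conj (v.toL2 x)) volume :=
  integrable_mul_conj hV (Lp.aestronglyMeasurable u.toL2) (Lp.aestronglyMeasurable v.toL2)
    u.2.1 v.2.1

variable (A V hA hV) in
/-- The scalar product `⟪u, v⟫_{H¹_{A,V}} = Re ∫ V u conj(v) + ⟪∇_A u, ∇_A v⟫_{L²}`. -/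
@[reducible] def core : InnerProductSpace.Core ℝ (H1AV A V hA hV) where
  inner u v := (∫ x, (V x : ℂ) * u.toL2 x * conj (v.toL2 x)).re +
    inner ℝ (magGrad A u.toL2) (magGrad A v.toL2)
  conj_inner_symm u v := by
    have h : ∫ x, (V x : ℂ) * v.toL2 x * conj (u.toL2 x) =
        conj (∫ x, (V x : ℂ) * u.toL2 x * conj (v.toL2 x)) := by
      rw [← integral_conj]
      congr; ext x
      simp; ring
    simp [h, real_inner_comm]
  re_inner_nonneg u := by
    refine add_nonneg ?_ real_inner_self_nonneg
    rw [re_integral_self]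
    obtain ⟨ν, hν, hVν⟩ := hV.2
    refine integral_nonneg_of_ae ?_
    filter_upwards [hVν] with x hx
    exact mul_nonneg (hν.le.trans hx) (sq_nonneg _)
  add_left u v w := by
    have h : ∫ x, (V x : ℂ) * (u + v).toL2 x * conj (w.toL2 x) =
        (∫ x, (V x : ℂ) * u.toL2 x * conj (w.toL2 x)) +
          ∫ x, (V x : ℂ) * v.toL2 x * conj (w.toL2 x) := by
      rw [← integral_add (integrable_pairing u w) (integrable_pairing v w)]
      apply integral_congr_ae
      filter_upwards [Lp.coeFn_add u.toL2 v.toL2] with x hx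
      change (V x : ℂ) * (u.toL2 + v.toL2 : L2 N) x * _ = _
      rw [hx, Pi.add_apply]; ring
    rw [magGrad_add, h, inner_add_left, Complex.add_re]; ring
  smul_left u v c := by
    have h : ∫ x, (V x : ℂ) * (c • u).toL2 x * conj (v.toL2 x) =
        c * (∫ x, (V x : ℂ) * u.toL2 x * conj (v.toL2 x)) := by
      rw [← integral_const_mul]
      apply integral_congr_ae
      filter_upwards [Lp.coeFn_smul c u.toL2] with x hx
      change (V x : ℂ) * (c • u.toL2 : L2 N) x * _ = _
      rw [hx, Pi.smul_apply, Complex.real_smul]; ring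
    rw [magGrad_smul, h, real_inner_smul_left, Complex.re_ofReal_mul]; simp; ring
  definite u h := by
    have h2 : (0 : ℝ) ≤ inner ℝ (magGrad A u.toL2) (magGrad A u.toL2) := real_inner_self_nonneg
    obtain ⟨ν, hν, hVν⟩ := hV.2
    have hpos : 0 ≤ᵐ[volume] fun x => V x * ‖u.toL2 x‖ ^ 2 := by
      filter_upwards [hVν] with x hx
      exact mul_nonneg (hν.le.trans hx) (sq_nonneg _)
    have h1 := integral_nonneg_of_ae hpos
    have h3 : ∫ x, V x * ‖u.toL2 x‖ ^ 2 = 0 := by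
      rw [re_integral_self] at h; linarith
    have hint : Integrable (fun x => V x * ‖u.toL2 x‖ ^ 2) volume := by
      refine (integrable_pairing u u).re.congr (Filter.Eventually.of_forall fun x => ?_)
      change ((V x : ℂ) * u.toL2 x * conj (u.toL2 x)).re = _
      rw [mul_assoc, Complex.mul_conj, Complex.normSq_eq_norm_sq, ← Complex.ofReal_mul,
        Complex.ofReal_re]
    rw [integral_eq_zero_iff_of_nonneg_ae hpos hint] at h3
    apply Subtype.ext
    change u.toL2 = 0
    apply Lp.ext
    filter_upwards [h3, hVν, Lp.coeFn_zero ℂ 2 (volume : Measure (E N))] with x hx hVx hz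
    rw [hz]
    have hVx' : V x ≠ 0 := (hν.trans_le hVx).ne'
    simpa [hVx'] using hx

instance : NormedAddCommGroup (H1AV A V hA hV) := (core A V hA hV).toNormedAddCommGroup
instance : InnerProductSpace ℝ (H1AV A V hA hV) :=
  InnerProductSpace.ofCore (core A V hA hV).toCore

end H1AV

/-! ### Test functions as elements of `H¹` and `H¹_{A,V}`; dual spaces -/

/-- `sup |φ| + sup |∇φ|`. -/
def testNorm {N : ℕ} (φ : TestFun N) : ℝ :=
  ‖TestFunction.toBoundedContinuousFunctionCLM ℝ φ‖ +
    ‖TestFunction.toBoundedContinuousFunctionCLM ℝ (TestFunction.fderivCLM ℝ ⊤ ⊤ φ)‖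

lemma continuous_testNorm {N : ℕ} : Continuous (testNorm : TestFun N → ℝ) := by
  unfold testNorm
  fun_prop

lemma testNorm_zero {N : ℕ} : testNorm (0 : TestFun N) = 0 := by
  rw [testNorm, map_zero, map_zero, map_zero, norm_zero, norm_zero, add_zero]

lemma testNorm_nonneg {N : ℕ} (φ : TestFun N) : 0 ≤ testNorm φ := by
  unfold testNorm; positivity

lemma norm_le_testNorm {N : ℕ} (φ : TestFun N) (x : E N) : ‖φ x‖ ≤ testNorm φ :=
  ((TestFunction.toBoundedContinuousFunctionCLM ℝ φ).norm_coe_le_norm x).trans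
    (le_add_of_nonneg_right (norm_nonneg _))

lemma norm_fderiv_le_testNorm {N : ℕ} (φ : TestFun N) (x : E N) :
    ‖fderiv ℝ φ x‖ ≤ testNorm φ := by
  have h := (TestFunction.toBoundedContinuousFunctionCLM ℝ
    (TestFunction.fderivCLM ℝ ⊤ ⊤ φ)).norm_coe_le_norm x
  have e : (TestFunction.toBoundedContinuousFunctionCLM ℝ (TestFunction.fderivCLM ℝ ⊤ ⊤ φ)) x =
      fderiv ℝ φ x := by simp
  rw [e] at h
  exact h.trans (le_add_of_nonneg_left (norm_nonneg _))

lemma continuous_of_testNorm_bound {N : ℕ} {F : Type*} [NormedAddCommGroup F] [NormedSpace ℝ F]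
    (f : TestFun N →ₗ[ℝ] F)
    (h : ∀ K : Set (E N), IsCompact K →
      ∃ C : ℝ, ∀ φ : TestFun N, tsupport φ ⊆ K → ‖f φ‖ ≤ C * testNorm φ) : Continuous f := by
  rw [TestFunction.continuous_iff_continuous_comp]
  intro K hK
  obtain ⟨C, hC⟩ := h K K.isCompact
  let g := f ∘ₗ (TestFunction.ofSupportedInCLM ℝ hK).toLinearMap
  change Continuous g
  apply continuous_of_continuousAt_zero g
  rw [ContinuousAt, map_zero]
  have hc : Continuous fun φ => C * testNorm (TestFunction.ofSupportedInCLM ℝ hK φ) :=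
    continuous_const.mul
      (continuous_testNorm.comp (TestFunction.ofSupportedInCLM ℝ hK).continuous)
  have h0 := hc.tendsto 0
  simp only [map_zero, testNorm_zero, mul_zero] at h0
  exact squeeze_zero_norm (fun φ => hC _ φ.tsupport_subset) h0

/-- The function `∇φ + i A φ` for a test function `φ`. -/
def testMagGradFun {N : ℕ} (A : E N → E N) (φ : TestFun N) (x : E N) :
    EuclideanSpace ℂ (Fin N) :=
  WithLp.toLp 2 fun j => fderiv ℝ φ x (basisVec j) + Complex.I * (A x j : ℂ) * φ x

lemma norm_le_sum {N : ℕ} (y : EuclideanSpace ℂ (Fin N)) : ‖y‖ ≤ ∑ j, ‖y j‖ := by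
  have h : y = ∑ j, EuclideanSpace.single j (y j) := by
    ext i; simp [Finset.sum_apply, Pi.single_apply]
  calc ‖y‖ = ‖∑ j, EuclideanSpace.single j (y j)‖ := by rw [← h]
    _ ≤ ∑ j, ‖EuclideanSpace.single j (y j)‖ := norm_sum_le _ _
    _ = ∑ j, ‖y j‖ := by simp

lemma norm_testMagGradFun_le {N : ℕ} (A : E N → E N) {φ : TestFun N} {K : Set (E N)}
    (hK : tsupport φ ⊆ K) (x : E N) :
    ‖testMagGradFun A φ x‖ ≤ testNorm φ * ‖K.indicator (fun x => N * (1 + ‖A x‖)) x‖ := by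
  by_cases hx : x ∈ K
  · rw [Set.indicator_of_mem hx, Real.norm_of_nonneg (by positivity)]
    refine (norm_le_sum _).trans ?_
    have hj : ∀ j, ‖testMagGradFun A φ x j‖ ≤ testNorm φ * (1 + ‖A x‖) := fun j => by
      have h1 : ‖fderiv ℝ φ x (basisVec j)‖ ≤ testNorm φ :=
        ((fderiv ℝ φ x).le_opNorm _).trans (by simpa using norm_fderiv_le_testNorm φ x)
      have h2 : ‖Complex.I * (A x j : ℂ) * φ x‖ ≤ ‖A x‖ * testNorm φ := by
        simp only [norm_mul, Complex.norm_I, one_mul, Complex.norm_real]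
        exact mul_le_mul (PiLp.norm_apply_le (A x) j) (norm_le_testNorm φ x) (norm_nonneg _)
          (norm_nonneg _)
      refine (norm_add_le _ _).trans ((add_le_add h1 h2).trans (le_of_eq ?_))
      ring
    refine (Finset.sum_le_sum fun j _ => hj j).trans (le_of_eq ?_)
    simp; ring
  · have hx' : x ∉ tsupport φ := fun h => hx (hK h)
    have h1 : φ x = 0 := image_eq_zero_of_notMem_tsupport hx'
    have h2 : fderiv ℝ φ x = 0 :=
      image_eq_zero_of_notMem_tsupport fun h => hx' (tsupport_fderiv_subset ℝ h)
    have h3 : testMagGradFun A φ x = 0 := by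
      ext j; simp [testMagGradFun, h1, h2]
    simp [h3, hx]

lemma memLp_indicator {N : ℕ} {A : E N → E N} (hA : MemLpLoc A 2) {K : Set (E N)}
    (hK : IsCompact K) :
    MemLp (K.indicator fun x => (N : ℝ) * (1 + ‖A x‖)) 2 volume := by
  rw [memLp_indicator_iff_restrict hK.measurableSet]
  have : IsFiniteMeasure (volume.restrict K) := ⟨by simpa using hK.measure_lt_top⟩
  have h1 : MemLp (fun _ : E N => (1 : ℝ)) 2 (volume.restrict K) := memLp_const 1
  have h2 : MemLp (fun x => 1 + ‖A x‖) 2 (volume.restrict K) := h1.add (hA K hK).norm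
  exact h2.const_mul (N : ℝ)

lemma aestronglyMeasurable_of_memLpLoc {N : ℕ} {A : E N → E N} (hA : MemLpLoc A 2) :
    AEStronglyMeasurable A volume := by
  have h : LocallyIntegrable A volume := by
    rw [locallyIntegrable_iff]
    intro K hK
    have : IsFiniteMeasure (volume.restrict K) := ⟨by simpa using hK.measure_lt_top⟩
    exact (hA K hK).integrable (by norm_num)
  exact h.aestronglyMeasurable

lemma continuous_fderiv_basisVec {N : ℕ} (φ : TestFun N) (j : Fin N) :
    Continuous fun x => fderiv ℝ φ x (basisVec j) :=
  (φ.contDiff.continuous_fderiv (by simp)).clm_apply continuous_const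

lemma memLp_testMagGradFun {N : ℕ} {A : E N → E N} (hA : MemLpLoc A 2) (φ : TestFun N) :
    MemLp (testMagGradFun A φ) 2 volume := by
  refine (memLp_indicator hA φ.hasCompactSupport).of_le_mul (c := testNorm φ) ?_
    (Filter.Eventually.of_forall fun x => norm_testMagGradFun_le A subset_rfl x)
  refine (PiLp.continuous_toLp 2 _).comp_aestronglyMeasurable
    (aemeasurable_pi_iff.2 fun j => ?_).aestronglyMeasurable
  have hAj : AEStronglyMeasurable (fun x => (A x j : ℂ)) volume :=
    (Complex.continuous_ofReal.comp (PiLp.continuous_apply 2 (fun _ : Fin N => ℝ) j)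
      ).comp_aestronglyMeasurable (aestronglyMeasurable_of_memLpLoc hA)
  exact ((continuous_fderiv_basisVec φ j).aestronglyMeasurable.add
    ((hAj.const_mul Complex.I).mul φ.continuous.aestronglyMeasurable)).aemeasurable

lemma memLp_test {N : ℕ} (φ : TestFun N) : MemLp φ 2 volume :=
  φ.continuous.memLp_of_hasCompactSupport φ.hasCompactSupport

/-- A test function, as an element of `L²(ℝ^N)`. -/
def testL2 {N : ℕ} (φ : TestFun N) : L2 N := (memLp_test φ).toLp φ

lemma distrDeriv_test {N : ℕ} (φ : TestFun N) (j : Fin N) :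
    distrDeriv j (toDistr φ) = toDistr fun x => fderiv ℝ φ x (basisVec j) := by
  have hφ : LocallyIntegrable φ volume := φ.continuous.locallyIntegrable
  have hφ' := (continuous_fderiv_basisVec φ j).locallyIntegrable (μ := volume)
  have hd : ∀ (ψ : TestFun N) (x : E N), HasLineDerivAt ℝ ψ (fderiv ℝ ψ x (basisVec j)) x
      (basisVec j) := fun ψ x =>
    ((ψ.contDiff.differentiable (by simp)).differentiableAt.hasFDerivAt).hasLineDerivAt _
  ext ψ
  let ψ' : TestFun N := TestFunction.lineDerivCLM ℝ (basisVec j) ψ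
  have hψ' : ∀ x, ψ' x = fderiv ℝ ψ x (basisVec j) := fun x => by
    simp only [ψ', TestFunction.lineDerivCLM_eq_fderivCLM]; simp
  have hi := φ.integrable_bilin (innerSL ℝ) (hφ.locallyIntegrableOn _)
  have key := integral_bilinear_hasLineDerivAt_right_eq_neg_left_of_integrable
    (μ := (volume : Measure (E N))) (B := innerSL ℝ) (f := ψ) (f' := ψ') (g := φ)
    (g' := fun x => fderiv ℝ φ x (basisVec j)) (v := basisVec j)
    (ψ'.integrable_bilin (innerSL ℝ) (hφ.locallyIntegrableOn _))
    (ψ.integrable_bilin (innerSL ℝ) (hφ'.locallyIntegrableOn _))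
    (ψ.integrable_bilin (innerSL ℝ) (hφ.locallyIntegrableOn _))
    (fun x _ => by rw [hψ']; exact hd ψ x) (fun x _ => hd φ x)
  rw [distrDeriv_apply, toDistr_apply hφ, toDistr_apply hφ']
  exact key.symm

lemma isMagGrad_test {N : ℕ} {A : E N → E N} (hA : MemLpLoc A 2) (φ : TestFun N) :
    IsMagGrad A (testL2 φ) ((memLp_testMagGradFun hA φ).toLp _) := by
  intro j
  have hφ : ((testL2 φ : L2 N) : E N → ℂ) =ᵐ[volume] φ := (memLp_test φ).coeFn_toLp
  have e1 : toDistr (testL2 φ : L2 N) = toDistr φ := toDistr_congr hφ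
  have e2 : toDistr (fun x => Complex.I * (A x j : ℂ) * (testL2 φ : L2 N) x) =
      toDistr fun x => Complex.I * (A x j : ℂ) * φ x := by
    apply toDistr_congr
    filter_upwards [hφ] with x hx
    rw [hx]
  have e3 : toDistr (fun x => ((memLp_testMagGradFun hA φ).toLp _ : L2v N) x j) =
      toDistr fun x => fderiv ℝ φ x (basisVec j) + Complex.I * (A x j : ℂ) * φ x := by
    apply toDistr_congr
    filter_upwards [(memLp_testMagGradFun hA φ).coeFn_toLp] with x hx
    rw [hx]; rfl
  rw [e3, toDistr_add (continuous_fderiv_basisVec φ j).locallyIntegrable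
    (locInt_I_mul hA (fun K _ => (memLp_test φ).restrict K) j), covDeriv, e1, e2, distrDeriv_test]

lemma isGrad_test {N : ℕ} (φ : TestFun N) :
    IsGrad (testL2 φ) ((memLp_testMagGradFun memLpLoc_zero φ).toLp _) :=
  isGrad_iff.2 (isMagGrad_test memLpLoc_zero φ)

lemma norm_testL2_le {N : ℕ} {K : Set (E N)} (hK : IsCompact K) :
    ∃ C : ℝ, ∀ φ : TestFun N, tsupport φ ⊆ K → ‖testL2 φ‖ ≤ testNorm φ * C := by
  have hm : MemLp (K.indicator fun _ => (1 : ℝ)) 2 (volume : Measure (E N)) :=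
    memLp_indicator_const 2 hK.measurableSet 1 (Or.inr hK.measure_lt_top.ne)
  refine ⟨‖hm.toLp _‖, fun φ hφ => Lp.norm_le_mul_norm_of_ae_le_mul ?_⟩
  filter_upwards [hm.coeFn_toLp, (memLp_test φ).coeFn_toLp] with x h1 h2
  rw [h1, testL2, h2]
  by_cases hx : x ∈ K
  · simpa [hx] using norm_le_testNorm φ x
  · simp [hx, image_eq_zero_of_notMem_tsupport fun h => hx (hφ h)]

lemma norm_testMagGrad_le {N : ℕ} {A : E N → E N} (hA : MemLpLoc A 2) {K : Set (E N)}
    (hK : IsCompact K) : ∃ C : ℝ, ∀ φ : TestFun N, tsupport φ ⊆ K →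
      ‖(memLp_testMagGradFun hA φ).toLp _‖ ≤ testNorm φ * C := by
  have hm := memLp_indicator hA hK
  refine ⟨‖hm.toLp _‖, fun φ hφ => Lp.norm_le_mul_norm_of_ae_le_mul ?_⟩
  filter_upwards [hm.coeFn_toLp, (memLp_testMagGradFun hA φ).coeFn_toLp] with x h1 h2
  rw [h1, h2]
  exact norm_testMagGradFun_le A hφ x

lemma norm_sq_bound {a b c m C C' : ℝ} (hm : 0 ≤ m) (hc : 0 ≤ c)
    (h : a ^ 2 ≤ b + c ^ 2) (h1 : b ≤ m ^ 2 * C) (h2 : c ≤ m * C') :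
    a ≤ √(C + C' ^ 2) * m := by
  have h3 : c ^ 2 ≤ (m * C') ^ 2 := pow_le_pow_left₀ hc h2 2
  have h4 : a ^ 2 ≤ m ^ 2 * (C + C' ^ 2) := by nlinarith
  calc a ≤ √(m ^ 2 * (C + C' ^ 2)) := Real.le_sqrt_of_sq_le h4
    _ = √(C + C' ^ 2) * m := by
      rw [Real.sqrt_mul (sq_nonneg m), Real.sqrt_sq hm, mul_comm]

/-- The inclusion `𝓓(ℝ^N) → H¹(ℝ^N)`. -/
def testToH1 (N : ℕ) : TestFun N →L[ℝ] H1 N where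
  toFun φ := ⟨testL2 φ, _, isGrad_test φ⟩
  map_add' _ _ := rfl
  map_smul' _ _ := rfl
  cont := by
    let f : TestFun N →ₗ[ℝ] H1 N := ⟨⟨fun φ => ⟨testL2 φ, _, isGrad_test φ⟩, fun _ _ => rfl⟩,
      fun _ _ => rfl⟩
    refine continuous_of_testNorm_bound f fun K hK => ?_
    obtain ⟨C, hC⟩ := norm_testL2_le hK
    obtain ⟨C', hC'⟩ := norm_testMagGrad_le (N := N) memLpLoc_zero hK
    refine ⟨√(C ^ 2 + C' ^ 2), fun φ hφ => norm_sq_bound (testNorm_nonneg φ)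
      (b := ‖testL2 φ‖ ^ 2) (norm_nonneg _) ?_ ?_ (hC' φ hφ)⟩
    · rw [← real_inner_self_eq_norm_sq, ← real_inner_self_eq_norm_sq,
        ← real_inner_self_eq_norm_sq, ← (isGrad_test φ).grad_eq]
      exact le_rfl
    · rw [← mul_pow]
      exact pow_le_pow_left₀ (norm_nonneg _) (hC φ hφ) 2

lemma integrable_test {N : ℕ} {V : E N → ℝ} (hV : ElectricCondition V) (φ : TestFun N) :
    Integrable (fun x => (V x : ℂ) * testL2 φ x ^ 2) volume := by
  have hVc : LocallyIntegrable (fun x => (V x : ℂ)) volume := fun x => by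
    obtain ⟨s, hs, hVs⟩ := hV.1 x
    exact ⟨s, hs, hVs.ofReal⟩
  let φ2 : TestFun N := ⟨fun x => φ x ^ 2, φ.contDiff.pow 2,
    φ.hasCompactSupport.comp_left (g := fun z : ℂ => z ^ 2) (by simp), by simp⟩
  refine (φ2.integrable_bilin (ContinuousLinearMap.mul ℝ ℂ)
    (hVc.locallyIntegrableOn _)).congr ?_
  filter_upwards [(memLp_test φ).coeFn_toLp] with x hx
  rw [testL2, hx]
  change φ x ^ 2 * (V x : ℂ) = _
  ring

lemma integral_test_le {N : ℕ} {V : E N → ℝ} (hV : ElectricCondition V) {K : Set (E N)}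
    (hK : IsCompact K) {φ : TestFun N} (hφ : tsupport φ ⊆ K) :
    ∫ x, V x * ‖testL2 φ x‖ ^ 2 ≤ testNorm φ ^ 2 * ∫ x in K, V x := by
  obtain ⟨ν, hν, hVν⟩ := hV.2
  rw [← integral_indicator hK.measurableSet, ← integral_const_mul]
  refine integral_mono_of_nonneg ?_ ?_ ?_
  · filter_upwards [hVν] with x hx
    exact mul_nonneg (hν.le.trans hx) (sq_nonneg _)
  · exact ((hV.1.integrableOn_isCompact hK).integrable_indicator hK.measurableSet).const_mul _
  · filter_upwards [hVν, (memLp_test φ).coeFn_toLp] with x hx h2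
    rw [testL2, h2]
    by_cases hxK : x ∈ K
    · rw [Set.indicator_of_mem hxK, mul_comm]
      exact mul_le_mul_of_nonneg_right (pow_le_pow_left₀ (norm_nonneg _)
        (norm_le_testNorm φ x) 2) (hν.le.trans hx)
    · simp [hxK, image_eq_zero_of_notMem_tsupport fun h => hxK (hφ h)]

/-- The inclusion `𝓓(ℝ^N) → H¹_{A,V}(ℝ^N)`. -/
def testToH1AV {N : ℕ} (A : E N → E N) (V : E N → ℝ) (hA : MemLpLoc A 2)
    (hV : ElectricCondition V) : TestFun N →L[ℝ] H1AV A V hA hV where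
  toFun φ := ⟨testL2 φ, integrable_test hV φ, _, isMagGrad_test hA φ⟩
  map_add' _ _ := rfl
  map_smul' _ _ := rfl
  cont := by
    let f : TestFun N →ₗ[ℝ] H1AV A V hA hV :=
      ⟨⟨fun φ => ⟨testL2 φ, integrable_test hV φ, _, isMagGrad_test hA φ⟩, fun _ _ => rfl⟩,
        fun _ _ => rfl⟩
    refine continuous_of_testNorm_bound f fun K hK => ?_
    obtain ⟨C', hC'⟩ := norm_testMagGrad_le hA hK
    refine ⟨√((∫ x in K, V x) + C' ^ 2), fun φ hφ => norm_sq_bound (testNorm_nonneg φ)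
      (b := ∫ x, V x * ‖testL2 φ x‖ ^ 2) (norm_nonneg _) ?_ (integral_test_le hV hK hφ)
      (hC' φ hφ)⟩
    · rw [← real_inner_self_eq_norm_sq, ← real_inner_self_eq_norm_sq,
        ← (isMagGrad_test hA φ).magGrad_eq, ← re_integral_self]
      exact le_rfl

/-- `H^{-1}(ℝ^N)`, the topological dual of `H¹(ℝ^N)`. -/
abbrev HNeg1 (N : ℕ) := StrongDual ℝ (H1 N)

/-- `H^{-1}_{A,V}(ℝ^N)`, the topological dual of `H¹_{A,V}(ℝ^N)`. -/
abbrev HNeg1AV {N : ℕ} (A : E N → E N) (V : E N → ℝ) (hA : MemLpLoc A 2)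
    (hV : ElectricCondition V) := StrongDual ℝ (H1AV A V hA hV)

/-- The distribution defined by an element of `H^{-1}(ℝ^N)`: its restriction to `𝓓(ℝ^N)`. -/
def HNeg1.toDistr {N : ℕ} (S : HNeg1 N) : Distr N := S ∘L testToH1 N

/-- The distribution defined by an element of `H^{-1}_{A,V}(ℝ^N)`: its restriction to
`𝓓(ℝ^N)`. -/
def HNeg1AV.toDistr {N : ℕ} {A : E N → E N} {V : E N → ℝ} {hA : MemLpLoc A 2}
    {hV : ElectricCondition V} (S : HNeg1AV A V hA hV) : Distr N := S ∘L testToH1AV A V hA hV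

end MagneticSobolev

end

open MagneticSobolev

/-! Everything rests on one estimate: multiplication by `A` is bounded from H¹ to L²
(`exists_multiplier_bound`). On a ball of radius one, Hölder's inequality pairs the L^p norm of `A`
with the L^q norm of `u`, where 1/p + 1/q = 1/2, and the three cases for p are such that H¹ embeds
in L^q locally. The L^p norms of `A` on unit balls are uniformly bounded, since each ball is
covered, up to a null set, by 3^N unit cubes. Multiplying `u` by translates of a fixed bump and
integrating over the translation vector sums the local estimates over the whole space
(`exists_weight_bound`); density of test functions and Fatou's lemma extend the result to H¹.

Part 1. For `u` in H¹ the field ∇_A u = ∇u + iAu is thus in L², with norm controlled by that of `u`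
in H¹. Hence v ↦ ⟨∇_A u, ∇_A v⟩ is continuous on H¹. On test functions it is -Δ_A u, directly from
the definition of the distributional derivative (`negMagLaplacian_apply`), and density of test
functions in H¹ gives uniqueness.

Part 2. If only ∇_A u is in L², the estimate cannot be applied to `u`, whose gradient is not known
to be in L². It is applied to |u| instead: the term iAu is tangent to the circle through u and does
not contribute to the derivative of |u|, so |∂_j|u|| ≤ |(∇_A u)_j| for each j. Since |A||u| has the
same L² norm as |A|u, the field Au is in L² (`magnetic_multiplier_bound`), and so is ∇u = ∇_A u -
iAu. With the lower bound on `V`, which controls the L² norm of `u`, this embeds H¹_{A,V}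
continuously in H¹, and the extension of `T` is its composition with the embedding.

Uniqueness in part 2 is the density of test functions in H¹_{A,V}. By the main estimate it suffices
to approximate in H¹ and, simultaneously, in L² with weight ρ = √V (`exists_close_test`): values are
truncated, then a spatial cutoff is applied, then a mollification. The same density lemma with ρ = 0
serves H¹. -/

noncomputable section

namespace MagneticSobolev

open Filter Topology Convolution ContDiff

/-! ### Mollification -/

/-- A bump function at the origin, supported in the ball of radius `2 / (n + 2) ≤ 1`. -/
def mollBump (N n : ℕ) : ContDiffBump (0 : E N) where
  rIn := 1 / (n + 2)
  rOut := 2 / (n + 2)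
  rIn_pos := by positivity
  rIn_lt_rOut := by gcongr; norm_num

/-- The normalized mollifier. -/
def mollKer (N n : ℕ) : E N → ℝ := (mollBump N n).normed volume

/-- The mollification of `f`. -/
def mollify {N : ℕ} (n : ℕ) (f : E N → ℂ) : E N → ℂ :=
  mollKer N n ⋆[ContinuousLinearMap.lsmul ℝ ℝ, volume] f

lemma mollify_apply {N : ℕ} (n : ℕ) (f : E N → ℂ) (x : E N) :
    mollify n f x = ∫ y, mollKer N n y • f (x - y) := rfl

lemma mollKer_nonneg {N n : ℕ} (x : E N) : 0 ≤ mollKer N n x := (mollBump N n).nonneg_normed x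

lemma contDiff_mollKer {N n : ℕ} : ContDiff ℝ ∞ (mollKer N n) := (mollBump N n).contDiff_normed

lemma hasCompactSupport_mollKer {N n : ℕ} : HasCompactSupport (mollKer N n) :=
  (mollBump N n).hasCompactSupport_normed

lemma integral_mollKer {N n : ℕ} : ∫ x, mollKer N n x = 1 := (mollBump N n).integral_normed

lemma mollBump_rOut_tendsto {N : ℕ} : Tendsto (fun n => (mollBump N n).rOut) atTop (𝓝 0) := by
  have h : Tendsto (fun n : ℕ => 2 / ((n : ℝ) + 2)) atTop (𝓝 0) :=
    tendsto_const_nhds.div_atTop (tendsto_atTop_add_const_right _ _ tendsto_natCast_atTop_atTop)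
  exact h

lemma mollBump_rOut_le {N n : ℕ} : (mollBump N n).rOut ≤ 1 := by
  change 2 / ((n : ℝ) + 2) ≤ 1
  rw [div_le_one (by positivity)]
  linarith [(Nat.cast_nonneg n : (0 : ℝ) ≤ n)]

lemma support_mollKer {N n : ℕ} : Function.support (mollKer N n) = Metric.ball 0 (mollBump N n).rOut :=
  (mollBump N n).support_normed_eq

lemma contDiff_mollify {N n : ℕ} {f : E N → ℂ} (hf : LocallyIntegrable f volume) :
    ContDiff ℝ ∞ (mollify n f) :=
  hasCompactSupport_mollKer.contDiff_convolution_left _ contDiff_mollKer hf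

lemma mollify_tendsto_ae {N : ℕ} {f : E N → ℂ} (hf : LocallyIntegrable f volume) :
    ∀ᵐ x, Tendsto (fun n => mollify n f x) atTop (𝓝 (f x)) := by
  -- The ratio of outer to inner radius is always 2, so the kernels are comparable to normalized
  -- indicators of balls and Lebesgue differentiation applies.
  refine ContDiffBump.ae_convolution_tendsto_right_of_locallyIntegrable (K := 2)
    mollBump_rOut_tendsto (Eventually.of_forall fun n => le_of_eq ?_) hf
  change 2 / ((n : ℝ) + 2) = 2 * (1 / ((n : ℝ) + 2))
  ring

lemma integrable_mollKer_smul {N n : ℕ} {f : E N → ℂ} (hf : LocallyIntegrable f volume) (x : E N) :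
    Integrable (fun y => mollKer N n y • f (x - y)) volume :=
  hasCompactSupport_mollKer.convolutionExists_left (ContinuousLinearMap.lsmul ℝ ℝ)
    contDiff_mollKer.continuous hf x

lemma norm_mollify_le {N n : ℕ} {f : E N → ℂ} {M : ℝ} (hM : ∀ x, ‖f x‖ ≤ M) (x : E N) :
    ‖mollify n f x‖ ≤ M := by
  have h : ∀ y, ‖mollKer N n y • f (x - y)‖ ≤ mollKer N n y * M := fun y => by
    rw [norm_smul, Real.norm_of_nonneg (mollKer_nonneg y)]
    exact mul_le_mul_of_nonneg_left (hM _) (mollKer_nonneg y)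
  refine (norm_integral_le_of_norm_le ((mollBump N n).integrable_normed.mul_const M)
    (Eventually.of_forall h)).trans (le_of_eq ?_)
  have := integral_mul_const (μ := (volume : Measure (E N))) M (mollKer N n)
  rw [integral_mollKer, one_mul] at this
  exact this

lemma mollify_eq_zero {N n : ℕ} {f : E N → ℂ} {R : ℝ} (hf : ∀ x, R ≤ ‖x‖ → f x = 0) {x : E N}
    (hx : R + 1 ≤ ‖x‖) : mollify n f x = 0 := by
  rw [mollify_apply]
  refine integral_eq_zero_of_ae (Eventually.of_forall fun y => ?_)
  by_cases hy : y ∈ Function.support (mollKer N n)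
  · rw [support_mollKer, mem_ball_zero_iff] at hy
    have h1 := norm_sub_norm_le x y
    have h2 := mollBump_rOut_le (N := N) (n := n)
    simp [hf (x - y) (by linarith)]
  · simp [Function.notMem_support.1 hy]

/-- Continuity of translations in L^p for finite p: the translations are measure preserving and vary
continuously in the compact-open topology. -/
lemma eLpNorm_translate_sub_tendsto {N : ℕ} {p : ℝ≥0∞} (hp : 1 ≤ p) (hp' : p ≠ ⊤)
    {f : E N → ℂ} (hf : MemLp f p volume) :
    Tendsto (fun y => eLpNorm (fun x => f (x - y) - f x) p volume) (𝓝 0) (𝓝 0) := by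
  have : Fact (1 ≤ p) := ⟨hp⟩
  let g : E N → C(E N, E N) := fun y => ⟨fun x => x - y, by fun_prop⟩
  have hgc : Continuous g := by
    refine ContinuousMap.continuous_of_continuous_uncurry _ ?_
    simp only [Function.uncurry_def, g]
    change Continuous fun z : E N × E N => z.2 - z.1
    fun_prop
  have hgm : ∀ y, MeasurePreserving (g y) volume volume := fun y =>
    measurePreserving_sub_right volume y
  have key := (tendsto_const_nhds (x := hf.toLp f)).compMeasurePreservingLp (hgc.tendsto 0) hgm
    (hgm 0) hp'
  rw [Lp.tendsto_Lp_iff_tendsto_eLpNorm'] at key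
  refine key.congr fun y => eLpNorm_congr_ae ?_
  have h1 := (hgm y).quasiMeasurePreserving.ae_eq_comp hf.coeFn_toLp
  have h0 := (hgm 0).quasiMeasurePreserving.ae_eq_comp hf.coeFn_toLp
  filter_upwards [Lp.coeFn_compMeasurePreserving (hf.toLp f) (hgm y), h1,
    Lp.coeFn_compMeasurePreserving (hf.toLp f) (hgm 0), h0] with x e1 e2 e3 e4
  rw [Pi.sub_apply, e1, e2, e3, e4]
  simp [g]

/-- The probability measure with density the mollifier. -/
def mollMeasure (N n : ℕ) : Measure (E N) :=
  volume.withDensity fun y => ENNReal.ofReal (mollKer N n y)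

instance {N n : ℕ} : IsProbabilityMeasure (mollMeasure N n) := ⟨by
  have h := ofReal_integral_eq_lintegral_ofReal (f := mollKer N n) (μ := volume)
    (mollBump N n).integrable_normed (Eventually.of_forall mollKer_nonneg)
  rw [mollMeasure, withDensity_apply _ MeasurableSet.univ, Measure.restrict_univ, ← h,
    integral_mollKer, ENNReal.ofReal_one]⟩

lemma lintegral_mollMeasure {N n : ℕ} {g : E N → ℝ≥0∞} (hg : AEMeasurable g volume) :
    ∫⁻ y, g y ∂(mollMeasure N n) = ∫⁻ y, ENNReal.ofReal (mollKer N n y) * g y :=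
  lintegral_withDensity_eq_lintegral_mul₀
    (contDiff_mollKer.continuous.measurable.ennreal_ofReal.aemeasurable) hg

lemma ae_mollMeasure {N n : ℕ} : ∀ᵐ y ∂(mollMeasure N n), y ∈ Metric.ball 0 (mollBump N n).rOut := by
  rw [mollMeasure, ae_withDensity_iff contDiff_mollKer.continuous.measurable.ennreal_ofReal]
  refine Eventually.of_forall fun y hy => ?_
  rw [← support_mollKer]
  intro h
  exact hy (by rw [h, ENNReal.ofReal_zero])

lemma aestronglyMeasurable_translate {N : ℕ} {f : E N → ℂ} (hf : AEStronglyMeasurable f volume)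
    (x : E N) : AEStronglyMeasurable (fun y => f (x - y)) volume :=
  hf.comp_measurePreserving (Measure.measurePreserving_sub_left volume x)

/-- Jensen's inequality: `mollify n f x - f x` is the average of f(x - y) - f(x) over the
probability measure `mollMeasure`, for which the L¹ norm is at most the L^p norm. -/
lemma enorm_mollify_sub_rpow_le {N n : ℕ} {p : ℝ} (hp : 1 ≤ p) {f : E N → ℂ}
    (hf : LocallyIntegrable f volume) (x : E N) :
    ‖mollify n f x - f x‖ₑ ^ p ≤ ∫⁻ y, ‖f (x - y) - f x‖ₑ ^ p ∂(mollMeasure N n) := by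
  have hm : AEStronglyMeasurable (fun y => f (x - y) - f x) volume :=
    (aestronglyMeasurable_translate hf.aestronglyMeasurable x).sub aestronglyMeasurable_const
  have hac : mollMeasure N n ≪ volume := withDensity_absolutelyContinuous _ _
  have e : mollify n f x - f x = ∫ y, mollKer N n y • (f (x - y) - f x) := by
    have e1 : ∫ y, mollKer N n y • f x = f x := by
      rw [integral_smul_const, integral_mollKer, one_smul]
    simp_rw [smul_sub]
    rw [integral_sub (integrable_mollKer_smul hf x), e1, mollify_apply]
    exact (mollBump N n).integrable_normed.smul_const _
  have h1 : ‖mollify n f x - f x‖ₑ ≤ ∫⁻ y, ‖f (x - y) - f x‖ₑ ∂(mollMeasure N n) := by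
    rw [e, lintegral_mollMeasure hm.enorm]
    refine (enorm_integral_le_lintegral_enorm _).trans (le_of_eq (lintegral_congr fun y => ?_))
    rw [enorm_smul, Real.enorm_of_nonneg (mollKer_nonneg y)]
  have h2 := eLpNorm_le_eLpNorm_of_exponent_le (μ := mollMeasure N n) (p := 1)
    (q := ENNReal.ofReal p) (by simpa using hp) (hm.mono_ac hac)
  rw [eLpNorm_one_eq_lintegral_enorm, eLpNorm_eq_lintegral_rpow_enorm_toReal (by simp; linarith)
    (by simp), ENNReal.toReal_ofReal (by linarith)] at h2
  have h3 := ENNReal.rpow_le_rpow (h1.trans h2) (by linarith : 0 ≤ p)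
  rwa [← ENNReal.rpow_mul, one_div_mul_cancel (by linarith), ENNReal.rpow_one] at h3

lemma lintegral_mollify_sub_rpow_le {N n : ℕ} {p : ℝ} (hp : 1 ≤ p) {f : E N → ℂ}
    (hf : LocallyIntegrable f volume) :
    ∫⁻ x, ‖mollify n f x - f x‖ₑ ^ p ≤
      ∫⁻ y, ∫⁻ x, ‖f (x - y) - f x‖ₑ ^ p ∂volume ∂(mollMeasure N n) := by
  rw [lintegral_lintegral_swap]
  · exact lintegral_mono fun (x : E N) => enorm_mollify_sub_rpow_le hp hf x
  · have hac : (mollMeasure N n).prod (volume : Measure (E N)) ≪ (volume : Measure (E N)).prod volume :=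
      (withDensity_absolutelyContinuous _ _).prod Measure.AbsolutelyContinuous.rfl
    -- As `f` is only a.e. strongly measurable, joint measurability of f(x - y) requires that
    -- subtraction pull null sets back to null sets.
    have hq : Measure.QuasiMeasurePreserving (fun z : E N × E N => z.2 - z.1)
        ((volume : Measure (E N)).prod volume) volume := by
      have := (quasiMeasurePreserving_sub_of_right_invariant (volume : Measure (E N)) volume).comp
        (Measure.measurePreserving_swap (μ := (volume : Measure (E N)))
          (ν := (volume : Measure (E N)))).quasiMeasurePreserving
      exact this
    have h1 := hf.aestronglyMeasurable.comp_quasiMeasurePreserving hq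
    have h2 := hf.aestronglyMeasurable.comp_quasiMeasurePreserving
      (Measure.quasiMeasurePreserving_snd (μ := (volume : Measure (E N))) (ν := volume))
    exact ((h1.sub h2).enorm.pow_const p).mono_ac hac

/-- After Tonelli, the p-th power of the error is an average of p-th powers of ‖f(· - y) - f‖_p over
y in the support of the kernel, which shrinks to the origin. -/
lemma eLpNorm_mollify_sub_tendsto {N : ℕ} {p : ℝ≥0∞} (hp : 1 ≤ p) (hp' : p ≠ ⊤)
    {f : E N → ℂ} (hf : MemLp f p volume) :
    Tendsto (fun n => eLpNorm (fun x => mollify n f x - f x) p volume) atTop (𝓝 0) := by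
  have hp0 : p ≠ 0 := (zero_lt_one.trans_le hp).ne'
  have hp1 : 1 ≤ p.toReal := by
    rw [← ENNReal.toReal_one]; exact ENNReal.toReal_mono hp' hp
  have hfl : LocallyIntegrable f volume := hf.locallyIntegrable hp
  rw [ENNReal.tendsto_nhds_zero]
  intro ε hε
  have h1 := (ENNReal.tendsto_nhds_zero.1 (eLpNorm_translate_sub_tendsto hp hp' hf)) ε hε
  obtain ⟨δ, hδ, hb⟩ := Metric.eventually_nhds_iff_ball.1 h1
  filter_upwards [(mollBump_rOut_tendsto (N := N)).eventually (gt_mem_nhds hδ)] with n hn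
  have hpp : 0 < p.toReal := by linarith
  rw [eLpNorm_eq_lintegral_rpow_enorm_toReal hp0 hp', one_div, ENNReal.rpow_inv_le_iff hpp]
  refine (lintegral_mollify_sub_rpow_le hp1 hfl).trans ?_
  calc ∫⁻ y, ∫⁻ x, ‖f (x - y) - f x‖ₑ ^ p.toReal ∂volume ∂(mollMeasure N n)
      ≤ ∫⁻ _, ε ^ p.toReal ∂(mollMeasure N n) := by
        refine lintegral_mono_ae ?_
        filter_upwards [ae_mollMeasure] with y hy
        have := hb y (Metric.ball_subset_ball hn.le hy)
        rwa [eLpNorm_eq_lintegral_rpow_enorm_toReal hp0 hp', one_div,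
          ENNReal.rpow_inv_le_iff hpp] at this
    _ = ε ^ p.toReal := by simp

/-! ### Weak derivatives -/

/-- `g` is the weak derivative of `f` in the direction `v`. -/
structure IsWeakDeriv {N : ℕ} (v : E N) (f g : E N → ℂ) : Prop where
  left : LocallyIntegrable f volume
  right : LocallyIntegrable g volume
  eq : ∀ ψ : E N → ℝ, ContDiff ℝ ∞ ψ → HasCompactSupport ψ →
    ∫ x, fderiv ℝ ψ x v • f x = -∫ x, ψ x • g x

lemma continuous_fderiv_apply_const {N : ℕ} {F : Type*} [NormedAddCommGroup F] [NormedSpace ℝ F]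
    {ψ : E N → F} (hψ : ContDiff ℝ 1 ψ) (v : E N) : Continuous fun x => fderiv ℝ ψ x v :=
  (hψ.continuous_fderiv (by simp)).clm_apply continuous_const

lemma hasCompactSupport_fderiv_apply {N : ℕ} {F : Type*} [NormedAddCommGroup F] [NormedSpace ℝ F]
    {ψ : E N → F} (hψ : HasCompactSupport ψ) (v : E N) :
    HasCompactSupport fun x => fderiv ℝ ψ x v :=
  (hψ.fderiv ℝ).comp_left (g := fun L : E N →L[ℝ] F => L v) (by simp)

lemma integrable_fderiv_smul {N : ℕ} {f : E N → ℂ} (hf : LocallyIntegrable f volume)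
    {ψ : E N → ℝ} (hψ : ContDiff ℝ ∞ ψ) (hc : HasCompactSupport ψ) (v : E N) :
    Integrable (fun x => fderiv ℝ ψ x v • f x) volume :=
  hf.integrable_smul_left_of_hasCompactSupport
    (continuous_fderiv_apply_const (hψ.of_le (by norm_cast)) v)
    (hasCompactSupport_fderiv_apply hc v)

/-- The distributional pairing takes real values on complex test functions, while `IsWeakDeriv`
takes complex values on real ones. One direction splits a test function into real and imaginary
parts; the other tests with ψ and iψ to recover the real and imaginary parts of the identity. -/
lemma isWeakDeriv_iff {N : ℕ} {f g : E N → ℂ} (hf : LocallyIntegrable f volume)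
    (hg : LocallyIntegrable g volume) (j : Fin N) :
    IsWeakDeriv (basisVec j) f g ↔ distrDeriv j (toDistr f) = toDistr g := by
  have hD : ∀ (φ : TestFun N) (x : E N),
      (TestFunction.lineDerivCLM ℝ (basisVec j) φ : TestFun N) x = fderiv ℝ φ x (basisVec j) :=
    fun φ x => by simp only [TestFunction.lineDerivCLM_eq_fderivCLM]; simp
  constructor
  · intro h
    ext φ
    have hφd : ∀ x, DifferentiableAt ℝ φ x := fun x =>
      (φ.contDiff.differentiable (by simp)).differentiableAt
    let a : E N → ℝ := fun x => (φ x).re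
    let b : E N → ℝ := fun x => (φ x).im
    have ha : ContDiff ℝ ∞ a := Complex.reCLM.contDiff.comp φ.contDiff
    have hb : ContDiff ℝ ∞ b := Complex.imCLM.contDiff.comp φ.contDiff
    have hac : HasCompactSupport a := φ.hasCompactSupport.comp_left (g := Complex.re) (by simp)
    have hbc : HasCompactSupport b := φ.hasCompactSupport.comp_left (g := Complex.im) (by simp)
    have hda : ∀ x, fderiv ℝ a x (basisVec j) = (fderiv ℝ φ x (basisVec j)).re := fun x => by
      have := (Complex.reCLM.hasFDerivAt.comp x (hφd x).hasFDerivAt).fderiv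
      change fderiv ℝ a x = _ at this
      rw [this]; rfl
    have hdb : ∀ x, fderiv ℝ b x (basisVec j) = (fderiv ℝ φ x (basisVec j)).im := fun x => by
      have := (Complex.imCLM.hasFDerivAt.comp x (hφd x).hasFDerivAt).fderiv
      change fderiv ℝ b x = _ at this
      rw [this]; rfl
    have e1 := h.eq a ha hac
    have e2 := h.eq b hb hbc
    have i1 := integrable_fderiv_smul hf ha hac (basisVec j)
    have i2 := integrable_fderiv_smul hf hb hbc (basisVec j)
    have i3 := hg.integrable_smul_left_of_hasCompactSupport ha.continuous hac
    have i4 := hg.integrable_smul_left_of_hasCompactSupport hb.continuous hbc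
    have e1' : ∫ x, (fderiv ℝ a x (basisVec j) • f x).re = -∫ x, (a x • g x).re := by
      have := congrArg Complex.re e1
      rw [Complex.neg_re] at this
      rwa [← RCLike.re_eq_complex_re, ← integral_re i1, ← integral_re i3] at this
    have e2' : ∫ x, (fderiv ℝ b x (basisVec j) • f x).im = -∫ x, (b x • g x).im := by
      have := congrArg Complex.im e2
      rw [Complex.neg_im] at this
      rwa [← RCLike.im_eq_complex_im, ← integral_im i2, ← integral_im i4] at this
    rw [distrDeriv_apply, toDistr_apply hf, toDistr_apply hg]
    have s1 : ∫ x, (f x * conj ((TestFunction.lineDerivCLM ℝ (basisVec j) φ : TestFun N) x)).re =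
        (∫ x, (fderiv ℝ a x (basisVec j) • f x).re) + ∫ x, (fderiv ℝ b x (basisVec j) • f x).im := by
      refine Eq.trans ?_ (integral_add i1.re i2.im)
      refine integral_congr_ae (Eventually.of_forall fun x => ?_)
      simp only [hD, hda, hdb]
      simp; ring
    have s2 : ∫ x, (g x * conj (φ x)).re = (∫ x, (a x • g x).re) + ∫ x, (b x • g x).im := by
      refine Eq.trans ?_ (integral_add i3.re i4.im)
      refine integral_congr_ae (Eventually.of_forall fun x => ?_)
      simp [a, b]; ring
    rw [s1, s2, e1', e2']; ring
  · intro h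
    refine ⟨hf, hg, fun ψ hψ hc => ?_⟩
    have i1 := integrable_fderiv_smul hf hψ hc (basisVec j)
    have i3 := hg.integrable_smul_left_of_hasCompactSupport hψ.continuous hc
    have key : ∀ c : ℂ, ∫ x, ((fderiv ℝ ψ x (basisVec j) • f x) * conj c).re =
        -∫ x, ((ψ x • g x) * conj c).re := by
      intro c
      let φ : TestFun N := ⟨fun x => (ψ x : ℂ) * c,
        (Complex.ofRealCLM.contDiff.comp hψ).mul contDiff_const,
        (hc.comp_left (g := fun t : ℝ => (t : ℂ) * c) (by simp)), by simp⟩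
      have hφ := congrArg (fun T : Distr N => T φ) h
      simp only [distrDeriv_apply, toDistr_apply hf, toDistr_apply hg, hD] at hφ
      have hd : ∀ x, fderiv ℝ φ x (basisVec j) = (fderiv ℝ ψ x (basisVec j) : ℂ) * c := fun x => by
        have h1 : HasFDerivAt ψ (fderiv ℝ ψ x) x :=
          ((hψ.differentiable (by simp)).differentiableAt).hasFDerivAt
        have h2 := (Complex.ofRealCLM.hasFDerivAt.comp x h1).mul_const c
        have h3 : fderiv ℝ φ x = _ := h2.fderiv
        rw [h3]; simp [mul_comm]
      have t1 : ∀ x, (fderiv ℝ ψ x (basisVec j) • f x * conj c).re =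
          (f x * conj (fderiv ℝ φ x (basisVec j))).re := fun x => by
        rw [hd]; simp; ring
      have t2 : ∀ x, (ψ x • g x * conj c).re = (g x * conj (φ x)).re := fun x => by
        change _ = (g x * conj ((ψ x : ℂ) * c)).re
        simp; ring
      simp_rw [t1, t2]
      linarith
    have k1 := key 1
    have k2 := key Complex.I
    apply Complex.ext
    · rw [Complex.neg_re, ← RCLike.re_eq_complex_re, ← integral_re i1, ← integral_re i3]
      simpa using k1
    · rw [Complex.neg_im, ← RCLike.im_eq_complex_im, ← integral_im i1, ← integral_im i3]
      simpa using k2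

lemma IsWeakDeriv.congr {N : ℕ} {v : E N} {f g f' g' : E N → ℂ} (h : IsWeakDeriv v f g)
    (hf : f =ᵐ[volume] f') (hg : g =ᵐ[volume] g') : IsWeakDeriv v f' g' := by
  refine ⟨h.left.congr hf, h.right.congr hg, fun ψ hψ hc => ?_⟩
  rw [integral_congr_ae (g := fun x => fderiv ℝ ψ x v • f x), h.eq ψ hψ hc,
    integral_congr_ae (g := fun x => ψ x • g' x)]
  · filter_upwards [hg] with x hx; rw [hx]
  · filter_upwards [hf] with x hx; rw [hx]

lemma IsWeakDeriv.const_smul {N : ℕ} {v : E N} {f g : E N → ℂ} (h : IsWeakDeriv v f g) (c : ℝ) :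
    IsWeakDeriv v (fun x => c • f x) (fun x => c • g x) := by
  refine ⟨h.left.smul c, h.right.smul c, fun ψ hψ hc => ?_⟩
  simp_rw [smul_comm _ c]
  rw [integral_smul, integral_smul, h.eq ψ hψ hc, smul_neg]

/-- Product of a weakly differentiable function and a smooth function. -/
lemma IsWeakDeriv.smooth_smul {N : ℕ} {v : E N} {f g : E N → ℂ} (h : IsWeakDeriv v f g)
    {χ : E N → ℝ} (hχ : ContDiff ℝ ∞ χ) :
    IsWeakDeriv v (fun x => χ x • f x) (fun x => χ x • g x + fderiv ℝ χ x v • f x) := by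
  have hχ' : Continuous fun x => fderiv ℝ χ x v :=
    continuous_fderiv_apply_const (hχ.of_le (by norm_cast)) v
  have l1 := h.left.continuous_smul hχ.continuous
  have l2 := h.right.continuous_smul hχ.continuous
  have l3 := h.left.continuous_smul hχ'
  refine ⟨l1, l2.add l3, fun ψ hψ hc => ?_⟩
  have hχd : ∀ x, DifferentiableAt ℝ χ x := fun x =>
    (hχ.differentiable (by simp)).differentiableAt
  have hψd : ∀ x, DifferentiableAt ℝ ψ x := fun x =>
    (hψ.differentiable (by simp)).differentiableAt
  -- The product rule is transferred to the test function, since χψ is again smooth with compact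
  -- support.
  have hp := h.eq (fun x => χ x * ψ x) (hχ.mul hψ) hc.mul_left
  have hd : ∀ x, fderiv ℝ (fun x => χ x * ψ x) x v = χ x * fderiv ℝ ψ x v + ψ x * fderiv ℝ χ x v :=
    fun x => by
      rw [fderiv_fun_mul (hχd x) (hψd x)]; simp
  have i1 : Integrable (fun x => fderiv ℝ ψ x v • (χ x • f x)) volume :=
    integrable_fderiv_smul l1 hψ hc v
  have i2 : Integrable (fun x => ψ x • (fderiv ℝ χ x v • f x)) volume :=
    l3.integrable_smul_left_of_hasCompactSupport hψ.continuous hc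
  have i3 : Integrable (fun x => ψ x • (χ x • g x)) volume :=
    l2.integrable_smul_left_of_hasCompactSupport hψ.continuous hc
  simp_rw [smul_add]
  rw [integral_add i3 i2, neg_add]
  have e1 : ∫ x, (χ x * ψ x) • g x = ∫ x, ψ x • (χ x • g x) := by
    congr; ext1 x; rw [smul_smul, mul_comm]
  have e2 : ∫ x, fderiv ℝ (fun x => χ x * ψ x) x v • f x =
      (∫ x, fderiv ℝ ψ x v • (χ x • f x)) + ∫ x, ψ x • (fderiv ℝ χ x v • f x) := by
    rw [← integral_add i1 i2]
    congr; ext1 x; rw [hd, add_smul, smul_smul, smul_smul, mul_comm (χ x)]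
  rw [e1, e2] at hp
  rw [← hp]; ring

/-- A continuously differentiable function has its classical derivative as a weak derivative. -/
lemma isWeakDeriv_of_contDiff {N : ℕ} (v : E N) {f : E N → ℂ} (hf : ContDiff ℝ 1 f) :
    IsWeakDeriv v f (fun x => fderiv ℝ f x v) := by
  have hf' := continuous_fderiv_apply_const hf v
  have l1 := hf.continuous.locallyIntegrable (μ := (volume : Measure (E N)))
  have l2 := hf'.locallyIntegrable (μ := (volume : Measure (E N)))
  refine ⟨l1, l2, fun ψ hψ hc => ?_⟩
  have := integral_smul_fderiv_eq_neg_fderiv_smul_of_integrable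
    (μ := (volume : Measure (E N))) (f := ψ) (g := f) (v := v)
    (integrable_fderiv_smul l1 hψ hc v)
    (l2.integrable_smul_left_of_hasCompactSupport hψ.continuous hc)
    (l1.integrable_smul_left_of_hasCompactSupport hψ.continuous hc)
    (fun x _ => (hψ.differentiable (by simp)).differentiableAt)
    (fun x _ => (hf.differentiable (by simp)).differentiableAt)
  rw [this, neg_neg]

/-- Mollification commutes with weak differentiation. -/
lemma IsWeakDeriv.fderiv_mollify {N : ℕ} {v : E N} {f g : E N → ℂ} (h : IsWeakDeriv v f g) (n : ℕ)
    (x : E N) : fderiv ℝ (mollify n f) x v = mollify n g x := by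
  have hρ1 : ContDiff ℝ 1 (mollKer N n) := contDiff_mollKer.of_le (by norm_cast)
  have hd := hasCompactSupport_mollKer.hasFDerivAt_convolution_left
    (ContinuousLinearMap.lsmul ℝ ℝ) hρ1 h.left x
  have hex := (hasCompactSupport_mollKer (N := N) (n := n)).fderiv ℝ |>.convolutionExists_left
    ((ContinuousLinearMap.lsmul ℝ ℝ : ℝ →L[ℝ] ℂ →L[ℝ] ℂ).precompL (E N))
    (hρ1.continuous_fderiv (by simp)) h.left x
  have e1 : fderiv ℝ (mollify n f) x v = ∫ y, fderiv ℝ (mollKer N n) y v • f (x - y) := by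
    have := hd.fderiv
    change fderiv ℝ (mollify n f) x = _ at this
    rw [this, convolution_def, ContinuousLinearMap.integral_apply hex]
    rfl
  -- The reflected and translated kernel is itself a test function; the sign coming from the
  -- reflection cancels the sign in the definition of the weak derivative.
  let ψ : E N → ℝ := fun y => mollKer N n (x - y)
  have hψ : ContDiff ℝ ∞ ψ := contDiff_mollKer.comp (contDiff_const.sub contDiff_id)
  have hψc : HasCompactSupport ψ :=
    hasCompactSupport_mollKer.comp_homeomorph (Homeomorph.subLeft x)
  have hψd : ∀ y, fderiv ℝ ψ y v = -fderiv ℝ (mollKer N n) (x - y) v := fun y => by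
    have h1 : HasFDerivAt (mollKer N n) (fderiv ℝ (mollKer N n) (x - y)) (x - y) :=
      (hρ1.differentiable (by simp)).differentiableAt.hasFDerivAt
    have h2 := h1.comp y ((hasFDerivAt_const x y).sub (hasFDerivAt_id y))
    have h3 : fderiv ℝ ψ y = _ := h2.fderiv
    rw [h3]; simp
  have e2 := h.eq ψ hψ hψc
  simp_rw [hψd, neg_smul, integral_neg, neg_inj] at e2
  rw [e1, mollify_apply, ← integral_sub_left_eq_self _ volume x,
    ← integral_sub_left_eq_self (fun y => mollKer N n y • g (x - y)) volume x]
  simpa [ψ] using e2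

/-! ### Chain rule for C¹ maps with bounded derivative -/

lemma integrable_mollify {N n : ℕ} {f : E N → ℂ} (hf : Integrable f volume) :
    Integrable (mollify n f) volume :=
  (mollBump N n).integrable_normed.integrable_convolution (ContinuousLinearMap.lsmul ℝ ℝ) hf

lemma norm_sub_le_of_fderiv_le {F : ℂ → ℂ} (hF : ContDiff ℝ 1 F) {C : ℝ}
    (hC : ∀ z, ‖fderiv ℝ F z‖ ≤ C) (a b : ℂ) : ‖F a - F b‖ ≤ C * ‖a - b‖ :=
  Convex.norm_image_sub_le_of_norm_fderiv_le (𝕜 := ℝ) (s := Set.univ)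
    (fun z _ => (hF.differentiable (by simp)).differentiableAt) (fun z _ => hC z) convex_univ
    (Set.mem_univ b) (Set.mem_univ a)

lemma norm_le_of_fderiv_le {F : ℂ → ℂ} (hF : ContDiff ℝ 1 F) (hF0 : F 0 = 0) {C : ℝ}
    (hC : ∀ z, ‖fderiv ℝ F z‖ ≤ C) (a : ℂ) : ‖F a‖ ≤ C * ‖a‖ := by
  simpa [hF0] using norm_sub_le_of_fderiv_le hF hC a 0

lemma continuous_fderiv_uncurry {F : ℂ → ℂ} (hF : ContDiff ℝ 1 F) :
    Continuous fun z : ℂ × ℂ => fderiv ℝ F z.1 z.2 :=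
  ((hF.continuous_fderiv (by simp)).comp continuous_fst).clm_apply continuous_snd

lemma tendsto_integral_smul_of_bound {N : ℕ} {ψ : E N → ℝ} (hψ : Continuous ψ)
    (hc : HasCompactSupport ψ) {f : ℕ → E N → ℂ} {b : ℕ → E N → ℝ}
    (hb : ∀ n, Integrable (b n) volume) (hfb : ∀ n x, ‖f n x‖ ≤ b n x)
    (hlim : Tendsto (fun n => ∫ x, b n x) atTop (𝓝 0)) :
    Tendsto (fun n => ∫ x, ψ x • f n x) atTop (𝓝 0) := by
  obtain ⟨M, hM⟩ := hψ.bounded_above_of_compact_support hc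
  have h2 : Tendsto (fun n => M * ∫ x, b n x) atTop (𝓝 0) := by simpa using hlim.const_mul M
  refine squeeze_zero_norm (fun n => ?_) h2
  rw [← integral_const_mul]
  refine norm_integral_le_of_norm_le ((hb n).const_mul M) (Eventually.of_forall fun x => ?_)
  rw [norm_smul]
  exact mul_le_mul (hM x) (hfb n x) (norm_nonneg _) ((norm_nonneg _).trans (hM x))

lemma integral_norm_mollify_sub_tendsto {N : ℕ} {f : E N → ℂ} (hf : Integrable f volume) :
    Tendsto (fun n => ∫ x, ‖mollify n f x - f x‖) atTop (𝓝 0) := by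
  have h := eLpNorm_mollify_sub_tendsto le_rfl ENNReal.one_ne_top (memLp_one_iff_integrable.2 hf)
  have h2 := (ENNReal.tendsto_toReal ENNReal.zero_ne_top).comp h
  refine (h2.congr fun n => ?_)
  rw [Function.comp_apply, eLpNorm_one_eq_lintegral_enorm]
  exact (integral_norm_eq_lintegral_enorm ((integrable_mollify hf).sub hf).aestronglyMeasurable).symm

/-- The classical chain rule for the mollifications u_n, of derivative w_n, passes to the limit. The
Lipschitz bound gives F(u_n) → F(u) in L¹. The derivative is split as F'(u_n)w + F'(u_n)(w_n - w):
the first term converges by domination by a multiple of |w|, the second tends to 0 in L¹. The split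
is needed because w_n converges in L¹ without a common dominating function. -/
lemma integral_chain_rule {N : ℕ} {v : E N} {u w : E N → ℂ} (h : IsWeakDeriv v u w)
    (hu : Integrable u volume) (hw : Integrable w volume) {F : ℂ → ℂ} (hF : ContDiff ℝ 1 F)
    {C : ℝ} (hC : ∀ z, ‖fderiv ℝ F z‖ ≤ C) {ψ : E N → ℝ} (hψ : ContDiff ℝ ∞ ψ)
    (hc : HasCompactSupport ψ) :
    ∫ x, fderiv ℝ ψ x v • F (u x) = -∫ x, ψ x • fderiv ℝ F (u x) (w x) := by
  have hψ' : Continuous fun x => fderiv ℝ ψ x v :=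
    continuous_fderiv_apply_const (hψ.of_le (by norm_cast)) v
  have hψc' := hasCompactSupport_fderiv_apply hc v
  obtain ⟨M, hM⟩ := hψ.continuous.bounded_above_of_compact_support hc
  have hum : ∀ n, ContDiff ℝ 1 (mollify n u) := fun n =>
    (contDiff_mollify h.left).of_le (by norm_cast)
  have hmu := integral_norm_mollify_sub_tendsto hu
  have hmw := integral_norm_mollify_sub_tendsto hw
  have hiu : ∀ n, Integrable (fun x => mollify n u x - u x) volume := fun n =>
    (integrable_mollify hu).sub hu
  have hiw : ∀ n, Integrable (fun x => mollify n w x - w x) volume := fun n =>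
    (integrable_mollify hw).sub hw
  have hFu : LocallyIntegrable (fun x => F (u x)) volume := by
    have h1 : Integrable (fun x => F (u x) - F 0) volume :=
      (hu.norm.const_mul C).mono' ((hF.continuous.comp_aestronglyMeasurable hu.1).sub
        aestronglyMeasurable_const) (Eventually.of_forall fun x => by
          simpa using norm_sub_le_of_fderiv_le hF hC (u x) 0)
    exact (h1.locallyIntegrable.add (locallyIntegrable_const (F 0))).congr
      (Eventually.of_forall fun x => by simp)
  have hdm : ∀ g : E N → ℂ, AEStronglyMeasurable g volume → ∀ n,
      AEStronglyMeasurable (fun x => fderiv ℝ F (mollify n u x) (g x)) volume := fun g hg n =>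
    (continuous_fderiv_uncurry hF).comp_aestronglyMeasurable
      ((hum n).continuous.aestronglyMeasurable.prodMk hg)
  have hdb : ∀ a b, ‖fderiv ℝ F a b‖ ≤ C * ‖b‖ := fun a b =>
    ((fderiv ℝ F a).le_opNorm b).trans (mul_le_mul_of_nonneg_right (hC a) (norm_nonneg b))
  have hMC : ∀ x a b, ‖ψ x • fderiv ℝ F a b‖ ≤ M * (C * ‖b‖) := fun x a b => by
    rw [norm_smul]
    exact mul_le_mul (hM x) (hdb _ _) (norm_nonneg _) ((norm_nonneg _).trans (hM x))
  have eq_n : ∀ n, ∫ x, fderiv ℝ ψ x v • F (mollify n u x) =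
      -((∫ x, ψ x • fderiv ℝ F (mollify n u x) (w x)) +
        ∫ x, ψ x • fderiv ℝ F (mollify n u x) (mollify n w x - w x)) := by
    intro n
    refine ((isWeakDeriv_of_contDiff v (hF.comp (hum n))).eq ψ hψ hc).trans ?_
    rw [← integral_add]
    · congr 2; ext x
      rw [fderiv_comp x (hF.differentiable (by simp)).differentiableAt
        ((hum n).differentiable (by simp)).differentiableAt, ContinuousLinearMap.comp_apply,
        h.fderiv_mollify, ← smul_add, ← map_add, add_sub_cancel]
    · exact ((hw.norm.const_mul C).const_mul M).mono'
        (hψ.continuous.aestronglyMeasurable.smul (hdm w hw.1 n))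
        (Eventually.of_forall fun x => hMC x _ _)
    · exact (((hiw n).norm.const_mul C).const_mul M).mono'
        (hψ.continuous.aestronglyMeasurable.smul (hdm _ (hiw n).1 n))
        (Eventually.of_forall fun x => hMC x _ _)
  have lim1 : Tendsto (fun n => ∫ x, fderiv ℝ ψ x v • F (mollify n u x)) atTop
      (𝓝 (∫ x, fderiv ℝ ψ x v • F (u x))) := by
    have h0 := tendsto_integral_smul_of_bound hψ' hψc'
      (f := fun n x => F (mollify n u x) - F (u x))
      (b := fun n x => C * ‖mollify n u x - u x‖) (fun n => (hiu n).norm.const_mul C)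
      (fun n x => norm_sub_le_of_fderiv_le hF hC _ _)
      (by simp_rw [integral_const_mul]; simpa using hmu.const_mul C)
    have h1 : ∀ n, ∫ x, fderiv ℝ ψ x v • (F (mollify n u x) - F (u x)) =
        (∫ x, fderiv ℝ ψ x v • F (mollify n u x)) - ∫ x, fderiv ℝ ψ x v • F (u x) := fun n => by
      simp_rw [smul_sub]
      refine integral_sub ?_ (integrable_fderiv_smul hFu hψ hc v)
      exact integrable_fderiv_smul (hF.continuous.comp (hum n).continuous).locallyIntegrable hψ hc v
    simp_rw [h1] at h0
    simpa using h0.add_const (∫ x, fderiv ℝ ψ x v • F (u x))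
  have lim2 : Tendsto (fun n => ∫ x, ψ x • fderiv ℝ F (mollify n u x) (w x)) atTop
      (𝓝 (∫ x, ψ x • fderiv ℝ F (u x) (w x))) := by
    refine tendsto_integral_of_dominated_convergence (fun x => M * (C * ‖w x‖))
      (fun n => hψ.continuous.aestronglyMeasurable.smul (hdm w hw.1 n))
      ((hw.norm.const_mul C).const_mul M) (fun n => Eventually.of_forall fun x => hMC x _ _) ?_
    filter_upwards [mollify_tendsto_ae h.left] with x hx
    have hcont : Continuous fun z : ℂ => ψ x • fderiv ℝ F z (w x) :=
      ((hF.continuous_fderiv (by simp)).clm_apply continuous_const).const_smul (ψ x)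
    exact (hcont.tendsto (u x)).comp hx
  have lim3 := tendsto_integral_smul_of_bound hψ.continuous hc
    (f := fun n x => fderiv ℝ F (mollify n u x) (mollify n w x - w x))
    (b := fun n x => C * ‖mollify n w x - w x‖) (fun n => (hiw n).norm.const_mul C)
    (fun n x => hdb _ _) (by simp_rw [integral_const_mul]; simpa using hmw.const_mul C)
  refine tendsto_nhds_unique lim1 ?_
  simp_rw [eq_n]
  simpa using (lim2.add lim3).neg

/-- Chain rule for weak derivatives. -/
lemma IsWeakDeriv.comp {N : ℕ} {v : E N} {u w : E N → ℂ} (h : IsWeakDeriv v u w) {F : ℂ → ℂ}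
    (hF : ContDiff ℝ 1 F) {C : ℝ} (hC : ∀ z, ‖fderiv ℝ F z‖ ≤ C) :
    IsWeakDeriv v (fun x => F (u x)) (fun x => fderiv ℝ F (u x) (w x)) := by
  have hloc : ∀ {f g : E N → ℂ} {c : ℝ}, LocallyIntegrable f volume →
      AEStronglyMeasurable g volume → (∀ x, ‖g x‖ ≤ c * ‖f x‖) → LocallyIntegrable g volume := by
    intro f g c hf hg hc x
    obtain ⟨s, hs, hfs⟩ := hf x
    exact ⟨s, hs, (hfs.norm.const_mul c).mono' hg.restrict (Eventually.of_forall hc)⟩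
  have l1 : LocallyIntegrable (fun x => F (u x)) volume := by
    have h1 : LocallyIntegrable (fun x => F (u x) - F 0) volume := hloc h.left
      ((hF.continuous.comp_aestronglyMeasurable h.left.aestronglyMeasurable).sub
        aestronglyMeasurable_const) fun x => by
          simpa using norm_sub_le_of_fderiv_le hF hC (u x) 0
    exact (h1.add (locallyIntegrable_const (F 0))).congr (Eventually.of_forall fun x => by simp)
  have l2 : LocallyIntegrable (fun x => fderiv ℝ F (u x) (w x)) volume := hloc h.right
    ((continuous_fderiv_uncurry hF).comp_aestronglyMeasurable
      (h.left.aestronglyMeasurable.prodMk h.right.aestronglyMeasurable)) fun x =>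
      ((fderiv ℝ F (u x)).le_opNorm _).trans
        (mul_le_mul_of_nonneg_right (hC _) (norm_nonneg _))
  refine ⟨l1, l2, fun ψ hψ hc => ?_⟩
  -- Reduction to the integrable case: u is replaced by χu, where χ = 1 in a neighbourhood of each
  -- point of the support of ψ. Both χ and its derivative are then invisible in the identity tested
  -- with ψ.
  obtain ⟨χ, hχ, hχc, hχ1⟩ : ∃ χ : E N → ℝ, ContDiff ℝ ∞ χ ∧ HasCompactSupport χ ∧
      ∀ x ∈ tsupport ψ, ∀ᶠ y in 𝓝 x, χ y = 1 := by
    obtain ⟨R, hR⟩ := hc.isBounded.subset_closedBall (0 : E N)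
    let b : ContDiffBump (0 : E N) := ⟨|R| + 1, |R| + 2, by positivity, by linarith⟩
    refine ⟨b, b.contDiff, b.hasCompactSupport, fun x hx => ?_⟩
    apply b.eventuallyEq_one_of_mem_ball
    have := hR hx
    rw [mem_closedBall_zero_iff] at this
    rw [mem_ball_zero_iff]
    exact this.trans_lt (by linarith [le_abs_self R] : R < |R| + 1)
  have key := integral_chain_rule (h.smooth_smul hχ)
    (h.left.integrable_smul_left_of_hasCompactSupport hχ.continuous hχc)
    ((h.right.integrable_smul_left_of_hasCompactSupport hχ.continuous hχc).add
      (integrable_fderiv_smul h.left hχ hχc v)) hF hC hψ hc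
  have e0 : ∀ x ∈ tsupport ψ, χ x = 1 ∧ fderiv ℝ χ x v = 0 := fun x hx => by
    refine ⟨(hχ1 x hx).self_of_nhds, ?_⟩
    have : χ =ᶠ[𝓝 x] fun _ => 1 := hχ1 x hx
    rw [this.fderiv_eq]; simp
  have e1 : ∀ x, fderiv ℝ ψ x v • F (χ x • u x) = fderiv ℝ ψ x v • F (u x) := fun x => by
    by_cases hx : x ∈ tsupport ψ
    · simp [(e0 x hx).1]
    · have : fderiv ℝ ψ x = 0 :=
        image_eq_zero_of_notMem_tsupport fun h => hx (tsupport_fderiv_subset ℝ h)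
      simp [this]
  have e2 : ∀ x, ψ x • fderiv ℝ F (χ x • u x) (χ x • w x + fderiv ℝ χ x v • u x) =
      ψ x • fderiv ℝ F (u x) (w x) := fun x => by
    by_cases hx : x ∈ tsupport ψ
    · simp [(e0 x hx).1, (e0 x hx).2]
    · simp [image_eq_zero_of_notMem_tsupport hx]
  simp_rw [e1, e2] at key
  exact key

/-! ### A Sobolev inequality with a uniformly locally integrable weight -/

/-- Hölder's inequality on a set of finite measure. It is used to return to exponent 2 in dimensions
1 and 2, where the Sobolev inequality starts from a gradient in L^p with p < 2. -/
lemma exists_eLpNorm_le_two {N : ℕ} {s : Set (E N)} (hs : IsCompact s) {p : ℝ≥0∞}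
    (hp2 : p ≤ 2) (hp0 : p ≠ 0) {F : Type*} [NormedAddCommGroup F] : ∃ C : NNReal,
      ∀ f : E N → F, Continuous f → (∀ x ∉ s, ‖f x‖ = 0) →
        eLpNorm f p volume ≤ C * eLpNorm f 2 volume := by
  have hfin : volume s ^ (1 / p.toReal - 1 / (2 : ℝ≥0∞).toReal) ≠ ⊤ := by
    refine ENNReal.rpow_ne_top_of_nonneg ?_ hs.measure_lt_top.ne
    rw [sub_nonneg]
    exact one_div_le_one_div_of_le (ENNReal.toReal_pos hp0 (hp2.trans_lt (by simp)).ne)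
      (ENNReal.toReal_mono (by simp) hp2)
  refine ⟨(volume s ^ (1 / p.toReal - 1 / (2 : ℝ≥0∞).toReal)).toNNReal, fun f hf hfs => ?_⟩
  rw [ENNReal.coe_toNNReal hfin, mul_comm]
  have hsup : Function.support f ⊆ s := fun x hx => by
    by_contra h
    exact hx (norm_eq_zero.1 (hfs x h))
  have h := eLpNorm_le_eLpNorm_mul_rpow_measure_univ (μ := volume.restrict s) hp2
    hf.aestronglyMeasurable
  rwa [eLpNorm_restrict_eq_of_support_subset hsup, eLpNorm_restrict_eq_of_support_subset hsup,
    Measure.restrict_apply_univ] at h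

lemma eLpNorm_fderiv_le_two {N : ℕ} {s : Set (E N)} (hs : Bornology.IsBounded s) {p : ℝ≥0∞}
    (hp2 : p ≤ 2) (hp0 : p ≠ 0) : ∃ C : NNReal, ∀ u : E N → ℂ, ContDiff ℝ 1 u →
      Function.support u ⊆ s → eLpNorm (fderiv ℝ u) p volume ≤ C * eLpNorm (fderiv ℝ u) 2 volume := by
  obtain ⟨C, hC⟩ := exists_eLpNorm_le_two (F := E N →L[ℝ] ℂ) hs.isCompact_closure hp2 hp0
  refine ⟨C, fun u hu hus => hC _ (hu.continuous_fderiv (by simp)) fun x hx => ?_⟩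
  have h : x ∉ tsupport u := fun h => hx (closure_mono hus h)
  rw [image_eq_zero_of_notMem_tsupport fun h' => h (tsupport_fderiv_subset ℝ h'), norm_zero]

/-- The exponent `q` admits a Sobolev inequality `H¹ ⊂ L^q` for functions supported in a fixed
bounded set. -/
def SobolevExponent (N : ℕ) (q : ℝ≥0∞) : Prop :=
  ∀ s : Set (E N), Bornology.IsBounded s → ∃ C : NNReal, ∀ u : E N → ℂ, ContDiff ℝ 1 u →
    Function.support u ⊆ s → eLpNorm u q volume ≤ C * eLpNorm (fderiv ℝ u) 2 volume

/-- In dimension one |u(x)| is at most the integral of |u'| over a half-line, and bounded support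
turns the L¹ norm of u' into its L² norm. The isometry `e` identifies ℝ with `E 1`. -/
lemma sobolevExponent_one : SobolevExponent 1 ⊤ := by
  intro s hs
  obtain ⟨C, hC⟩ := eLpNorm_fderiv_le_two (p := 1) hs (by norm_num) one_ne_zero
  refine ⟨C, fun u hu hus => le_trans ?_ (hC u hu hus)⟩
  rw [eLpNorm_exponent_top, eLpNorm_one_eq_lintegral_enorm]
  refine eLpNormEssSup_le_of_ae_enorm_bound (Eventually.of_forall fun x => ?_)
  let e := (OrthonormalBasis.singleton (Fin 1) ℝ).repr
  have he : MeasurePreserving e volume volume :=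
    (OrthonormalBasis.singleton (Fin 1) ℝ).measurePreserving_repr
  have hemb : MeasurableEmbedding e := e.toHomeomorph.measurableEmbedding
  have hg : ContDiff ℝ 1 (u ∘ e) := hu.comp e.contDiff
  have huc : HasCompactSupport u :=
    HasCompactSupport.of_support_subset_isCompact hs.isCompact_closure (hus.trans subset_closure)
  have hgc : HasCompactSupport (u ∘ e) := huc.comp_homeomorph e.toHomeomorph
  have h1 := HasCompactSupport.enorm_le_lintegral_Ici_deriv hg hgc (e.symm x)
  rw [Function.comp_apply, e.apply_symm_apply] at h1
  refine h1.trans ((setLIntegral_le_lintegral _ _).trans ?_)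
  rw [← he.lintegral_comp_emb hemb]
  refine lintegral_mono fun t => ?_
  have hd : deriv (u ∘ e) t = fderiv ℝ u (e t) (e 1) := by
    have h2 : HasFDerivAt u (fderiv ℝ u (e t)) (e t) :=
      (hu.differentiable (by simp)).differentiableAt.hasFDerivAt
    have h3 := (h2.comp t (e.toContinuousLinearEquiv : ℝ →L[ℝ] E 1).hasFDerivAt).hasDerivAt
    exact h3.deriv
  rw [hd]
  have h4 := (fderiv ℝ u (e t)).le_opNorm (e 1)
  rw [show ‖e 1‖ = 1 from (e.norm_map 1).trans norm_one, mul_one] at h4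
  exact enorm_le_iff_norm_le.2 h4

/-- The exponent q = 2(2 + ε)/ε is the Hölder partner of 2 + ε relative to 2. It is the Sobolev
conjugate, in dimension 2, of p = (2 + ε)/(1 + ε), because 1/p - 1/2 = ε/(2(2 + ε)) = 1/q; and 1 ≤ p
< 2. -/
lemma sobolevExponent_two {ε : ℝ} (hε : 0 < ε) :
    SobolevExponent 2 (ENNReal.ofReal (2 * (2 + ε) / ε)) := by
  intro s hs
  let p : NNReal := ⟨(2 + ε) / (1 + ε), by positivity⟩
  have hp1 : (1 : ℝ) ≤ (p : ℝ) := by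
    change 1 ≤ (2 + ε) / (1 + ε)
    rw [le_div_iff₀ (by positivity)]; linarith
  have hp2 : (p : ℝ) < 2 := by
    change (2 + ε) / (1 + ε) < 2
    rw [div_lt_iff₀ (by positivity)]; linarith
  obtain ⟨C, hC⟩ := eLpNorm_fderiv_le_two (N := 2) (p := p) hs
    (by exact_mod_cast hp2.le) (by
      have : (0 : ℝ) < p := by linarith
      simpa using (NNReal.coe_pos.1 this).ne')
  let q : NNReal := ⟨2 * (2 + ε) / ε, by positivity⟩
  have hq : ENNReal.ofReal (2 * (2 + ε) / ε) = q := by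
    rw [ENNReal.ofReal_eq_coe_nnreal (by positivity)]; rfl
  refine ⟨eLpNormLESNormFDerivOfLeConst ℂ volume s p q * C, fun u hu hus => ?_⟩
  rw [hq]
  refine (eLpNorm_le_eLpNorm_fderiv_of_le (p := p) (q := q) volume hu hus
    (by exact_mod_cast hp1) ?_ ?_ hs).trans ?_
  · rw [finrank_euclideanSpace_fin]
    exact_mod_cast hp2
  · rw [finrank_euclideanSpace_fin]
    change ((2 + ε) / (1 + ε))⁻¹ - ((2 : ℕ) : ℝ)⁻¹ ≤ (2 * (2 + ε) / ε)⁻¹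
    refine le_of_eq ?_
    push_cast
    field_simp
    ring
  · rw [ENNReal.coe_mul, mul_assoc]
    gcongr
    exact hC u hu hus

/-- This is the Gagliardo–Nirenberg–Sobolev inequality at the critical exponent, whose constant does
not depend on the support. Here 1/N + 1/q = 1/2, which is why `A` in L^N suffices. -/
lemma sobolevExponent_of_three_le {N : ℕ} (hN : 3 ≤ N) :
    SobolevExponent N (ENNReal.ofReal (2 * N / (N - 2))) := by
  intro s hs
  have hN' : (3 : ℝ) ≤ N := by exact_mod_cast hN
  have hpos : 0 ≤ 2 * (N : ℝ) / (N - 2) := div_nonneg (by positivity) (by linarith)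
  let q : NNReal := ⟨2 * N / (N - 2), hpos⟩
  have hq : ENNReal.ofReal (2 * N / (N - 2)) = q := by
    rw [ENNReal.ofReal_eq_coe_nnreal hpos]; rfl
  refine ⟨SNormLESNormFDerivOfEqConst ℂ (volume : Measure (E N)) (2 : NNReal),
    fun u hu hus => ?_⟩
  rw [hq]
  have huc : HasCompactSupport u :=
    HasCompactSupport.of_support_subset_isCompact hs.isCompact_closure (hus.trans subset_closure)
  refine eLpNorm_le_eLpNorm_fderiv_of_eq (p := 2) (p' := q) volume hu huc (by norm_num) ?_ ?_
  · rw [finrank_euclideanSpace_fin]; omega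
  · rw [finrank_euclideanSpace_fin]
    change (2 * (N : ℝ) / (N - 2))⁻¹ = ((2 : NNReal) : ℝ)⁻¹ - (N : ℝ)⁻¹
    have : (N : ℝ) - 2 ≠ 0 := by linarith
    have h2 : (N : ℝ) ≠ 0 := by linarith
    rw [inv_div]
    push_cast
    field_simp

lemma holderTriple_ofReal {a b : ℝ} (ha : 0 < a) (hb : 0 < b) (h : a⁻¹ + b⁻¹ = 2⁻¹) :
    ENNReal.HolderTriple (ENNReal.ofReal a) (ENNReal.ofReal b) 2 := by
  constructor
  rw [← ENNReal.ofReal_inv_of_pos ha, ← ENNReal.ofReal_inv_of_pos hb,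
    ← ENNReal.ofReal_add (by positivity) (by positivity), h, ENNReal.ofReal_inv_of_pos (by norm_num)]
  norm_num

/-- Under the assumption on the magnetic potential, Hölder and Sobolev exponents match. -/
lemma exists_exponents {N : ℕ} (hN : 1 ≤ N) {A : E N → E N} (hA : MagneticCondition A) :
    ∃ p q : ℝ≥0∞, ENNReal.HolderTriple p q 2 ∧ p ≠ 0 ∧ p ≠ ⊤ ∧ MemLpUnif A p ∧
      SobolevExponent N q := by
  obtain h | h | h : N = 1 ∨ N = 2 ∨ 3 ≤ N := by omega
  · subst h
    exact ⟨2, ⊤, ⟨by simp⟩, by simp, by simp, hA.2.2 rfl, sobolevExponent_one⟩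
  · subst h
    obtain ⟨ε, hε, hAε⟩ := hA.2.1 rfl
    refine ⟨_, _, holderTriple_ofReal (by positivity) (b := 2 * (2 + ε) / ε) (by positivity) ?_,
      by simp; positivity, by simp, hAε, sobolevExponent_two hε⟩
    field_simp
  · have hN' : (3 : ℝ) ≤ N := by exact_mod_cast h
    have e : (N : ℝ≥0∞) = ENNReal.ofReal (N : ℝ) := (ENNReal.ofReal_natCast N).symm
    have hA' := hA.1 h
    rw [e] at hA'
    have h3 : (0 : ℝ) < N - 2 := by linarith
    refine ⟨_, _, holderTriple_ofReal (by linarith) (b := 2 * (N : ℝ) / (N - 2)) (by positivity) ?_,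
      by simp; omega, by simp, hA', sobolevExponent_of_three_le h⟩
    rw [inv_div]
    have h2 : (N : ℝ) ≠ 0 := by linarith
    field_simp; ring

/-- The open unit cubes miss exactly the hyperplanes on which some coordinate is an integer; these
are null, so the cubes cover almost every point. -/
lemma ae_coord_ne {N : ℕ} : ∀ᵐ x : E N, ∀ (i : Fin N) (m : ℤ), x i ≠ (m : ℝ) := by
  rw [ae_all_iff]; intro i
  rw [ae_all_iff]; intro m
  have h : ∀ᵐ y : Fin N → ℝ, y i ≠ (m : ℝ) := Measure.ae_eval_ne (μ := fun _ : Fin N => (volume : Measure ℝ)) i _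
  exact (PiLp.volume_preserving_ofLp (Fin N)).quasiMeasurePreserving.ae h

/-- A uniformly locally integrable function is uniformly integrable on unit balls. -/
lemma exists_eLpNorm_ball_le {N : ℕ} {A : E N → E N} {p : ℝ≥0∞} (hp0 : p ≠ 0) (hp : p ≠ ⊤)
    (hA : MemLpUnif A p) : ∃ K : NNReal, ∀ y : E N,
      eLpNorm A p (volume.restrict (Metric.ball y 1)) ≤ K := by
  obtain ⟨M, hM⟩ : ∃ M : NNReal, (M : ℝ≥0∞) =
      ⨆ z : Fin N → ℤ, eLpNorm A p (volume.restrict (unitCube z)) :=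
    ⟨_, ENNReal.coe_toNNReal hA.2.ne⟩
  have hpp : 0 < p.toReal := ENNReal.toReal_pos hp0 hp
  have hMz : ∀ z : Fin N → ℤ, ∫⁻ x in unitCube z, ‖A x‖ₑ ^ p.toReal ≤ (M : ℝ≥0∞) ^ p.toReal := by
    intro z
    have h1 : eLpNorm A p (volume.restrict (unitCube z)) ≤ M := by
      rw [hM]
      exact le_iSup (fun z => eLpNorm A p (volume.restrict (unitCube z))) z
    rwa [eLpNorm_eq_lintegral_rpow_enorm_toReal hp0 hp, one_div,
      ENNReal.rpow_inv_le_iff hpp] at h1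
  let B : ℝ≥0∞ := ∑' _ : Fin N → Fin 3, (M : ℝ≥0∞) ^ p.toReal
  have hB : B ≠ ⊤ := by
    simp only [B, tsum_fintype]
    exact ENNReal.sum_ne_top.2 fun _ _ => ENNReal.rpow_ne_top_of_nonneg hpp.le ENNReal.coe_ne_top
  have hB' : B ^ (1 / p.toReal) ≠ ⊤ := ENNReal.rpow_ne_top_of_nonneg (by positivity) hB
  refine ⟨(B ^ (1 / p.toReal)).toNNReal, fun y => ?_⟩
  rw [ENNReal.coe_toNNReal hB', eLpNorm_eq_lintegral_rpow_enorm_toReal hp0 hp]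
  refine ENNReal.rpow_le_rpow ?_ (by positivity)
  -- If |x i - y i| < 1, then ⌊x i⌋ differs from ⌊y i⌋ by -1, 0 or 1. So 3^N cubes cover the ball
  -- almost everywhere, whatever its centre.
  let Z : (Fin N → Fin 3) → Fin N → ℤ := fun d i => ⌊y i⌋ - 1 + ((d i : ℕ) : ℤ)
  have hcov : Metric.ball y 1 ≤ᵐ[volume] ⋃ d, unitCube (Z d) := by
    filter_upwards [ae_coord_ne (N := N)] with x hx (hxy : x ∈ Metric.ball y 1)
    have hxy' : ∀ i, |x i - y i| < 1 := fun i => by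
      have h1 := PiLp.norm_apply_le (x - y) i
      rw [Metric.mem_ball, dist_eq_norm] at hxy
      exact lt_of_le_of_lt h1 hxy
    have hfl : ∀ i, ∃ d : Fin 3, ⌊x i⌋ = ⌊y i⌋ - 1 + ((d : ℕ) : ℤ) := fun i => by
      have h1 := abs_lt.1 (hxy' i)
      have h2 : ⌊y i⌋ - 1 ≤ ⌊x i⌋ := by
        rw [Int.le_floor]; push_cast; linarith [Int.floor_le (y i)]
      have h3 : ⌊x i⌋ < ⌊y i⌋ + 2 := by
        rw [Int.floor_lt]; push_cast; linarith [Int.lt_floor_add_one (y i)]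
      exact ⟨⟨(⌊x i⌋ - (⌊y i⌋ - 1)).toNat, by omega⟩, by simp; omega⟩
    choose d hd using hfl
    change x ∈ ⋃ d, unitCube (Z d)
    refine Set.mem_iUnion.2 ⟨d, fun i => ?_⟩
    have e : Z d i = ⌊x i⌋ := (hd i).symm
    rw [e]
    exact ⟨lt_of_le_of_ne (Int.floor_le _) (hx i _).symm, Int.lt_floor_add_one _⟩
  calc ∫⁻ x in Metric.ball y 1, ‖A x‖ₑ ^ p.toReal
      ≤ ∫⁻ x in ⋃ d, unitCube (Z d), ‖A x‖ₑ ^ p.toReal := lintegral_mono_set' hcov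
    _ ≤ ∑' d, ∫⁻ x in unitCube (Z d), ‖A x‖ₑ ^ p.toReal := lintegral_iUnion_le _ _
    _ ≤ B := ENNReal.tsum_le_tsum fun d => hMz (Z d)

lemma eLpNorm_two_sq {N : ℕ} {F : Type*} [NormedAddCommGroup F] (f : E N → F) (μ : Measure (E N)) :
    eLpNorm f 2 μ ^ 2 = ∫⁻ x, ‖f x‖ₑ ^ 2 ∂μ := by
  rw [eLpNorm_eq_lintegral_rpow_enorm_toReal (by simp) (by simp), ← ENNReal.rpow_natCast,
    ← ENNReal.rpow_mul]
  simp

/-- Weighted inequality for functions supported in a unit ball. -/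
lemma exists_local_weight_bound {N : ℕ} (hN : 1 ≤ N) {A : E N → E N} (hA : MemLpLoc A 2)
    (hA' : MagneticCondition A) : ∃ C : NNReal, ∀ (u : E N → ℂ) (y : E N), ContDiff ℝ 1 u →
      Function.support u ⊆ Metric.ball y 1 →
      ∫⁻ x, ‖A x‖ₑ ^ 2 * ‖u x‖ₑ ^ 2 ≤ C * ∫⁻ x, ‖fderiv ℝ u x‖ₑ ^ 2 := by
  obtain ⟨p, q, hpq, hp0, hp, hAp, hq⟩ := exists_exponents hN hA'
  obtain ⟨K, hK⟩ := exists_eLpNorm_ball_le hp0 hp hAp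
  obtain ⟨C, hC⟩ := hq (Metric.ball 0 1) Metric.isBounded_ball
  refine ⟨(K * C) ^ 2, fun u y hu hus => ?_⟩
  -- The Sobolev constant is attached to the ball centred at the origin; translating `u` there makes
  -- it independent of `y`.
  have hSob : eLpNorm u q volume ≤ C * eLpNorm (fderiv ℝ u) 2 volume := by
    let τ : E N → E N := fun x => x + y
    have hτ : MeasurePreserving τ volume volume := measurePreserving_add_right volume y
    have hf : ∀ x, fderiv ℝ (fun z => u (z + y)) x = fderiv ℝ u (x + y) := fun x =>
      fderiv_comp_add_right y
    have h := hC (fun x => u (x + y)) (hu.comp (contDiff_id.add contDiff_const)) fun x hx => by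
      have := hus hx
      simpa [dist_eq_norm] using this
    have e1 : eLpNorm (fun x => u (x + y)) q volume = eLpNorm u q volume :=
      eLpNorm_comp_measurePreserving hu.continuous.aestronglyMeasurable hτ
    have e2 : eLpNorm (fderiv ℝ fun x => u (x + y)) 2 volume = eLpNorm (fderiv ℝ u) 2 volume := by
      rw [show (fderiv ℝ fun x => u (x + y)) = fun x => fderiv ℝ u (x + y) from funext hf]
      exact eLpNorm_comp_measurePreserving
        (hu.continuous_fderiv (by simp)).aestronglyMeasurable hτ
    rwa [e1, e2] at h
  have hAm : AEStronglyMeasurable (fun x => ‖A x‖) (volume.restrict (Metric.ball y 1)) :=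
    (aestronglyMeasurable_of_memLpLoc hA).norm.restrict
  -- Hölder is applied on the ball only, since `A` need not be in L^p of the whole space.
  have hH := eLpNorm_smul_le_mul_eLpNorm (p := p) (q := q) (r := 2)
    (μ := volume.restrict (Metric.ball y 1)) hu.continuous.aestronglyMeasurable hAm
  have hsup : Function.support ((fun x => ‖A x‖) • u) ⊆ Metric.ball y 1 :=
    (Function.support_smul_subset_right _ _).trans hus
  rw [eLpNorm_restrict_eq_of_support_subset hsup, eLpNorm_restrict_eq_of_support_subset hus,
    eLpNorm_norm] at hH
  have h3 : eLpNorm ((fun x => ‖A x‖) • u) 2 volume ≤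
      (K * C : ℝ≥0∞) * eLpNorm (fderiv ℝ u) 2 volume := by
    rw [mul_assoc]
    exact hH.trans (mul_le_mul' (hK y) hSob)
  have h4 := pow_le_pow_left₀ (zero_le) h3 2
  rw [mul_pow, eLpNorm_two_sq, eLpNorm_two_sq] at h4
  push_cast
  refine le_trans (le_of_eq (lintegral_congr fun x => ?_)) h4
  rw [Pi.smul_apply', enorm_smul, enorm_norm, mul_pow]

lemma add_sq_le_two_mul (a b : ℝ≥0∞) : (a + b) ^ 2 ≤ 2 * (a ^ 2 + b ^ 2) := by
  have := ENNReal.rpow_add_le_mul_rpow_add_rpow a b (p := 2) (by norm_num)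
  norm_num at this
  exact_mod_cast this

/-- The weight `|A|²` is form-bounded by the norm of `H¹` on smooth functions. -/
lemma exists_weight_bound {N : ℕ} (hN : 1 ≤ N) {A : E N → E N} (hA : MemLpLoc A 2)
    (hA' : MagneticCondition A) : ∃ C : NNReal, ∀ u : E N → ℂ, ContDiff ℝ 1 u →
      ∫⁻ x, ‖A x‖ₑ ^ 2 * ‖u x‖ₑ ^ 2 ≤
        C * ((∫⁻ x, ‖u x‖ₑ ^ 2) + ∫⁻ x, ‖fderiv ℝ u x‖ₑ ^ 2) := by
  obtain ⟨C, hC⟩ := exists_local_weight_bound hN hA hA'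
  -- For index 0 the outer radius is 2/(0 + 2) = 1, so each translate of χ lives in a unit ball. Its
  -- translates act as a continuous partition of unity: the integral of |χ(x - y)|² over y is the
  -- same constant c for every x, nonzero because χ has integral 1.
  let χ : E N → ℝ := mollKer N 0
  have hχ : ContDiff ℝ 1 χ := contDiff_mollKer.of_le (by norm_cast)
  have hχ' : Continuous (fderiv ℝ χ) := hχ.continuous_fderiv (by simp)
  have m1 : Measurable fun x => ‖χ x‖ₑ ^ 2 := hχ.continuous.enorm.measurable.pow_const 2
  have m2 : Measurable fun x => ‖fderiv ℝ χ x‖ₑ ^ 2 := hχ'.enorm.measurable.pow_const 2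
  have m1' : ∀ x, Measurable fun y => ‖χ (x - y)‖ₑ ^ 2 := fun x =>
    m1.comp (measurable_const.sub measurable_id)
  have m2' : ∀ x, Measurable fun y => ‖fderiv ℝ χ (x - y)‖ₑ ^ 2 := fun x =>
    m2.comp (measurable_const.sub measurable_id)
  have hfin : ∀ {F : Type} [NormedAddCommGroup F] (f : E N → F), Continuous f →
      HasCompactSupport f → ∫⁻ x, ‖f x‖ₑ ^ 2 ≠ ⊤ := fun f hf hc => by
    rw [← eLpNorm_two_sq]
    exact ENNReal.pow_ne_top (hf.memLp_of_hasCompactSupport hc).eLpNorm_lt_top.ne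
  have hc1 : ∫⁻ x, ‖χ x‖ₑ ^ 2 ≠ ⊤ := hfin χ hχ.continuous hasCompactSupport_mollKer
  have hc2 : ∫⁻ x, ‖fderiv ℝ χ x‖ₑ ^ 2 ≠ ⊤ := by
    rw [← eLpNorm_two_sq]
    exact ENNReal.pow_ne_top
      (hχ'.memLp_of_hasCompactSupport (hasCompactSupport_mollKer.fderiv ℝ)).eLpNorm_lt_top.ne
  have hc0 : ∫⁻ x, ‖χ x‖ₑ ^ 2 ≠ 0 := by
    intro h
    rw [lintegral_eq_zero_iff m1] at h
    have h0 : χ =ᵐ[volume] fun _ => 0 := by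
      filter_upwards [h] with x hx
      simpa using hx
    have := integral_mollKer (N := N) (n := 0)
    rw [integral_congr_ae h0] at this
    simp at this
  obtain ⟨c, hc⟩ : ∃ c : NNReal, (c : ℝ≥0∞) = ∫⁻ x, ‖χ x‖ₑ ^ 2 := ⟨_, ENNReal.coe_toNNReal hc1⟩
  obtain ⟨c', hc'⟩ : ∃ c : NNReal, (c : ℝ≥0∞) = ∫⁻ x, ‖fderiv ℝ χ x‖ₑ ^ 2 :=
    ⟨_, ENNReal.coe_toNNReal hc2⟩
  have hcne : (c : ℝ≥0∞) ≠ 0 := by rwa [hc]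
  refine ⟨c⁻¹ * (C * 2 * (c + c')), fun u hu => ?_⟩
  have hu' : Continuous (fderiv ℝ u) := hu.continuous_fderiv (by simp)
  have mu : Measurable fun x => ‖u x‖ₑ ^ 2 := hu.continuous.enorm.measurable.pow_const 2
  have mu' : Measurable fun x => ‖fderiv ℝ u x‖ₑ ^ 2 := hu'.enorm.measurable.pow_const 2
  have hAm : AEMeasurable (fun x => ‖A x‖ₑ) volume := (aestronglyMeasurable_of_memLpLoc hA).enorm
  have hwm : AEMeasurable (fun x => ‖A x‖ₑ ^ 2 * ‖u x‖ₑ ^ 2) volume :=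
    (hAm.pow_const 2).mul mu.aemeasurable
  -- The local estimate for χ(· - y)u, with the product rule and (a + b)² ≤ 2(a² + b²) on the
  -- gradient.
  have hloc : ∀ y, ∫⁻ x, ‖A x‖ₑ ^ 2 * ‖u x‖ₑ ^ 2 * ‖χ (x - y)‖ₑ ^ 2 ≤
      C * ∫⁻ x, 2 * (‖χ (x - y)‖ₑ ^ 2 * ‖fderiv ℝ u x‖ₑ ^ 2 +
        ‖fderiv ℝ χ (x - y)‖ₑ ^ 2 * ‖u x‖ₑ ^ 2) := by
    intro y
    have hχy : ContDiff ℝ 1 fun x => χ (x - y) := hχ.comp (contDiff_id.sub contDiff_const)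
    have h := hC (fun x => χ (x - y) • u x) y (hχy.smul hu) fun x hx => by
      have h1 : x - y ∈ Function.support χ := fun h0 => hx (by simp [h0])
      rw [support_mollKer] at h1
      rw [mem_ball_iff_norm]
      rw [mem_ball_zero_iff] at h1
      exact h1.trans_le mollBump_rOut_le
    refine le_trans (le_of_eq (lintegral_congr fun x => ?_)) (h.trans ?_)
    · rw [enorm_smul, mul_pow]; ring
    · gcongr with x
      have : fderiv ℝ (fun x => χ (x - y)) x = fderiv ℝ χ (x - y) := by
        simp_rw [sub_eq_add_neg]
        exact fderiv_comp_add_right (-y)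
      have hd : fderiv ℝ (fun x => χ (x - y) • u x) x =
          χ (x - y) • fderiv ℝ u x + (fderiv ℝ χ (x - y)).smulRight (u x) := by
        rw [fderiv_fun_smul (hχy.differentiable (by simp)).differentiableAt
          (hu.differentiable (by simp)).differentiableAt, this]
      rw [← mul_pow, ← mul_pow]
      refine (pow_le_pow_left₀ (zero_le) ?_ 2).trans (add_sq_le_two_mul _ _)
      have hn : ‖fderiv ℝ (fun x => χ (x - y) • u x) x‖ ≤
          ‖χ (x - y)‖ * ‖fderiv ℝ u x‖ + ‖fderiv ℝ χ (x - y)‖ * ‖u x‖ := by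
        rw [hd, ← ContinuousLinearMap.norm_smulRight_apply, ← norm_smul]
        exact norm_add_le _ _
      have h2 := ENNReal.ofReal_le_ofReal hn
      rwa [ENNReal.ofReal_add (by positivity) (by positivity), ENNReal.ofReal_mul (norm_nonneg _),
        ENNReal.ofReal_mul (norm_nonneg _), ofReal_norm, ofReal_norm, ofReal_norm, ofReal_norm,
        ofReal_norm] at h2
  have hsub : ∀ (g : E N → ℝ≥0∞) (x : E N), ∫⁻ y, g (x - y) = ∫⁻ y, g y := fun g x =>
    lintegral_sub_left_eq_self g x
  -- Integration over y and Tonelli: the bumps disappear, leaving only the constants c and c'.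
  have hstep : c * ∫⁻ x, ‖A x‖ₑ ^ 2 * ‖u x‖ₑ ^ 2 ≤
      C * 2 * (c * (∫⁻ x, ‖fderiv ℝ u x‖ₑ ^ 2) + c' * ∫⁻ x, ‖u x‖ₑ ^ 2) := by
    calc c * ∫⁻ x, ‖A x‖ₑ ^ 2 * ‖u x‖ₑ ^ 2
        = ∫⁻ x, ∫⁻ y, ‖A x‖ₑ ^ 2 * ‖u x‖ₑ ^ 2 * ‖χ (x - y)‖ₑ ^ 2 := by
          rw [← lintegral_const_mul'' _ hwm]
          refine lintegral_congr fun x => ?_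
          rw [lintegral_const_mul _ (m1' x), hsub (fun z => ‖χ z‖ₑ ^ 2), ← hc, mul_comm]
      _ = ∫⁻ y, ∫⁻ x, ‖A x‖ₑ ^ 2 * ‖u x‖ₑ ^ 2 * ‖χ (x - y)‖ₑ ^ 2 := by
          refine lintegral_lintegral_swap ?_
          refine (hwm.comp_quasiMeasurePreserving Measure.quasiMeasurePreserving_fst).mul ?_
          have : Continuous fun z : E N × E N => χ (z.1 - z.2) := by fun_prop
          exact (this.enorm.measurable.pow_const 2).aemeasurable
      _ ≤ ∫⁻ y, C * ∫⁻ x, 2 * (‖χ (x - y)‖ₑ ^ 2 * ‖fderiv ℝ u x‖ₑ ^ 2 +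
            ‖fderiv ℝ χ (x - y)‖ₑ ^ 2 * ‖u x‖ₑ ^ 2) := lintegral_mono hloc
      _ = C * ∫⁻ x, ∫⁻ y, 2 * (‖χ (x - y)‖ₑ ^ 2 * ‖fderiv ℝ u x‖ₑ ^ 2 +
            ‖fderiv ℝ χ (x - y)‖ₑ ^ 2 * ‖u x‖ₑ ^ 2) := by
          rw [lintegral_const_mul' _ _ ENNReal.coe_ne_top, lintegral_lintegral_swap]
          have h1 : Continuous fun z : E N × E N => χ (z.2 - z.1) := by fun_prop
          have h2 : Continuous fun z : E N × E N => fderiv ℝ χ (z.2 - z.1) := by fun_prop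
          have h3 : Continuous fun z : E N × E N => u z.2 := by fun_prop
          have h4 : Continuous fun z : E N × E N => fderiv ℝ u z.2 := by fun_prop
          exact ((((h1.enorm.measurable.pow_const 2).mul (h4.enorm.measurable.pow_const 2)).add
            ((h2.enorm.measurable.pow_const 2).mul (h3.enorm.measurable.pow_const 2))).const_mul
              2).aemeasurable
      _ = C * ∫⁻ x, 2 * (c * ‖fderiv ℝ u x‖ₑ ^ 2 + c' * ‖u x‖ₑ ^ 2) := by
          congr 1
          refine lintegral_congr fun x => ?_
          rw [lintegral_const_mul' _ _ (by simp),
            lintegral_add_left ((m1' x).mul_const _),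
            lintegral_mul_const _ (m1' x), lintegral_mul_const _ (m2' x),
            hsub (fun z => ‖χ z‖ₑ ^ 2), hsub (fun z => ‖fderiv ℝ χ z‖ₑ ^ 2), ← hc, ← hc']
      _ = _ := by
          rw [lintegral_const_mul' _ _ (by simp),
            lintegral_add_left (mu'.const_mul _), lintegral_const_mul _ mu',
            lintegral_const_mul _ mu, mul_assoc]
  have hfinal : ∫⁻ x, ‖A x‖ₑ ^ 2 * ‖u x‖ₑ ^ 2 = (c : ℝ≥0∞)⁻¹ * (c * ∫⁻ x, ‖A x‖ₑ ^ 2 * ‖u x‖ₑ ^ 2) := by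
    rw [← mul_assoc, ENNReal.inv_mul_cancel hcne ENNReal.coe_ne_top, one_mul]
  rw [hfinal]
  push_cast
  rw [ENNReal.coe_inv (by exact_mod_cast hcne), mul_assoc]
  refine mul_le_mul_right (hstep.trans ?_) _
  rw [mul_assoc (C * 2 : ℝ≥0∞)]
  refine mul_le_mul_right ?_ _
  rw [add_mul, mul_add, mul_add]
  calc (c : ℝ≥0∞) * (∫⁻ x, ‖fderiv ℝ u x‖ₑ ^ 2) + c' * ∫⁻ x, ‖u x‖ₑ ^ 2
      ≤ (c * (∫⁻ x, ‖u x‖ₑ ^ 2) + c * ∫⁻ x, ‖fderiv ℝ u x‖ₑ ^ 2) +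
        (c' * (∫⁻ x, ‖u x‖ₑ ^ 2) + c' * ∫⁻ x, ‖fderiv ℝ u x‖ₑ ^ 2) :=
        add_le_add le_add_self le_self_add

/-! ### Density of test functions in weighted Sobolev spaces -/

lemma tendsto_eLpNorm_two_of_dominated {N : ℕ} {f : ℕ → E N → ℂ} {g : E N → ℂ} {b : E N → ℝ}
    (hf : ∀ n, AEStronglyMeasurable (f n) volume) (hg : AEStronglyMeasurable g volume)
    (hb : MemLp b 2 volume) (hfb : ∀ n, ∀ᵐ x, ‖f n x - g x‖ ≤ b x)
    (hlim : ∀ᵐ x, Tendsto (fun n => f n x) atTop (𝓝 (g x))) :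
    Tendsto (fun n => eLpNorm (fun x => f n x - g x) 2 volume) atTop (𝓝 0) := by
  have hbfin : ∫⁻ x, ‖b x‖ₑ ^ 2 ≠ ⊤ := by
    rw [← eLpNorm_two_sq]
    exact ENNReal.pow_ne_top hb.eLpNorm_lt_top.ne
  have h : Tendsto (fun n => ∫⁻ x, ‖f n x - g x‖ₑ ^ 2) atTop (𝓝 (∫⁻ _ : E N, 0)) := by
    refine tendsto_lintegral_of_dominated_convergence' (fun x => ‖b x‖ₑ ^ 2)
      (fun n => ((hf n).sub hg).enorm.pow_const 2) (fun n => ?_) hbfin ?_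
    · filter_upwards [hfb n] with x hx
      gcongr
      exact enorm_le_iff_norm_le.2 (hx.trans (Real.le_norm_self _))
    · filter_upwards [hlim] with x hx
      have h1 : Tendsto (fun n => f n x - g x) atTop (𝓝 0) := by
        simpa using hx.sub_const (g x)
      have h2 : Tendsto (fun n => ‖f n x - g x‖ₑ) atTop (𝓝 0) := by
        simpa using h1.enorm
      simpa using ENNReal.Tendsto.pow (n := 2) h2
  rw [lintegral_zero] at h
  have h3 := h.ennrpow_const (1 / 2)
  rw [ENNReal.zero_rpow_of_pos (by norm_num)] at h3
  refine h3.congr fun n => ?_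
  rw [← eLpNorm_two_sq, ← ENNReal.rpow_natCast, ← ENNReal.rpow_mul]
  simp

/-- The pair `(u, w)` is a function in `H¹` with its weak gradient, and `ρ u` is in `L²`. -/
structure MemWeightedH1 {N : ℕ} (ρ : E N → ℝ) (u : E N → ℂ) (w : Fin N → E N → ℂ) : Prop where
  memLp : MemLp u 2 volume
  memLp_deriv : ∀ j, MemLp (w j) 2 volume
  weak : ∀ j, IsWeakDeriv (basisVec j) u (w j)
  memLp_weight : MemLp (fun x => ρ x • u x) 2 volume

/-- The pairs `(u, w)` and `(u', w')` are `ε`-close in `H¹` and in `L²` with weight `ρ`. -/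
structure WeightedH1Close {N : ℕ} (ρ : E N → ℝ) (ε : ℝ≥0∞) (u : E N → ℂ) (w : Fin N → E N → ℂ)
    (u' : E N → ℂ) (w' : Fin N → E N → ℂ) : Prop where
  fst : eLpNorm (fun x => u' x - u x) 2 volume ≤ ε
  deriv : ∀ j, eLpNorm (fun x => w' j x - w j x) 2 volume ≤ ε
  weight : eLpNorm (fun x => ρ x • u' x - ρ x • u x) 2 volume ≤ ε

lemma eLpNorm_sub_le_add {N : ℕ} {f g h : E N → ℂ} {ε δ : ℝ≥0∞} (hf : MemLp f 2 volume)
    (hg : MemLp g 2 volume) (hh : MemLp h 2 volume)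
    (h1 : eLpNorm (fun x => g x - f x) 2 volume ≤ ε)
    (h2 : eLpNorm (fun x => h x - g x) 2 volume ≤ δ) :
    eLpNorm (fun x => h x - f x) 2 volume ≤ ε + δ := by
  have e : (fun x => h x - f x) = (fun x => g x - f x) + fun x => h x - g x := by
    ext x; simp
  rw [e]
  exact (eLpNorm_add_le (hg.sub hf).1 (hh.sub hg).1 (by norm_num)).trans (add_le_add h1 h2)

lemma WeightedH1Close.trans {N : ℕ} {ρ : E N → ℝ} {ε δ : ℝ≥0∞} {u u' u'' : E N → ℂ}
    {w w' w'' : Fin N → E N → ℂ} (h : MemWeightedH1 ρ u w) (h' : MemWeightedH1 ρ u' w')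
    (h'' : MemWeightedH1 ρ u'' w'') (c : WeightedH1Close ρ ε u w u' w')
    (c' : WeightedH1Close ρ δ u' w' u'' w'') : WeightedH1Close ρ (ε + δ) u w u'' w'' where
  fst := eLpNorm_sub_le_add h.memLp h'.memLp h''.memLp c.fst c'.fst
  deriv j := eLpNorm_sub_le_add (h.memLp_deriv j) (h'.memLp_deriv j) (h''.memLp_deriv j)
    (c.deriv j) (c'.deriv j)
  weight := eLpNorm_sub_le_add h.memLp_weight h'.memLp_weight h''.memLp_weight c.weight c'.weight

lemma exists_weightedH1Close {N : ℕ} {ρ : E N → ℝ} {u : E N → ℂ} {w : Fin N → E N → ℂ}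
    {u' : ℕ → E N → ℂ} {w' : ℕ → Fin N → E N → ℂ}
    (h1 : Tendsto (fun n => eLpNorm (fun x => u' n x - u x) 2 volume) atTop (𝓝 0))
    (h2 : ∀ j, Tendsto (fun n => eLpNorm (fun x => w' n j x - w j x) 2 volume) atTop (𝓝 0))
    (h3 : Tendsto (fun n => eLpNorm (fun x => ρ x • u' n x - ρ x • u x) 2 volume) atTop (𝓝 0))
    {ε : ℝ≥0∞} (hε : ε ≠ 0) : ∃ n, WeightedH1Close ρ ε u w (u' n) (w' n) := by
  have hp : 0 < ε := pos_iff_ne_zero.2 hε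
  have e1 := ENNReal.tendsto_nhds_zero.1 h1 ε hp
  have e2 : ∀ᶠ n in atTop, ∀ j, eLpNorm (fun x => w' n j x - w j x) 2 volume ≤ ε :=
    eventually_all.2 fun j => ENNReal.tendsto_nhds_zero.1 (h2 j) ε hp
  have e3 := ENNReal.tendsto_nhds_zero.1 h3 ε hp
  obtain ⟨n, n1, n2, n3⟩ := (e1.and (e2.and e3)).exists
  exact ⟨n, n1, n2, n3⟩

/-! ### Truncation of values -/

/-- A smooth compactly supported map `ℂ → ℂ` which is the identity near the origin. -/
def truncMap (z : ℂ) : ℂ := (⟨1, 2, one_pos, one_lt_two⟩ : ContDiffBump (0 : ℂ)) z • z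

lemma contDiff_truncMap : ContDiff ℝ 1 truncMap :=
  (ContDiffBump.contDiff _).smul contDiff_id

lemma hasCompactSupport_truncMap : HasCompactSupport truncMap :=
  (ContDiffBump.hasCompactSupport _).smul_right

lemma truncMap_eventuallyEq : truncMap =ᶠ[𝓝 0] id := by
  filter_upwards [(⟨1, 2, one_pos, one_lt_two⟩ : ContDiffBump (0 : ℂ)).eventuallyEq_one] with z hz
  rw [truncMap, hz]; simp

lemma truncMap_zero : truncMap 0 = 0 := by simp [truncMap]

lemma fderiv_truncMap_zero : fderiv ℝ truncMap 0 = ContinuousLinearMap.id ℝ ℂ := by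
  rw [truncMap_eventuallyEq.fderiv_eq, fderiv_id]

lemma exists_fderiv_truncMap_le : ∃ C : ℝ, ∀ z, ‖fderiv ℝ truncMap z‖ ≤ C :=
  (contDiff_truncMap.continuous_fderiv (by simp)).bounded_above_of_compact_support
    (hasCompactSupport_truncMap.fderiv ℝ)

lemma inv_smul_tendsto (z : ℂ) :
    Tendsto (fun n : ℕ => ((n : ℝ) + 1)⁻¹ • z) atTop (𝓝 0) := by
  have h : Tendsto (fun n : ℕ => ((n : ℝ) + 1)⁻¹) atTop (𝓝 0) :=
    tendsto_inv_atTop_zero.comp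
      (tendsto_atTop_add_const_right _ _ tendsto_natCast_atTop_atTop)
  simpa using h.smul_const z

/-- Approximation by bounded functions. -/
lemma exists_close_bounded {N : ℕ} {ρ : E N → ℝ} {u : E N → ℂ} {w : Fin N → E N → ℂ}
    (hρ : AEStronglyMeasurable ρ volume) (h : MemWeightedH1 ρ u w) {ε : ℝ≥0∞} (hε : ε ≠ 0) :
    ∃ u' w', MemWeightedH1 ρ u' w' ∧ WeightedH1Close ρ ε u w u' w' ∧ ∃ M : ℝ, ∀ x, ‖u' x‖ ≤ M := by
  obtain ⟨C, hC⟩ := exists_fderiv_truncMap_le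
  obtain ⟨M, hM⟩ := contDiff_truncMap.continuous.bounded_above_of_compact_support
    hasCompactSupport_truncMap
  let c : ℕ → ℝ := fun n => (n : ℝ) + 1
  have hc : ∀ n, 0 < c n := fun n => by positivity
  -- Since `truncMap` is the identity near 0, at each point this equals u for n large. The Lipschitz
  -- constant of z ↦ c T(z/c) does not depend on c, so |u'| ≤ C|u| for all n; the same bound
  -- dominates the weighted norm.
  let u' : ℕ → E N → ℂ := fun n x => c n • truncMap ((c n)⁻¹ • u x)
  let w' : ℕ → Fin N → E N → ℂ := fun n j x => fderiv ℝ truncMap ((c n)⁻¹ • u x) (w j x)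
  have hb1 : ∀ n x, ‖u' n x‖ ≤ C * ‖u x‖ := fun n x => by
    have h1 := norm_le_of_fderiv_le contDiff_truncMap truncMap_zero hC ((c n)⁻¹ • u x)
    simp only [u']
    rw [norm_smul, Real.norm_of_nonneg (hc n).le]
    rw [norm_smul, norm_inv, Real.norm_of_nonneg (hc n).le] at h1
    calc c n * ‖truncMap ((c n)⁻¹ • u x)‖ ≤ c n * (C * ((c n)⁻¹ * ‖u x‖)) := by gcongr
      _ = C * ‖u x‖ := by field_simp [(hc n).ne']
  have hb2 : ∀ n j x, ‖w' n j x‖ ≤ C * ‖w j x‖ := fun n j x =>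
    ((fderiv ℝ truncMap _).le_opNorm _).trans (by gcongr; exact hC _)
  have hum : ∀ n, AEStronglyMeasurable (u' n) volume := fun n =>
    (contDiff_truncMap.continuous.comp_aestronglyMeasurable
      (h.memLp.1.const_smul (c n)⁻¹)).const_smul (c n)
  have hwm : ∀ n j, AEStronglyMeasurable (w' n j) volume := fun n j =>
    (continuous_fderiv_uncurry contDiff_truncMap).comp_aestronglyMeasurable
      ((h.memLp.1.const_smul (c n)⁻¹).prodMk (h.memLp_deriv j).1)
  have hlim1 : ∀ x, Tendsto (fun n => u' n x) atTop (𝓝 (u x)) := fun x => by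
    refine tendsto_nhds_of_eventually_eq ?_
    filter_upwards [(inv_smul_tendsto (u x)).eventually truncMap_eventuallyEq] with n hn
    simp only [u', c]
    rw [hn, id, smul_inv_smul₀ (hc n).ne']
  have hlim2 : ∀ j x, Tendsto (fun n => w' n j x) atTop (𝓝 (w j x)) := fun j x => by
    have hcont : Continuous fun z => fderiv ℝ truncMap z (w j x) :=
      (contDiff_truncMap.continuous_fderiv (by simp)).clm_apply continuous_const
    have := (hcont.tendsto 0).comp (inv_smul_tendsto (u x))
    rw [fderiv_truncMap_zero] at this
    exact this
  have hb1' : ∀ n x, ‖ρ x • u' n x‖ ≤ C * ‖ρ x • u x‖ := fun n x => by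
    rw [norm_smul (ρ x) (u' n x), norm_smul (ρ x) (u x), mul_left_comm]
    exact mul_le_mul_of_nonneg_left (hb1 n x) (norm_nonneg _)
  have hmem : ∀ n, MemWeightedH1 ρ (u' n) (w' n) := fun n => by
    refine ⟨h.memLp.of_le_mul (hum n) (Eventually.of_forall (hb1 n)),
      fun j => (h.memLp_deriv j).of_le_mul (hwm n j) (Eventually.of_forall (hb2 n j)), fun j => ?_,
      h.memLp_weight.of_le_mul (hρ.smul (hum n)) (Eventually.of_forall (hb1' n))⟩
    have h1 := (((h.weak j).const_smul (c n)⁻¹).comp contDiff_truncMap hC).const_smul (c n)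
    simp only [map_smul, smul_inv_smul₀ (hc n).ne'] at h1
    exact h1
  have hsub : ∀ {f g : ℂ}, ‖f‖ ≤ C * ‖g‖ → ‖f - g‖ ≤ (C + 1) * ‖g‖ := fun {f g} hfg => by
    have := norm_sub_le f g
    linarith
  obtain ⟨n, hn⟩ := exists_weightedH1Close (ρ := ρ) (u := u) (w := w) (u' := u') (w' := w')
    (tendsto_eLpNorm_two_of_dominated hum h.memLp.1 (h.memLp.norm.const_mul (C + 1))
      (fun n => Eventually.of_forall fun x => hsub (hb1 n x)) (Eventually.of_forall hlim1))
    (fun j => tendsto_eLpNorm_two_of_dominated (fun n => hwm n j) (h.memLp_deriv j).1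
      ((h.memLp_deriv j).norm.const_mul (C + 1))
      (fun n => Eventually.of_forall fun x => hsub (hb2 n j x)) (Eventually.of_forall (hlim2 j)))
    (tendsto_eLpNorm_two_of_dominated (fun n => hρ.smul (hum n)) h.memLp_weight.1
      (h.memLp_weight.norm.const_mul (C + 1))
      (fun n => Eventually.of_forall fun x => hsub (hb1' n x))
      (Eventually.of_forall fun x => (hlim1 x).const_smul (ρ x))) hε
  refine ⟨u' n, w' n, hmem n, hn, c n * M, fun x => ?_⟩
  simp only [u']
  rw [norm_smul, Real.norm_of_nonneg (hc n).le]
  exact mul_le_mul_of_nonneg_left (hM _) (hc n).le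

/-! ### Spatial cutoff -/

/-- A cutoff function on the space. -/
def cutoff (N : ℕ) : E N → ℝ := (⟨1, 2, one_pos, one_lt_two⟩ : ContDiffBump (0 : E N))

lemma contDiff_cutoff {N : ℕ} : ContDiff ℝ ∞ (cutoff N) := ContDiffBump.contDiff _

lemma hasCompactSupport_cutoff {N : ℕ} : HasCompactSupport (cutoff N) :=
  ContDiffBump.hasCompactSupport _

lemma cutoff_eventuallyEq {N : ℕ} : cutoff N =ᶠ[𝓝 0] 1 := ContDiffBump.eventuallyEq_one _

lemma norm_cutoff_le {N : ℕ} (x : E N) : ‖cutoff N x‖ ≤ 1 := by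
  have h : 0 ≤ cutoff N x := ContDiffBump.nonneg _
  rw [Real.norm_of_nonneg h]
  exact ContDiffBump.le_one _

lemma cutoff_eq_zero {N : ℕ} {x : E N} (hx : 2 ≤ ‖x‖) : cutoff N x = 0 :=
  ContDiffBump.zero_of_le_dist _ (by simpa using hx)

lemma exists_fderiv_cutoff_le (N : ℕ) : ∃ C : ℝ, ∀ x, ‖fderiv ℝ (cutoff N) x‖ ≤ C :=
  (contDiff_cutoff.continuous_fderiv (by simp)).bounded_above_of_compact_support
    (hasCompactSupport_cutoff.fderiv ℝ)

/-- Approximation by compactly supported functions. -/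
lemma exists_close_compactlySupported {N : ℕ} {ρ : E N → ℝ} {u : E N → ℂ} {w : Fin N → E N → ℂ}
    (hρ : AEStronglyMeasurable ρ volume) (h : MemWeightedH1 ρ u w) {M : ℝ} (hM : ∀ x, ‖u x‖ ≤ M)
    {ε : ℝ≥0∞} (hε : ε ≠ 0) :
    ∃ u' w', MemWeightedH1 ρ u' w' ∧ WeightedH1Close ρ ε u w u' w' ∧ (∀ x, ‖u' x‖ ≤ M) ∧
      ∃ R : ℝ, ∀ x, R ≤ ‖x‖ → u' x = 0 := by
  obtain ⟨C, hC⟩ := exists_fderiv_cutoff_le N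
  have hC0 : 0 ≤ C := (norm_nonneg _).trans (hC 0)
  let c : ℕ → ℝ := fun n => (n : ℝ) + 1
  have hc : ∀ n, 0 < c n := fun n => by positivity
  have hc1 : ∀ n, (c n)⁻¹ ≤ 1 := fun n => inv_le_one_of_one_le₀ (by
    simp only [c]; linarith [(Nat.cast_nonneg n : (0 : ℝ) ≤ n)])
  have hcinv : Tendsto (fun n => (c n)⁻¹) atTop (𝓝 0) :=
    tendsto_inv_atTop_zero.comp (tendsto_atTop_add_const_right _ _ tendsto_natCast_atTop_atTop)
  -- The gradient of the dilated cutoff is O(1/c n), so the extra term u∇χ tends to 0.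
  let χ : ℕ → E N → ℝ := fun n x => cutoff N ((c n)⁻¹ • x)
  have hχ : ∀ n, ContDiff ℝ ∞ (χ n) := fun n => contDiff_cutoff.comp (contDiff_id.const_smul _)
  have hχd : ∀ n x v, fderiv ℝ (χ n) x v = (c n)⁻¹ * fderiv ℝ (cutoff N) ((c n)⁻¹ • x) v := by
    intro n x v
    have h1 : HasFDerivAt (cutoff N) (fderiv ℝ (cutoff N) ((c n)⁻¹ • x)) ((c n)⁻¹ • x) :=
      (contDiff_cutoff.differentiable (by simp)).differentiableAt.hasFDerivAt
    have h2 := h1.comp x ((hasFDerivAt_id x).const_smul (c n)⁻¹)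
    have h3 : fderiv ℝ (χ n) x = _ := h2.fderiv
    rw [h3]; simp
  have hχdb : ∀ n x j, ‖fderiv ℝ (χ n) x (basisVec j)‖ ≤ (c n)⁻¹ * C := fun n x j => by
    rw [hχd, norm_mul, norm_inv, Real.norm_of_nonneg (hc n).le]
    have h1 := (fderiv ℝ (cutoff N) ((c n)⁻¹ • x)).le_opNorm (basisVec j)
    rw [show ‖(basisVec j : E N)‖ = 1 by simp, mul_one] at h1
    exact mul_le_mul_of_nonneg_left (h1.trans (hC _)) (inv_nonneg.2 (hc n).le)
  let u' : ℕ → E N → ℂ := fun n x => χ n x • u x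
  let w' : ℕ → Fin N → E N → ℂ := fun n j x =>
    χ n x • w j x + fderiv ℝ (χ n) x (basisVec j) • u x
  have hsmul : ∀ n x (z : ℂ), ‖χ n x • z‖ ≤ ‖z‖ := fun n x z => by
    rw [norm_smul]
    exact mul_le_of_le_one_left (norm_nonneg _) (norm_cutoff_le _)
  have hb1 : ∀ n x, ‖u' n x‖ ≤ ‖u x‖ := fun n x => hsmul n x _
  have hb2 : ∀ n j x, ‖w' n j x‖ ≤ ‖w j x‖ + C * ‖u x‖ := fun n j x => by
    refine (norm_add_le _ _).trans (add_le_add (hsmul n x (w j x)) ?_)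
    rw [norm_smul]
    have := (hχdb n x j).trans (mul_le_of_le_one_left hC0 (hc1 n))
    gcongr
  have hb3 : ∀ n x, ‖ρ x • u' n x‖ ≤ ‖ρ x • u x‖ := fun n x => by
    rw [norm_smul (ρ x) (u' n x), norm_smul (ρ x) (u x)]
    exact mul_le_mul_of_nonneg_left (hb1 n x) (norm_nonneg _)
  have hχm : ∀ n, AEStronglyMeasurable (χ n) (volume : Measure (E N)) := fun n =>
    (hχ n).continuous.aestronglyMeasurable
  have hum : ∀ n, AEStronglyMeasurable (u' n) volume := fun n => (hχm n).smul h.memLp.1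
  have hwm : ∀ n j, AEStronglyMeasurable (w' n j) volume := fun n j =>
    ((hχm n).smul (h.memLp_deriv j).1).add
      ((continuous_fderiv_apply_const ((hχ n).of_le (by norm_cast))
        (basisVec j)).aestronglyMeasurable.smul h.memLp.1)
  have hb2L : ∀ j, MemLp (fun x => ‖w j x‖ + C * ‖u x‖) 2 volume := fun j =>
    (h.memLp_deriv j).norm.add (h.memLp.norm.const_mul C)
  have hmem : ∀ n, MemWeightedH1 ρ (u' n) (w' n) := fun n =>
    ⟨h.memLp.of_le (hum n) (Eventually.of_forall (hb1 n)),
      fun j => (hb2L j).of_le (hwm n j) (Eventually.of_forall fun x =>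
        (hb2 n j x).trans (Real.le_norm_self _)),
      fun j => (h.weak j).smooth_smul (hχ n),
      h.memLp_weight.of_le (hρ.smul (hum n)) (Eventually.of_forall (hb3 n))⟩
  have hχlim : ∀ x, ∀ᶠ n in atTop, χ n x = 1 := fun x => by
    have h1 : Tendsto (fun n => (c n)⁻¹ • x) atTop (𝓝 0) := by
      simpa using hcinv.smul_const x
    exact h1.eventually cutoff_eventuallyEq
  have hlim1 : ∀ x, Tendsto (fun n => u' n x) atTop (𝓝 (u x)) := fun x => by
    refine tendsto_nhds_of_eventually_eq ?_
    filter_upwards [hχlim x] with n hn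
    simp only [u']
    rw [hn, one_smul]
  have hlim2 : ∀ j x, Tendsto (fun n => w' n j x) atTop (𝓝 (w j x)) := fun j x => by
    have h1 : Tendsto (fun n => χ n x • w j x) atTop (𝓝 (w j x)) := by
      refine tendsto_nhds_of_eventually_eq ?_
      filter_upwards [hχlim x] with n hn
      rw [hn, one_smul]
    have h2 : Tendsto (fun n => fderiv ℝ (χ n) x (basisVec j)) atTop (𝓝 0) :=
      squeeze_zero_norm (fun n => hχdb n x j) (by simpa using hcinv.mul_const C)
    have h3 := h1.add (h2.smul_const (u x))
    rwa [zero_smul, add_zero] at h3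
  obtain ⟨n, hn⟩ := exists_weightedH1Close (ρ := ρ) (u := u) (w := w) (u' := u') (w' := w')
    (tendsto_eLpNorm_two_of_dominated hum h.memLp.1 (h.memLp.norm.add h.memLp.norm)
      (fun n => Eventually.of_forall fun x => (norm_sub_le _ _).trans
        (add_le_add (hb1 n x) le_rfl)) (Eventually.of_forall hlim1))
    (fun j => tendsto_eLpNorm_two_of_dominated (fun n => hwm n j) (h.memLp_deriv j).1
      ((hb2L j).add (h.memLp_deriv j).norm)
      (fun n => Eventually.of_forall fun x => (norm_sub_le _ _).trans
        (add_le_add (hb2 n j x) le_rfl)) (Eventually.of_forall (hlim2 j)))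
    (tendsto_eLpNorm_two_of_dominated (fun n => hρ.smul (hum n)) h.memLp_weight.1
      (h.memLp_weight.norm.add h.memLp_weight.norm)
      (fun n => Eventually.of_forall fun x => (norm_sub_le _ _).trans
        (add_le_add (hb3 n x) le_rfl))
      (Eventually.of_forall fun x => (hlim1 x).const_smul (ρ x))) hε
  refine ⟨u' n, w' n, hmem n, hn, fun x => (hb1 n x).trans (hM x), c n * 2, fun x hx => ?_⟩
  have hx' : 2 ≤ ‖(c n)⁻¹ • x‖ := by
    rw [norm_smul, norm_inv, Real.norm_of_nonneg (hc n).le, le_inv_mul_iff₀ (hc n)]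
    exact hx
  simp only [u', χ]
  rw [cutoff_eq_zero hx', zero_smul]

/-- Approximation of bounded, compactly supported functions by test functions. -/
lemma exists_close_test_of_bounded {N : ℕ} {ρ : E N → ℝ} {u : E N → ℂ} {w : Fin N → E N → ℂ}
    (hρ : ∀ K : Set (E N), IsCompact K → MemLp ρ 2 (volume.restrict K)) (hρm : AEStronglyMeasurable ρ volume)
    (h : MemWeightedH1 ρ u w) {M : ℝ} (hM : ∀ x, ‖u x‖ ≤ M) {R : ℝ}
    (hR : ∀ x, R ≤ ‖x‖ → u x = 0) {ε : ℝ≥0∞} (hε : ε ≠ 0) :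
    ∃ φ : TestFun N, WeightedH1Close ρ ε u w φ fun j x => fderiv ℝ φ x (basisVec j) := by
  have hul := h.memLp.locallyIntegrable (by norm_num)
  have hum : ∀ n, ContDiff ℝ ∞ (mollify n u) := fun n => contDiff_mollify hul
  -- Mollification has no uniform bound in the weighted norm for general ρ. Here, however, the
  -- mollifications stay bounded by M and vanish outside the ball of radius R + 1, so 2M|ρ| on that
  -- ball dominates the error; it is in L² because ρ is in L²_loc, and a.e. convergence concludes.
  have hb : MemLp ((Metric.closedBall (0 : E N) (R + 1)).indicator fun x => 2 * M * ‖ρ x‖) 2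
      volume := by
    rw [memLp_indicator_iff_restrict measurableSet_closedBall]
    exact (hρ _ (isCompact_closedBall _ _)).norm.const_mul (2 * M)
  have hbd : ∀ n x, ‖ρ x • mollify n u x - ρ x • u x‖ ≤
      (Metric.closedBall (0 : E N) (R + 1)).indicator (fun x => 2 * M * ‖ρ x‖) x := fun n x => by
    by_cases hx : x ∈ Metric.closedBall (0 : E N) (R + 1)
    · rw [Set.indicator_of_mem hx, ← smul_sub, norm_smul, mul_comm]
      refine mul_le_mul_of_nonneg_right ((norm_sub_le _ _).trans ?_) (norm_nonneg _)
      linarith [norm_mollify_le (n := n) hM x, hM x]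
    · rw [Set.indicator_of_notMem hx]
      rw [mem_closedBall_zero_iff, not_le] at hx
      rw [mollify_eq_zero hR hx.le, hR x (by linarith)]
      simp
  obtain ⟨n, hn⟩ := exists_weightedH1Close (ρ := ρ) (u := u) (w := w)
    (u' := fun n => mollify n u) (w' := fun n j => mollify n (w j))
    (eLpNorm_mollify_sub_tendsto (by norm_num) (by simp) h.memLp)
    (fun j => eLpNorm_mollify_sub_tendsto (by norm_num) (by simp) (h.memLp_deriv j))
    (tendsto_eLpNorm_two_of_dominated
      (fun n => hρm.smul (hum n).continuous.aestronglyMeasurable) h.memLp_weight.1 hb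
      (fun n => Eventually.of_forall (hbd n)) (by
        filter_upwards [mollify_tendsto_ae hul] with x hx
        exact hx.const_smul (ρ x))) hε
  have hcs : HasCompactSupport (mollify n u) := by
    refine HasCompactSupport.intro (isCompact_closedBall (0 : E N) (R + 1)) fun x hx => ?_
    rw [mem_closedBall_zero_iff, not_le] at hx
    exact mollify_eq_zero hR hx.le
  refine ⟨⟨mollify n u, hum n, hcs, by simp⟩, hn.fst, fun j => ?_, hn.weight⟩
  have e : ∀ x, fderiv ℝ (mollify n u) x (basisVec j) = mollify n (w j) x :=
    (h.weak j).fderiv_mollify n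
  change eLpNorm (fun x => fderiv ℝ (mollify n u) x (basisVec j) - w j x) 2 volume ≤ ε
  simp_rw [e]
  exact hn.deriv j

lemma memWeightedH1_test {N : ℕ} {ρ : E N → ℝ}
    (hρ : ∀ K : Set (E N), IsCompact K → MemLp ρ 2 (volume.restrict K))
    (hρm : AEStronglyMeasurable ρ volume) (φ : TestFun N) :
    MemWeightedH1 ρ φ fun j x => fderiv ℝ φ x (basisVec j) := by
  have hφ : ContDiff ℝ 1 φ := φ.contDiff.of_le (by simp)
  refine ⟨memLp_test φ, fun j => (continuous_fderiv_apply_const hφ _).memLp_of_hasCompactSupport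
    (hasCompactSupport_fderiv_apply φ.hasCompactSupport _),
    fun j => isWeakDeriv_of_contDiff _ hφ, ?_⟩
  obtain ⟨M, hM⟩ := φ.continuous.bounded_above_of_compact_support φ.hasCompactSupport
  have hb : MemLp ((tsupport φ).indicator fun x => M * ‖ρ x‖) 2 volume := by
    rw [memLp_indicator_iff_restrict (isClosed_tsupport _).measurableSet]
    exact (hρ _ φ.hasCompactSupport).norm.const_mul M
  refine hb.of_le (hρm.smul φ.continuous.aestronglyMeasurable) (Eventually.of_forall fun x => ?_)
  by_cases hx : x ∈ tsupport φ
  · rw [Set.indicator_of_mem hx, norm_smul, mul_comm]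
    exact (mul_le_mul_of_nonneg_right (hM x) (norm_nonneg _)).trans (Real.le_norm_self _)
  · simp [image_eq_zero_of_notMem_tsupport hx]

/-- Test functions are dense in the weighted Sobolev space. -/
lemma exists_close_test {N : ℕ} {ρ : E N → ℝ} {u : E N → ℂ} {w : Fin N → E N → ℂ}
    (hρ : ∀ K : Set (E N), IsCompact K → MemLp ρ 2 (volume.restrict K))
    (hρm : AEStronglyMeasurable ρ volume) (h : MemWeightedH1 ρ u w) {ε : ℝ≥0∞} (hε : ε ≠ 0) :
    ∃ φ : TestFun N, WeightedH1Close ρ ε u w φ fun j x => fderiv ℝ φ x (basisVec j) := by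
  have hε3 : ε / 3 ≠ 0 := by simp [hε]
  obtain ⟨u₁, w₁, h₁, c₁, M, hM⟩ := exists_close_bounded hρm h hε3
  obtain ⟨u₂, w₂, h₂, c₂, hM₂, R, hR⟩ := exists_close_compactlySupported hρm h₁ hM hε3
  obtain ⟨φ, c₃⟩ := exists_close_test_of_bounded hρ hρm h₂ hM₂ hR hε3
  have := (c₁.trans h h₁ h₂ c₂).trans h h₂ (memWeightedH1_test hρ hρm φ) c₃
  rw [ENNReal.add_thirds] at this
  exact ⟨φ, this⟩

/-! ### The magnetic potential as a multiplier, and the diamagnetic inequality -/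

lemma norm_le_sum_basisVec {N : ℕ} (L : E N →L[ℝ] ℂ) : ‖L‖ ≤ ∑ j, ‖L (basisVec j)‖ := by
  refine L.opNorm_le_bound (Finset.sum_nonneg fun _ _ => norm_nonneg _) fun x => ?_
  have hx : x = ∑ j, x j • (basisVec j : E N) := by
    ext i; simp [Finset.sum_apply, Pi.single_apply]
  have h : L x = ∑ j, x j • L (basisVec j) := by
    conv_lhs => rw [hx]
    simp only [map_sum, map_smul]
  rw [h, Finset.sum_mul]
  refine (norm_sum_le _ _).trans (Finset.sum_le_sum fun j _ => ?_)
  rw [norm_smul, mul_comm]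
  exact mul_le_mul_of_nonneg_left (PiLp.norm_apply_le x j) (norm_nonneg _)

lemma eLpNorm_fderiv_le_sum {N : ℕ} {u : E N → ℂ} (hu : ContDiff ℝ 1 u) :
    eLpNorm (fderiv ℝ u) 2 volume ≤
      ∑ j, eLpNorm (fun x => fderiv ℝ u x (basisVec j)) 2 volume := by
  have h1 : eLpNorm (fderiv ℝ u) 2 volume ≤
      eLpNorm (∑ j : Fin N, fun x => ‖fderiv ℝ u x (basisVec j)‖) 2 volume := by
    refine eLpNorm_mono_real fun x => ?_
    simpa using norm_le_sum_basisVec (fderiv ℝ u x)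
  refine h1.trans ((eLpNorm_sum_le (fun j _ =>
    (continuous_fderiv_apply_const hu _).norm.aestronglyMeasurable) (by norm_num)).trans ?_)
  exact Finset.sum_le_sum fun j _ => (eLpNorm_norm _).le

lemma exists_eLpNorm_weight_bound {N : ℕ} (hN : 1 ≤ N) {A : E N → E N} (hA : MemLpLoc A 2)
    (hA' : MagneticCondition A) : ∃ C : NNReal, ∀ u : E N → ℂ, ContDiff ℝ 1 u →
      eLpNorm (fun x => ‖A x‖ • u x) 2 volume ≤ C * (eLpNorm u 2 volume +
        ∑ j, eLpNorm (fun x => fderiv ℝ u x (basisVec j)) 2 volume) := by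
  obtain ⟨C, hC⟩ := exists_weight_bound hN hA hA'
  -- C + 1 replaces √C when square roots are taken, as C ≤ (C + 1)².
  refine ⟨C + 1, fun u hu => ?_⟩
  have h := hC u hu
  have e : ∫⁻ x, ‖A x‖ₑ ^ 2 * ‖u x‖ₑ ^ 2 = eLpNorm (fun x => ‖A x‖ • u x) 2 volume ^ 2 := by
    rw [eLpNorm_two_sq]
    refine lintegral_congr fun x => ?_
    rw [enorm_smul, enorm_norm, mul_pow]
  rw [e, ← eLpNorm_two_sq, ← eLpNorm_two_sq] at h
  set a := eLpNorm u 2 volume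
  set b := eLpNorm (fderiv ℝ u) 2 volume
  have h2 : eLpNorm (fun x => ‖A x‖ • u x) 2 volume ^ 2 ≤ (((C + 1 : NNReal) : ℝ≥0∞) * (a + b)) ^ 2 := by
    refine h.trans ?_
    rw [mul_pow]
    refine mul_le_mul' ?_ ?_
    · have : C ≤ (C + 1) ^ 2 := by
        rw [← NNReal.coe_le_coe]; push_cast; nlinarith [C.2, sq_nonneg (C : ℝ)]
      exact_mod_cast this
    · rw [add_sq']
      exact le_self_add
  have h3 := (ENNReal.pow_le_pow_left_iff two_ne_zero).1 h2
  refine h3.trans (mul_le_mul' le_rfl (add_le_add le_rfl (eLpNorm_fderiv_le_sum hu)))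

lemma eLpNorm_le_add_of_sub {N : ℕ} {f g : E N → ℂ} {ε : ℝ≥0∞} (hf : AEStronglyMeasurable f volume)
    (hg : AEStronglyMeasurable g volume) (h : eLpNorm (fun x => g x - f x) 2 volume ≤ ε) :
    eLpNorm g 2 volume ≤ eLpNorm f 2 volume + ε := by
  have e : g = f + fun x => g x - f x := by ext x; simp
  conv_lhs => rw [e]
  exact (eLpNorm_add_le hf (hg.sub hf) (by norm_num)).trans (add_le_add le_rfl h)

/-- The constant `C` bounds the multiplication by `|A|`, from `H¹` to `L²`. -/
def IsMultiplierBound {N : ℕ} (A : E N → E N) (C : NNReal) : Prop :=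
  ∀ (u : E N → ℂ) (w : Fin N → E N → ℂ), MemWeightedH1 0 u w →
    eLpNorm (fun x => ‖A x‖ • u x) 2 volume ≤
      C * (eLpNorm u 2 volume + ∑ j, eLpNorm (w j) 2 volume)

/-- The potential is a bounded multiplier from `H¹` to `L²`. -/
lemma exists_multiplier_bound {N : ℕ} (hN : 1 ≤ N) {A : E N → E N} (hA : MemLpLoc A 2)
    (hA' : MagneticCondition A) : ∃ C : NNReal, IsMultiplierBound A C := by
  obtain ⟨C, hC⟩ := exists_eLpNorm_weight_bound hN hA hA'
  refine ⟨C, fun u w h => ?_⟩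
  have hAm := (aestronglyMeasurable_of_memLpLoc hA).norm
  let ε : ℕ → ℝ≥0∞ := fun n => ((n : ℝ≥0∞) + 1)⁻¹
  have hε : ∀ n, ε n ≠ 0 := fun n => by simp [ε]
  have hεlim : Tendsto ε atTop (𝓝 0) := by
    have := (tendsto_add_atTop_iff_nat 1).2 ENNReal.tendsto_inv_nat_nhds_zero
    simpa [ε] using this
  have hφ : ∀ n, ∃ φ : TestFun N, WeightedH1Close 0 (ε n) u w φ fun j x =>
      fderiv ℝ φ x (basisVec j) := fun n =>
    exists_close_test (fun _ _ => MemLp.zero) aestronglyMeasurable_zero h (hε n)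
  choose φ hφ using hφ
  have hφc : ∀ n, ContDiff ℝ 1 (φ n) := fun n => (φ n).contDiff.of_le (by simp)
  have hlim : Tendsto (fun n => eLpNorm (⇑(φ n) - u) 2 volume) atTop (𝓝 0) :=
    tendsto_of_tendsto_of_tendsto_of_le_of_le tendsto_const_nhds hεlim (fun _ => zero_le)
      fun n => (hφ n).fst
  obtain ⟨ns, hns, hae⟩ := (tendstoInMeasure_of_tendsto_eLpNorm (by norm_num)
    (fun n => (φ n).continuous.aestronglyMeasurable) h.memLp.1 hlim).exists_seq_tendsto_ae
  -- Fatou along an a.e. convergent subsequence, because |A|u is not yet known to be in L².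
  have hfat := Lp.eLpNorm_lim_le_liminf_eLpNorm (p := 2) (μ := volume)
    (f := fun n x => ‖A x‖ • φ (ns n) x)
    (fun n => hAm.smul (φ (ns n)).continuous.aestronglyMeasurable) (fun x => ‖A x‖ • u x) (by
      filter_upwards [hae] with x hx
      exact hx.const_smul ‖A x‖)
  refine hfat.trans ?_
  have hb : ∀ n, eLpNorm (fun x => ‖A x‖ • φ n x) 2 volume ≤
      C * ((eLpNorm u 2 volume + ε n) + ∑ j, (eLpNorm (w j) 2 volume + ε n)) := fun n => by
    refine (hC (φ n) (hφc n)).trans (mul_le_mul' le_rfl (add_le_add ?_ ?_))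
    · exact eLpNorm_le_add_of_sub h.memLp.1 (φ n).continuous.aestronglyMeasurable (hφ n).fst
    · exact Finset.sum_le_sum fun j _ => eLpNorm_le_add_of_sub (h.memLp_deriv j).1
        (continuous_fderiv_apply_const (hφc n) _).aestronglyMeasurable ((hφ n).deriv j)
  have hblim : Tendsto (fun n => C * ((eLpNorm u 2 volume + ε n) +
      ∑ j, (eLpNorm (w j) 2 volume + ε n))) atTop
      (𝓝 (C * ((eLpNorm u 2 volume + 0) + ∑ j, (eLpNorm (w j) 2 volume + 0)))) := by
    refine ENNReal.Tendsto.const_mul ?_ (Or.inr ENNReal.coe_ne_top)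
    exact (tendsto_const_nhds.add hεlim).add
      (tendsto_finsetSum _ fun j _ => tendsto_const_nhds.add hεlim)
  simp only [add_zero] at hblim
  have hblim' := hblim.comp hns.tendsto_atTop
  rw [← hblim'.liminf_eq]
  exact liminf_le_liminf (Eventually.of_forall fun n => hb (ns n))

/-! ### Smooth approximation of the modulus -/

/-- The regularized modulus `√(1 + |z|²) - 1`. -/
def regAbs (z : ℂ) : ℂ := ((√(1 + ‖z‖ ^ 2) - 1 : ℝ) : ℂ)

lemma contDiff_regAbs : ContDiff ℝ 1 regAbs := by
  have h : ContDiff ℝ 1 fun z : ℂ => √(1 + ‖z‖ ^ 2) - 1 :=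
    ((contDiff_const.add (contDiff_norm_sq ℝ)).sqrt fun z => by positivity).sub contDiff_const
  exact Complex.ofRealCLM.contDiff.comp h

lemma fderiv_regAbs (z h : ℂ) :
    fderiv ℝ regAbs z h = (((√(1 + ‖z‖ ^ 2))⁻¹ * inner ℝ z h : ℝ) : ℂ) := by
  have h1 : HasFDerivAt (fun z : ℂ => ‖z‖ ^ 2) (2 • innerSL ℝ z) z :=
    (hasStrictFDerivAt_norm_sq z).hasFDerivAt
  have h2 := ((h1.const_add 1).sqrt (by positivity)).sub_const 1
  have h3 : HasFDerivAt regAbs _ z := Complex.ofRealCLM.hasFDerivAt.comp z h2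
  rw [h3.fderiv]
  simp [mul_assoc, mul_comm]
  ring

/-- Cauchy–Schwarz and |z| ≤ √(1 + |z|²). The constant 1 is the one in the diamagnetic inequality.
-/
lemma norm_fderiv_regAbs_le (z : ℂ) : ‖fderiv ℝ regAbs z‖ ≤ 1 := by
  refine ContinuousLinearMap.opNorm_le_bound _ zero_le_one fun h => ?_
  have hs : ‖z‖ ≤ √(1 + ‖z‖ ^ 2) := Real.le_sqrt_of_sq_le (by linarith)
  have hpos : 0 < √(1 + ‖z‖ ^ 2) := by positivity
  rw [fderiv_regAbs, Complex.norm_real, norm_mul, norm_inv, Real.norm_of_nonneg hpos.le, one_mul,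
    inv_mul_le_iff₀ hpos]
  exact (norm_inner_le_norm z h).trans (mul_le_mul_of_nonneg_right hs (norm_nonneg _))

lemma regAbs_zero : regAbs 0 = 0 := by simp [regAbs]

/-- The regularized modulus is insensitive to infinitesimal rotations. -/
lemma fderiv_regAbs_rotation (z : ℂ) (a : ℝ) : fderiv ℝ regAbs z (Complex.I * a * z) = 0 := by
  rw [fderiv_regAbs]
  have : inner ℝ z (Complex.I * a * z) = 0 := by
    simp [Complex.inner]; ring
  rw [this]; simp

/-- With c = n + 1 the scaled function is √(c⁻² + |z|²) - c⁻¹. Subtracting 1 in `regAbs` makes it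
vanish at 0, so that composition with an L² function stays in L². -/
lemma regAbs_scaled_tendsto (z : ℂ) :
    Tendsto (fun n : ℕ => ((n : ℝ) + 1)⁻¹ • regAbs (((n : ℝ) + 1) • z)) atTop (𝓝 (‖z‖ : ℂ)) := by
  have hinv : Tendsto (fun n : ℕ => ((n : ℝ) + 1)⁻¹) atTop (𝓝 0) :=
    tendsto_inv_atTop_zero.comp (tendsto_atTop_add_const_right _ _ tendsto_natCast_atTop_atTop)
  have h1 : Tendsto (fun n : ℕ => √((((n : ℝ) + 1)⁻¹) ^ 2 + ‖z‖ ^ 2) - ((n : ℝ) + 1)⁻¹) atTop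
      (𝓝 (√(0 ^ 2 + ‖z‖ ^ 2) - 0)) :=
    ((Real.continuous_sqrt.tendsto _).comp ((hinv.pow 2).add_const _)).sub hinv
  have h2 : √(0 ^ 2 + ‖z‖ ^ 2) - 0 = ‖z‖ := by
    rw [zero_pow two_ne_zero, zero_add, sub_zero, Real.sqrt_sq (norm_nonneg z)]
  rw [h2] at h1
  refine ((Complex.continuous_ofReal.tendsto _).comp h1).congr fun n => ?_
  have hc : 0 < (n : ℝ) + 1 := by positivity
  rw [Function.comp_apply, regAbs, ← Complex.coe_smul, smul_eq_mul, ← Complex.ofReal_mul,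
    Complex.ofReal_inj, norm_smul, Real.norm_of_nonneg hc.le, mul_sub, mul_one]
  congr 1
  rw [← Real.sqrt_sq (inv_nonneg.2 hc.le), ← Real.sqrt_mul (sq_nonneg _),
    Real.sqrt_sq (inv_nonneg.2 hc.le)]
  congr 1
  field_simp

/-- By the diamagnetic inequality, the multiplier bound extends to functions with a magnetic
gradient in `L²`. -/
lemma magnetic_multiplier_bound {N : ℕ} {A : E N → E N} (hA : MemLpLoc A 2) {C : NNReal}
    (hC : IsMultiplierBound A C)
    {u : E N → ℂ} {w : Fin N → E N → ℂ} (hu : MemLp u 2 volume) (hw : ∀ j, MemLp (w j) 2 volume)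
    (h : ∀ j, IsWeakDeriv (basisVec j) u fun x => w j x - Complex.I * (A x j : ℂ) * u x) :
    eLpNorm (fun x => ‖A x‖ • u x) 2 volume ≤
      C * (eLpNorm u 2 volume + ∑ j, eLpNorm (w j) 2 volume) := by
  have hAm := (aestronglyMeasurable_of_memLpLoc hA).norm
  let c : ℕ → ℝ := fun n => (n : ℝ) + 1
  have hc : ∀ n, 0 < c n := fun n => by positivity
  -- These functions approximate |u|, not u. They are in H¹ although the weak gradient of u is so
  -- far only locally integrable.
  let g : ℕ → E N → ℂ := fun n x => (c n)⁻¹ • regAbs (c n • u x)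
  let d : ℕ → Fin N → E N → ℂ := fun n j x => fderiv ℝ regAbs (c n • u x) (w j x)
  have hgm : ∀ n, AEStronglyMeasurable (g n) volume := fun n =>
    (contDiff_regAbs.continuous.comp_aestronglyMeasurable (hu.1.const_smul (c n))).const_smul (c n)⁻¹
  have hdm : ∀ n j, AEStronglyMeasurable (d n j) volume := fun n j =>
    (continuous_fderiv_uncurry contDiff_regAbs).comp_aestronglyMeasurable
      ((hu.1.const_smul (c n)).prodMk (hw j).1)
  have hgb : ∀ n x, ‖g n x‖ ≤ ‖u x‖ := fun n x => by
    have h1 := norm_le_of_fderiv_le contDiff_regAbs regAbs_zero norm_fderiv_regAbs_le (c n • u x)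
    rw [one_mul, norm_smul, Real.norm_of_nonneg (hc n).le] at h1
    change ‖(c n)⁻¹ • regAbs (c n • u x)‖ ≤ _
    rwa [norm_smul, norm_inv, Real.norm_of_nonneg (hc n).le, inv_mul_le_iff₀ (hc n)]
  have hdb : ∀ n j x, ‖d n j x‖ ≤ ‖w j x‖ := fun n j x =>
    ((fderiv ℝ regAbs _).le_opNorm _).trans
      (mul_le_of_le_one_left (norm_nonneg _) (norm_fderiv_regAbs_le _))
  have hmem : ∀ n, MemWeightedH1 0 (g n) (d n) := fun n => by
    refine ⟨hu.of_le (hgm n) (Eventually.of_forall (hgb n)),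
      fun j => (hw j).of_le (hdm n j) (Eventually.of_forall (hdb n j)), fun j => ?_, by simp⟩
    have h1 := (((h j).const_smul (c n)).comp contDiff_regAbs norm_fderiv_regAbs_le).const_smul
      (c n)⁻¹
    -- The gradient of u is w - iAu, and iAu is an infinitesimal rotation of u, which the derivative
    -- of `regAbs` annihilates. Only w remains, and it is in L².
    have e : ∀ x, (c n)⁻¹ • fderiv ℝ regAbs (c n • u x)
        (c n • (w j x - Complex.I * (A x j : ℂ) * u x)) = d n j x := fun x => by
      have h0 := fderiv_regAbs_rotation (c n • u x) (A x j)
      rw [mul_smul_comm, map_smul] at h0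
      have h0' := (smul_eq_zero_iff_right (hc n).ne').1 h0
      rw [map_smul, inv_smul_smul₀ (hc n).ne', map_sub, h0', sub_zero]
    simp_rw [e] at h1
    exact h1
  have hfat := Lp.eLpNorm_lim_le_liminf_eLpNorm (p := 2) (μ := volume)
    (f := fun n x => ‖A x‖ • g n x) (fun n => hAm.smul (hgm n))
    (fun x => ‖A x‖ • (‖u x‖ : ℂ))
    (Eventually.of_forall fun x => (regAbs_scaled_tendsto (u x)).const_smul ‖A x‖)
  have e : eLpNorm (fun x => ‖A x‖ • u x) 2 volume =
      eLpNorm (fun x => ‖A x‖ • (‖u x‖ : ℂ)) 2 volume := by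
    refine eLpNorm_congr_norm_ae (Eventually.of_forall fun x => ?_)
    simp
  rw [e]
  refine hfat.trans ?_
  have hb : ∀ n, eLpNorm (fun x => ‖A x‖ • g n x) 2 volume ≤
      C * (eLpNorm u 2 volume + ∑ j, eLpNorm (w j) 2 volume) := fun n => by
    refine (hC (g n) (d n) (hmem n)).trans (mul_le_mul' le_rfl (add_le_add ?_ ?_))
    · exact eLpNorm_mono (hgb n)
    · exact Finset.sum_le_sum fun j _ => eLpNorm_mono (hdb n j)
  exact (liminf_le_liminf (Eventually.of_forall hb)).trans (by simp)

/-! ### Gradients and magnetic gradients of the same function -/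

lemma isGrad_iff_isWeakDeriv {N : ℕ} {u : L2 N} {w : L2v N} :
    IsGrad u w ↔ ∀ j, IsWeakDeriv (basisVec j) u fun x => w x j :=
  forall_congr' fun j => (isWeakDeriv_iff (locInt_of_memLpLoc (memLpLoc_L2 u))
    (locInt_of_memLpLoc (memLpLoc_L2v w j)) j).symm

lemma isMagGrad_iff_isWeakDeriv {N : ℕ} {A : E N → E N} (hA : MemLpLoc A 2) {u : L2 N}
    {w : L2v N} : IsMagGrad A u w ↔
      ∀ j, IsWeakDeriv (basisVec j) u fun x => w x j - Complex.I * (A x j : ℂ) * u x := by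
  refine forall_congr' fun j => ?_
  have hw := locInt_of_memLpLoc (memLpLoc_L2v w j)
  have hAu := locInt_I_mul hA (memLpLoc_L2 u) j
  have hsub : LocallyIntegrable (fun x => w x j - Complex.I * (A x j : ℂ) * u x) volume :=
    hw.sub hAu
  rw [isWeakDeriv_iff (locInt_of_memLpLoc (memLpLoc_L2 u)) hsub, covDeriv]
  have e : toDistr (fun x => w x j) =
      toDistr (fun x => w x j - Complex.I * (A x j : ℂ) * u x) +
        toDistr (fun x => Complex.I * (A x j : ℂ) * u x) := by
    rw [← toDistr_add hsub hAu]
    simp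
  rw [e, add_left_inj]

lemma eLpNorm_L2v_coord_le {N : ℕ} (w : L2v N) (j : Fin N) :
    eLpNorm (fun x => w x j) 2 volume ≤ ‖w‖ₑ := by
  rw [Lp.enorm_def]
  exact eLpNorm_mono fun x => PiLp.norm_apply_le (w x) j

lemma enorm_L2v_le_sum {N : ℕ} (w : L2v N) :
    ‖w‖ₑ ≤ ∑ j, eLpNorm (fun x => w x j) 2 volume := by
  rw [Lp.enorm_def]
  have h1 : eLpNorm w 2 volume ≤ eLpNorm (∑ j : Fin N, fun x => ‖w x j‖) 2 volume := by
    refine eLpNorm_mono_real fun x => ?_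
    simpa using norm_le_sum (w x)
  refine h1.trans ((eLpNorm_sum_le (fun j _ => (memLp_coord (Lp.memLp w) j).1.norm)
    (by norm_num)).trans ?_)
  exact Finset.sum_le_sum fun j _ => (eLpNorm_norm _).le

lemma exists_L2v {N : ℕ} {f : Fin N → E N → ℂ} (hf : ∀ j, MemLp (f j) 2 volume) :
    ∃ w : L2v N, ∀ j, (fun x => w x j) =ᵐ[volume] f j := by
  have h : MemLp (fun x => (WithLp.toLp 2 fun j => f j x : EuclideanSpace ℂ (Fin N))) 2 volume :=
    MemLp.of_eval_piLp hf
  refine ⟨h.toLp _, fun j => ?_⟩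
  filter_upwards [h.coeFn_toLp] with x hx
  rw [hx]

/-- Adding a multiple of `i A u` to a vector field. -/
lemma exists_add_potential {N : ℕ} {A : E N → E N} (hA : MemLpLoc A 2) {C : NNReal} {u : L2 N}
    {w : L2v N} {s : ℂ} (hs : ‖s‖ ≤ 1)
    (h : eLpNorm (fun x => ‖A x‖ • u x) 2 volume ≤
      C * (eLpNorm u 2 volume + ∑ j, eLpNorm (fun x => w x j) 2 volume)) :
    ∃ w' : L2v N, (∀ j, (fun x => w' x j) =ᵐ[volume]
      fun x => w x j + s * (Complex.I * (A x j : ℂ) * u x)) ∧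
      ‖w'‖ ≤ N * (1 + C * (1 + N)) * (‖u‖ + ‖w‖) := by
  have hum : AEStronglyMeasurable u volume := Lp.aestronglyMeasurable u
  have hAm := aestronglyMeasurable_of_memLpLoc hA
  have hb : eLpNorm (fun x => ‖A x‖ • u x) 2 volume ≤ C * (‖u‖ₑ + N * ‖w‖ₑ) := by
    refine h.trans (mul_le_mul' le_rfl (add_le_add (le_of_eq (Lp.enorm_def u).symm) ?_))
    refine (Finset.sum_le_sum fun j _ => eLpNorm_L2v_coord_le w j).trans ?_
    simp
  have hAu : MemLp (fun x => ‖A x‖ • u x) 2 volume := by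
    refine ⟨hAm.norm.smul hum, hb.trans_lt ?_⟩
    exact ENNReal.mul_lt_top ENNReal.coe_lt_top (ENNReal.add_lt_top.2
      ⟨enorm_lt_top, ENNReal.mul_lt_top (ENNReal.natCast_lt_top N) enorm_lt_top⟩)
  have hle : ∀ j x, ‖s * (Complex.I * (A x j : ℂ) * u x)‖ ≤ ‖‖A x‖ • u x‖ := fun j x => by
    rw [norm_mul, norm_mul, norm_mul, Complex.norm_I, one_mul, Complex.norm_real, norm_smul,
      norm_norm]
    refine (mul_le_of_le_one_left (by positivity) hs).trans ?_
    exact mul_le_mul_of_nonneg_right (PiLp.norm_apply_le (A x) j) (norm_nonneg _)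
  have hm : ∀ j, AEStronglyMeasurable (fun x => s * (Complex.I * (A x j : ℂ) * u x)) volume :=
    fun j => (locInt_I_mul hA (memLpLoc_L2 u) j).aestronglyMeasurable.const_mul s
  have hf : ∀ j, MemLp (fun x => s * (Complex.I * (A x j : ℂ) * u x)) 2 volume := fun j =>
    hAu.of_le (hm j) (Eventually.of_forall (hle j))
  obtain ⟨w', hw'⟩ := exists_L2v fun j => (memLp_coord (Lp.memLp w) j).add (hf j)
  refine ⟨w', hw', ?_⟩
  -- Each of the N components of w' is bounded by ‖w‖ plus the multiplier bound for Au.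
  have hsum : ‖w'‖ₑ ≤ N * (‖w‖ₑ + C * (‖u‖ₑ + N * ‖w‖ₑ)) := by
    refine (enorm_L2v_le_sum w').trans ?_
    have hj : ∀ j, eLpNorm (fun x => w' x j) 2 volume ≤ ‖w‖ₑ + C * (‖u‖ₑ + N * ‖w‖ₑ) := fun j => by
      rw [eLpNorm_congr_ae (hw' j)]
      refine (eLpNorm_add_le (memLp_coord (Lp.memLp w) j).1 (hm j) (by norm_num)).trans
        (add_le_add (eLpNorm_L2v_coord_le w j) ((eLpNorm_mono (hle j)).trans hb))
    refine (Finset.sum_le_sum fun j _ => hj j).trans (le_of_eq ?_)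
    rw [Finset.sum_const, Finset.card_univ, Fintype.card_fin, nsmul_eq_mul]
  have hreal : ‖w'‖ ≤ N * (‖w‖ + C * (‖u‖ + N * ‖w‖)) := by
    have e : (N * (‖w‖ₑ + C * (‖u‖ₑ + N * ‖w‖ₑ)) : ℝ≥0∞) =
        ENNReal.ofReal (N * (‖w‖ + C * (‖u‖ + N * ‖w‖))) := by
      rw [ENNReal.ofReal_mul (by positivity), ENNReal.ofReal_add (by positivity) (by positivity),
        ENNReal.ofReal_mul (by positivity), ENNReal.ofReal_add (by positivity) (by positivity),
        ENNReal.ofReal_mul (by positivity), ofReal_norm, ofReal_norm, ENNReal.ofReal_natCast,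
        ENNReal.ofReal_coe_nnreal]
    rw [e, ← ofReal_norm] at hsum
    exact (ENNReal.ofReal_le_ofReal_iff (by positivity)).1 hsum
  refine hreal.trans ?_
  rw [mul_assoc]
  refine mul_le_mul_of_nonneg_left ?_ (by positivity)
  have h1 := norm_nonneg u
  have h2 := norm_nonneg w
  have h3 : (0 : ℝ) ≤ C := C.2
  have h4 : (0 : ℝ) ≤ N := by positivity
  nlinarith [mul_nonneg h3 h1, mul_nonneg h3 h2, mul_nonneg (mul_nonneg h3 h4) h1]

lemma memWeightedH1_of_isGrad {N : ℕ} {u : L2 N} {w : L2v N} (h : IsGrad u w) :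
    MemWeightedH1 0 u fun j x => w x j :=
  ⟨Lp.memLp u, memLp_coord (Lp.memLp w), isGrad_iff_isWeakDeriv.1 h, by simp⟩

/-- The norm of the operators exchanging gradients and magnetic gradients. -/
def gradConst (N : ℕ) (C : NNReal) : ℝ := N * (1 + C * (1 + N))

lemma gradConst_nonneg {N : ℕ} {C : NNReal} : 0 ≤ gradConst N C := by
  have h : (0 : ℝ) ≤ C := C.2
  unfold gradConst; positivity

/-- ∇_A u = ∇u + iAu, and Au is in L² by the multiplier bound on H¹. -/
lemma IsGrad.exists_isMagGrad {N : ℕ} {A : E N → E N} (hA : MemLpLoc A 2) {C : NNReal}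
    (hC : IsMultiplierBound A C) {u : L2 N} {w : L2v N} (h : IsGrad u w) :
    ∃ w', IsMagGrad A u w' ∧ ‖w'‖ ≤ gradConst N C * (‖u‖ + ‖w‖) := by
  obtain ⟨w', hw', hn⟩ := exists_add_potential hA (s := 1) (by simp)
    (hC _ _ (memWeightedH1_of_isGrad h))
  refine ⟨w', (isMagGrad_iff_isWeakDeriv hA).2 fun j => ?_, hn⟩
  refine (isGrad_iff_isWeakDeriv.1 h j).congr (ae_eq_refl _) ?_
  filter_upwards [hw' j] with x hx
  rw [hx]; ring

/-- ∇u = ∇_A u - iAu. Here u is not known to be in H¹, so the bound on Au is the diamagnetic one. -/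
lemma IsMagGrad.exists_isGrad {N : ℕ} {A : E N → E N} (hA : MemLpLoc A 2) {C : NNReal}
    (hC : IsMultiplierBound A C) {u : L2 N} {w : L2v N} (h : IsMagGrad A u w) :
    ∃ w', IsGrad u w' ∧ ‖w'‖ ≤ gradConst N C * (‖u‖ + ‖w‖) := by
  have hw := (isMagGrad_iff_isWeakDeriv hA).1 h
  obtain ⟨w', hw', hn⟩ := exists_add_potential hA (s := -1) (by simp)
    (magnetic_multiplier_bound hA hC (Lp.memLp u) (memLp_coord (Lp.memLp w)) hw)
  refine ⟨w', isGrad_iff_isWeakDeriv.2 fun j => ?_, hn⟩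
  refine (hw j).congr (ae_eq_refl _) ?_
  filter_upwards [hw' j] with x hx
  rw [hx]; ring

/-! ### Norms in `H¹` and density of test functions -/

namespace H1

variable {N : ℕ}

lemma norm_sq (u : H1 N) : ‖u‖ ^ 2 = ‖u.toL2‖ ^ 2 + ‖grad u.toL2‖ ^ 2 := by
  rw [← real_inner_self_eq_norm_sq, ← real_inner_self_eq_norm_sq, ← real_inner_self_eq_norm_sq]
  rfl

lemma norm_toL2_le (u : H1 N) : ‖u.toL2‖ ≤ ‖u‖ :=
  le_of_sq_le_sq (by rw [norm_sq]; linarith [sq_nonneg ‖grad u.toL2‖]) (norm_nonneg _)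

lemma norm_grad_le (u : H1 N) : ‖grad u.toL2‖ ≤ ‖u‖ :=
  le_of_sq_le_sq (by rw [norm_sq]; linarith [sq_nonneg ‖u.toL2‖]) (norm_nonneg _)

lemma norm_le (u : H1 N) : ‖u‖ ≤ ‖u.toL2‖ + ‖grad u.toL2‖ :=
  le_of_sq_le_sq (by
    rw [norm_sq]
    nlinarith [mul_nonneg (norm_nonneg u.toL2) (norm_nonneg (grad u.toL2))]) (by positivity)

end H1

/-- Converts componentwise closeness of representatives into norms of classes; the factor N comes
from summing the components of the gradient. -/
lemma norm_sub_testL2_le {N : ℕ} {ρ : E N → ℝ} {u : L2 N} {w : L2v N} (h : IsGrad u w)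
    {φ : TestFun N} {ε : ℝ} (hε : 0 ≤ ε)
    (hφ : WeightedH1Close ρ (ENNReal.ofReal ε) u (fun j x => w x j) φ
      fun j x => fderiv ℝ φ x (basisVec j)) :
    ‖u - testL2 φ‖ ≤ ε ∧ ‖grad (u - testL2 φ)‖ ≤ N * ε := by
  have e1 : ∀ x y : ℂ, ‖x - y‖ = ‖y - x‖ := fun x y => norm_sub_rev x y
  constructor
  · rw [← ENNReal.ofReal_le_ofReal_iff hε, ofReal_norm, Lp.enorm_def]
    refine le_trans (le_of_eq (eLpNorm_congr_norm_ae ?_)) hφ.fst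
    filter_upwards [Lp.coeFn_sub u (testL2 φ), (memLp_test φ).coeFn_toLp] with x hx hx'
    rw [hx, Pi.sub_apply, testL2, hx', e1]
  · have hg := h.add ((isGrad_test φ).smul (-1))
    rw [neg_one_smul, neg_one_smul, ← sub_eq_add_neg, ← sub_eq_add_neg] at hg
    rw [hg.grad_eq, ← ENNReal.ofReal_le_ofReal_iff (by positivity), ofReal_norm]
    refine (enorm_L2v_le_sum _).trans ?_
    have hj : ∀ j, eLpNorm (fun x => (w - (memLp_testMagGradFun memLpLoc_zero φ).toLp _ : L2v N) x j)
        2 volume ≤ ENNReal.ofReal ε := fun j => by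
      refine le_trans (le_of_eq (eLpNorm_congr_norm_ae ?_)) (hφ.deriv j)
      filter_upwards [Lp.coeFn_sub w ((memLp_testMagGradFun memLpLoc_zero φ).toLp _),
        (memLp_testMagGradFun memLpLoc_zero φ).coeFn_toLp] with x hx hx'
      rw [hx, Pi.sub_apply, hx', e1]
      simp [testMagGradFun]
    refine (Finset.sum_le_sum fun j _ => hj j).trans ?_
    rw [ENNReal.ofReal_mul (by positivity), ENNReal.ofReal_natCast]
    simp

lemma denseRange_testToH1 (N : ℕ) : DenseRange (testToH1 N) := by
  rw [Metric.denseRange_iff]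
  intro u r hr
  let ε : ℝ := r / (2 * (1 + N))
  have hε : 0 < ε := by positivity
  have hu := isGrad_grad u.2
  obtain ⟨φ, hφ⟩ := exists_close_test (fun _ _ => MemLp.zero) aestronglyMeasurable_zero
    (memWeightedH1_of_isGrad hu) (ε := ENNReal.ofReal ε) (by simpa using hε)
  obtain ⟨h1, h2⟩ := norm_sub_testL2_le hu hε.le hφ
  refine ⟨φ, ?_⟩
  rw [dist_eq_norm]
  have h3 := H1.norm_le (u - testToH1 N φ)
  change _ ≤ ‖u.toL2 - testL2 φ‖ + ‖grad (u.toL2 - testL2 φ)‖ at h3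
  have h4 : ε * (1 + N) = r / 2 := by simp only [ε]; field_simp
  have h1' : ‖u.toL2 - testL2 φ‖ ≤ ε := h1
  have h2' : ‖grad (u.toL2 - testL2 φ)‖ ≤ N * ε := h2
  linarith

/-! ### The magnetic Laplacian as an element of the dual of `H¹` -/

/-- Moving the derivative to φ is the definition of the distributional derivative. The factors -i of
the operator and of the field combine so that w_j is paired with the j-th component of ∇φ + iAφ.
Integrability is recorded for the sum over j. -/
lemma momentum_apply {N : ℕ} {A : E N → E N} (hA : MemLpLoc A 2) (w : L2v N) (j : Fin N)
    (φ : TestFun N) : Integrable (fun x => (inner ℝ (w x j)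
        (fderiv ℝ φ x (basisVec j) + Complex.I * (A x j : ℂ) * φ x) : ℝ)) volume ∧
    momentum A j (fun x => -Complex.I * w x j) φ =
      ∫ x, inner ℝ (w x j) (fderiv ℝ φ x (basisVec j) + Complex.I * (A x j : ℂ) * φ x) := by
  have hf2 : MemLpLoc (fun x => -Complex.I * w x j) 2 := fun K hK =>
    (memLpLoc_L2v w j K hK).const_mul _
  have hf := locInt_of_memLpLoc hf2
  have hAf := locInt_mul hA hf2 j
  let ψ : TestFun N := TestFunction.lineDerivCLM ℝ (basisVec j)
    (TestFunction.postcompCLM (ContinuousLinearMap.mul ℝ ℂ (conj (-Complex.I))) φ : TestFun N)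
  have hψ : ∀ x, ψ x = Complex.I * fderiv ℝ φ x (basisVec j) := fun x => by
    have e1 : ψ x = fderiv ℝ (fun y => conj (-Complex.I) * φ y) x (basisVec j) := by
      simp only [ψ, TestFunction.lineDerivCLM_eq_fderivCLM]
      simp
      rfl
    rw [e1, fderiv_const_mul (φ.contDiff.differentiable (by simp)).differentiableAt]
    simp
  have i1 := integrable_toDistr hf ψ
  have i2 := integrable_toDistr hAf φ
  have e : ∀ x, inner ℝ (w x j) (fderiv ℝ φ x (basisVec j) + Complex.I * (A x j : ℂ) * φ x) =
      -((-Complex.I * w x j) * conj (ψ x)).re +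
        ((A x j : ℂ) * (-Complex.I * w x j) * conj (φ x)).re := fun x => by
    rw [hψ, Complex.inner]
    simp
    ring
  simp_rw [e]
  refine ⟨i1.neg.add i2, ?_⟩
  refine Eq.trans ?_ (integral_add i1.neg i2).symm
  rw [integral_neg', momentum, add_apply, distrSMul_apply, distrDeriv_apply,
    toDistr_apply hf, toDistr_apply hAf]

/-- Valid for every u in L², because both sides involve only the L² field `magGrad A u`, even when
it is the default value 0. -/
lemma negMagLaplacian_apply {N : ℕ} {A : E N → E N} (hA : MemLpLoc A 2) (u : L2 N)
    (φ : TestFun N) :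
    negMagLaplacian A u φ = inner ℝ (magGrad A u) (magGrad A (testL2 φ)) := by
  rw [(isMagGrad_test hA φ).magGrad_eq, L2.inner_def]
  have e : ∫ x, inner ℝ (magGrad A u x) (((memLp_testMagGradFun hA φ).toLp _ : L2v N) x) =
      ∫ x, ∑ j, inner ℝ (magGrad A u x j)
        (fderiv ℝ φ x (basisVec j) + Complex.I * (A x j : ℂ) * φ x) := by
    refine integral_congr_ae ?_
    filter_upwards [(memLp_testMagGradFun hA φ).coeFn_toLp] with x hx
    rw [hx, PiLp.inner_apply]
    rfl
  rw [e, integral_finsetSum _ fun j _ => (momentum_apply hA (magGrad A u) j φ).1, negMagLaplacian,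
    sum_apply]
  exact Finset.sum_congr rfl fun j _ => (momentum_apply hA (magGrad A u) j φ).2

section Duality

variable {N : ℕ} {A : E N → E N}

lemma H1.exists_isMagGrad (hA : MemLpLoc A 2) {C : NNReal} (hC : IsMultiplierBound A C) (u : H1 N) :
    ∃ w, IsMagGrad A u.toL2 w :=
  ((isGrad_grad u.2).exists_isMagGrad hA hC).imp fun _ h => h.1

lemma H1.norm_magGrad_le (hA : MemLpLoc A 2) {C : NNReal} (hC : IsMultiplierBound A C)
    (u : H1 N) : ‖magGrad A u.toL2‖ ≤ gradConst N C * 2 * ‖u‖ := by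
  obtain ⟨w, hw, hn⟩ := (isGrad_grad u.2).exists_isMagGrad hA hC
  have e : magGrad A u.toL2 = w := hw.magGrad_eq
  rw [e, mul_assoc]
  refine hn.trans (mul_le_mul_of_nonneg_left ?_ gradConst_nonneg)
  have h1 := u.norm_toL2_le
  have h2 := u.norm_grad_le
  change ‖u.toL2‖ + ‖grad u.toL2‖ ≤ _
  linarith

/-- The magnetic gradient as a continuous linear map on `H¹`. -/
def H1.magGradCLM (hA : MemLpLoc A 2) {C : NNReal} (hC : IsMultiplierBound A C) :
    H1 N →L[ℝ] L2v N :=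
  LinearMap.mkContinuous
    { toFun := fun u => magGrad A u.toL2
      map_add' := fun u v => ((isMagGrad_magGrad (u.exists_isMagGrad hA hC)).add hA
        (isMagGrad_magGrad (v.exists_isMagGrad hA hC))).magGrad_eq
      map_smul' := fun c u =>
        ((isMagGrad_magGrad (u.exists_isMagGrad hA hC)).smul hA c).magGrad_eq }
    (gradConst N C * 2) (H1.norm_magGrad_le hA hC)

/-- The functional `v ↦ ⟪∇_A u, ∇_A v⟫`. -/
def H1.magForm (hA : MemLpLoc A 2) {C : NNReal} (hC : IsMultiplierBound A C) (u : H1 N) :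
    HNeg1 N :=
  innerSL ℝ (magGrad A u.toL2) ∘L H1.magGradCLM hA hC

lemma H1.toDistr_magForm (hA : MemLpLoc A 2) {C : NNReal} (hC : IsMultiplierBound A C)
    (u : H1 N) : HNeg1.toDistr (H1.magForm hA hC u) = negMagLaplacian A u.toL2 := by
  ext φ
  rw [negMagLaplacian_apply hA]
  rfl

/-- Two continuous functionals that agree on the dense range of test functions coincide. -/
lemma HNeg1.toDistr_injective : Function.Injective (HNeg1.toDistr (N := N)) := by
  intro S S' h
  have h1 : (S : H1 N → ℝ) ∘ testToH1 N = S' ∘ testToH1 N := by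
    ext φ
    exact congrArg (fun T : Distr N => T φ) h
  exact DFunLike.coe_injective ((denseRange_testToH1 N).equalizer S.continuous S'.continuous h1)

end Duality

/-! ### Comparison of `H¹_{A,V}` and `H¹` -/

namespace H1AV

variable {N : ℕ} {A : E N → E N} {V : E N → ℝ} {hA : MemLpLoc A 2} {hV : ElectricCondition V}

lemma norm_sq (u : H1AV A V hA hV) :
    ‖u‖ ^ 2 = (∫ x, V x * ‖u.toL2 x‖ ^ 2) + ‖magGrad A u.toL2‖ ^ 2 := by
  rw [← real_inner_self_eq_norm_sq, ← real_inner_self_eq_norm_sq, ← re_integral_self]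
  rfl

lemma integral_nonneg (u : H1AV A V hA hV) : 0 ≤ ∫ x, V x * ‖u.toL2 x‖ ^ 2 := by
  obtain ⟨ν, hν, hVν⟩ := hV.2
  refine integral_nonneg_of_ae ?_
  filter_upwards [hVν] with x hx
  exact mul_nonneg (hν.le.trans hx) (sq_nonneg _)

lemma norm_magGrad_le (u : H1AV A V hA hV) : ‖magGrad A u.toL2‖ ≤ ‖u‖ :=
  le_of_sq_le_sq (by rw [norm_sq]; linarith [u.integral_nonneg]) (norm_nonneg _)

lemma integrable_weight (u : H1AV A V hA hV) : Integrable (fun x => V x * ‖u.toL2 x‖ ^ 2) volume := by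
  obtain ⟨ν, hν, hVν⟩ := hV.2
  refine u.2.1.norm.congr ?_
  filter_upwards [hVν] with x hx
  rw [norm_mul, norm_pow, Complex.norm_real, Real.norm_of_nonneg (hν.le.trans hx)]
  rfl

/-- The norm of H¹_{A,V} has no separate L² term; the lower bound ν of V supplies it. -/
lemma norm_toL2_le {ν : ℝ} (hν : 0 < ν) (hVν : ∀ᵐ x, ν ≤ V x) (u : H1AV A V hA hV) :
    ‖u.toL2‖ ≤ (√ν)⁻¹ * ‖u‖ := by
  have e : ‖u.toL2‖ ^ 2 = ∫ x, ‖u.toL2 x‖ ^ 2 := by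
    rw [← real_inner_self_eq_norm_sq, L2.inner_def]
    simp_rw [real_inner_self_eq_norm_sq]
  have h1 : ν * ‖u.toL2‖ ^ 2 ≤ ‖u‖ ^ 2 := by
    rw [norm_sq, e, ← integral_const_mul]
    refine le_trans (integral_mono_of_nonneg (Eventually.of_forall fun x => by positivity)
      u.integrable_weight ?_) (le_add_of_nonneg_right (sq_nonneg _))
    filter_upwards [hVν] with x hx
    exact mul_le_mul_of_nonneg_right hx (sq_nonneg _)
  have hs : 0 < √ν := Real.sqrt_pos.2 hν
  rw [← div_eq_inv_mul, le_div_iff₀ hs]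
  refine le_of_sq_le_sq ?_ (norm_nonneg _)
  rw [mul_pow, Real.sq_sqrt hν.le]
  linarith

lemma exists_isGrad {C : NNReal} (hC : IsMultiplierBound A C) (u : H1AV A V hA hV) :
    ∃ w, IsGrad u.toL2 w :=
  ((isMagGrad_magGrad u.2.2).exists_isGrad hA hC).imp fun _ h => h.1

lemma norm_grad_le {C : NNReal} (hC : IsMultiplierBound A C) (u : H1AV A V hA hV) :
    ‖grad u.toL2‖ ≤ gradConst N C * (‖u.toL2‖ + ‖magGrad A u.toL2‖) := by
  obtain ⟨w, hw, hn⟩ := (isMagGrad_magGrad u.2.2).exists_isGrad hA hC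
  have e : grad u.toL2 = w := hw.grad_eq
  rw [e]
  exact hn

lemma exists_norm_bound {C : NNReal} (hC : IsMultiplierBound A C) : ∃ K : ℝ,
    ∀ u : H1AV A V hA hV, ‖u.toL2‖ + ‖grad u.toL2‖ ≤ K * ‖u‖ := by
  obtain ⟨ν, hν, hVν⟩ := hV.2
  refine ⟨(√ν)⁻¹ + gradConst N C * ((√ν)⁻¹ + 1), fun u => ?_⟩
  have h1 := u.norm_toL2_le hν hVν
  have h2 := u.norm_grad_le hC
  have h3 := u.norm_magGrad_le
  have h4 : gradConst N C * (‖u.toL2‖ + ‖magGrad A u.toL2‖) ≤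
      gradConst N C * ((√ν)⁻¹ * ‖u‖ + ‖u‖) :=
    mul_le_mul_of_nonneg_left (add_le_add h1 h3) gradConst_nonneg
  nlinarith

/-- The inclusion of `H¹_{A,V}` into `H¹`. -/
def toH1 {C : NNReal} (hC : IsMultiplierBound A C) : H1AV A V hA hV →L[ℝ] H1 N :=
  LinearMap.mkContinuous
    { toFun := fun u => ⟨u.toL2, u.exists_isGrad hC⟩
      map_add' := fun _ _ => rfl
      map_smul' := fun _ _ => rfl }
    (exists_norm_bound hC).choose
    fun u => (H1.norm_le _).trans ((exists_norm_bound hC).choose_spec u)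

/-- Test functions are dense in `H¹_{A,V}`. -/
lemma denseRange_test {C : NNReal} (hC : IsMultiplierBound A C) :
    DenseRange (testToH1AV A V hA hV) := by
  rw [Metric.denseRange_iff]
  intro u r hr
  obtain ⟨ν, hν, hVν⟩ := hV.2
  -- With this weight the potential energy is the squared L² norm of ρu, and ρ is in L²_loc because
  -- V is in L¹_loc.
  let ρ : E N → ℝ := fun x => √(V x)
  have hρm : AEStronglyMeasurable ρ volume :=
    Real.continuous_sqrt.comp_aestronglyMeasurable hV.1.aestronglyMeasurable
  have hρsq : ∀ᵐ x, ρ x ^ 2 = V x := by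
    filter_upwards [hVν] with x hx
    exact Real.sq_sqrt (hν.le.trans hx)
  have hρ : ∀ K : Set (E N), IsCompact K → MemLp ρ 2 (volume.restrict K) := fun K hK => by
    rw [memLp_two_iff_integrable_sq hρm.restrict]
    exact (hV.1.integrableOn_isCompact hK).congr
      (ae_restrict_of_ae (hρsq.mono fun x hx => hx.symm))
  have hwt : ∀ v : H1AV A V hA hV, (fun x => ‖ρ x • v.toL2 x‖ ^ 2) =ᵐ[volume]
      fun x => V x * ‖v.toL2 x‖ ^ 2 := fun v => by
    filter_upwards [hρsq] with x hx
    rw [norm_smul, mul_pow, Real.norm_eq_abs, sq_abs, hx]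
  have hmem : ∀ v : H1AV A V hA hV, MemLp (fun x => ρ x • v.toL2 x) 2 volume := fun v => by
    refine (memLp_two_iff_integrable_sq_norm
      (hρm.smul (Lp.aestronglyMeasurable v.toL2))).2 ?_
    exact v.integrable_weight.congr (hwt v).symm
  have hg := isGrad_grad (u.exists_isGrad hC)
  have hmw := memWeightedH1_of_isGrad hg
  -- The potential part contributes ε to the error, and the magnetic part `gradConst N C` times ε +
  -- Nε; hence εK = r/2 in total.
  let K : ℝ := 1 + gradConst N C * (1 + N)
  have hK : 0 < K := by
    have := gradConst_nonneg (N := N) (C := C)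
    positivity
  let ε : ℝ := r / (2 * K)
  have hε : 0 < ε := by positivity
  obtain ⟨φ, hφ⟩ := exists_close_test hρ hρm
    ⟨hmw.memLp, hmw.memLp_deriv, hmw.weak, hmem u⟩ (ε := ENNReal.ofReal ε) (by simpa using hε)
  obtain ⟨h1, h2⟩ := norm_sub_testL2_le hg hε.le hφ
  refine ⟨φ, ?_⟩
  rw [dist_eq_norm]
  set z : H1AV A V hA hV := u - testToH1AV A V hA hV φ with hz
  have hzL : z.toL2 = u.toL2 - testL2 φ := rfl
  rw [← hzL] at h1 h2
  -- It is ∇u that was approximated; the multiplier bound turns smallness of z in H¹ into smallness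
  -- of ∇_A z.
  obtain ⟨w, hw, hn⟩ := (isGrad_grad (z.exists_isGrad hC)).exists_isMagGrad hA hC
  rw [← hw.magGrad_eq] at hn
  have hmag : ‖magGrad A z.toL2‖ ≤ gradConst N C * (1 + N) * ε := by
    refine hn.trans ?_
    rw [mul_assoc]
    refine mul_le_mul_of_nonneg_left ?_ gradConst_nonneg
    linarith
  have hV2 : ∫ x, V x * ‖z.toL2 x‖ ^ 2 ≤ ε ^ 2 := by
    have e1 : eLpNorm (fun x => ρ x • z.toL2 x) 2 volume ≤ ENNReal.ofReal ε := by
      refine le_trans (le_of_eq (eLpNorm_congr_norm_ae ?_)) hφ.weight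
      filter_upwards [Lp.coeFn_sub u.toL2 (testL2 φ), (memLp_test φ).coeFn_toLp] with x hx hx'
      rw [hzL, hx, Pi.sub_apply, testL2, hx', ← smul_sub, norm_smul, norm_smul, norm_sub_rev]
    have e2 := pow_le_pow_left₀ (zero_le) e1 2
    rw [eLpNorm_two_sq, ← ENNReal.ofReal_pow hε.le] at e2
    rw [← integral_congr_ae (hwt z), integral_eq_lintegral_of_nonneg_ae
      (Eventually.of_forall fun x => sq_nonneg _) ((hmem z).1.norm.pow 2)]
    refine ENNReal.toReal_le_of_le_ofReal (sq_nonneg ε) (le_trans (le_of_eq ?_) e2)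
    refine lintegral_congr fun x => ?_
    rw [ENNReal.ofReal_pow (norm_nonneg _), ofReal_norm]
  have hfin : ‖z‖ ≤ ε + gradConst N C * (1 + N) * ε := by
    have hnn : 0 ≤ gradConst N C * (1 + N) * ε :=
      mul_nonneg (mul_nonneg gradConst_nonneg (by positivity)) hε.le
    refine le_of_sq_le_sq ?_ (by positivity)
    rw [norm_sq]
    have h5 := pow_le_pow_left₀ (norm_nonneg _) hmag 2
    nlinarith [mul_nonneg hε.le hnn]
  have h6 : ε * K = r / 2 := by simp only [ε]; field_simp
  have h7 : ε + gradConst N C * (1 + N) * ε = ε * K := by simp only [K]; ring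
  linarith

end H1AV

lemma HNeg1AV.toDistr_injective {N : ℕ} {A : E N → E N} {V : E N → ℝ} {hA : MemLpLoc A 2}
    {hV : ElectricCondition V} {C : NNReal} (hC : IsMultiplierBound A C) :
    Function.Injective (HNeg1AV.toDistr (A := A) (V := V) (hA := hA) (hV := hV)) := by
  intro S S' h
  have h1 : (S : H1AV A V hA hV → ℝ) ∘ testToH1AV A V hA hV = S' ∘ testToH1AV A V hA hV := by
    ext φ
    exact congrArg (fun T : Distr N => T φ) h
  exact DFunLike.coe_injective
    ((H1AV.denseRange_test hC).equalizer S.continuous S'.continuous h1)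

end MagneticSobolev

end

/-! ### The theorem -/

theorem mainTheorem10 {N : ℕ} (hN : 1 ≤ N) (A : E N → E N) (hA : MemLpLoc A 2)
    (hA' : MagneticCondition A) :
    (∀ u : H1 N,
      (∃ w, IsMagGrad A u.toL2 w) ∧
      (∃! S : HNeg1 N, HNeg1.toDistr S = negMagLaplacian A u.toL2) ∧
      ∀ S : HNeg1 N, HNeg1.toDistr S = negMagLaplacian A u.toL2 →
        ∀ v : H1 N, S v = inner ℝ (magGrad A u.toL2) (magGrad A v.toL2)) ∧
    (∀ (V : E N → ℝ) (hV : ElectricCondition V) (T : HNeg1 N),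
      (∃! T' : HNeg1AV A V hA hV, HNeg1AV.toDistr T' = HNeg1.toDistr T) ∧
      ∀ T' : HNeg1AV A V hA hV, HNeg1AV.toDistr T' = HNeg1.toDistr T →
        ∀ u : H1AV A V hA hV, ∃ u' : H1 N, u'.toL2 = u.toL2 ∧ T' u = T u') := by
  obtain ⟨C, hC⟩ := exists_multiplier_bound hN hA hA'
  refine ⟨fun u => ?_, fun V hV T => ?_⟩
  · have hS := H1.toDistr_magForm hA hC u
    refine ⟨u.exists_isMagGrad hA hC, ⟨H1.magForm hA hC u, hS, fun S h =>
      HNeg1.toDistr_injective (h.trans hS.symm)⟩, fun S h v => ?_⟩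
    rw [HNeg1.toDistr_injective (h.trans hS.symm)]
    rfl
  · have hT : HNeg1AV.toDistr (T ∘L H1AV.toH1 (hA := hA) (hV := hV) hC) = HNeg1.toDistr T := rfl
    refine ⟨⟨T ∘L H1AV.toH1 hC, hT, fun T' h =>
      HNeg1AV.toDistr_injective hC (h.trans hT.symm)⟩, fun T' h u => ⟨H1AV.toH1 hC u, rfl, ?_⟩⟩
    rw [HNeg1AV.toDistr_injective hC (h.trans hT.symm)]
    rfl
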